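/- **Setting.** Let $\mathcal A=(\mathfrak D,\Psi,[\![\_]\!],\bot,\top,\sqcup,\sqcap,{}^c)$ be an effective Boolean algebra: a nonempty (possibly infinite) set $\mathfrak D$ of letters and a set $\Psi$ of predicates, closed under the connectives, with denotations $[\![\alpha]\!]\subseteq\mathfrak D$ such that $[\![\bot]\!]=\emptyset$, $[\![\top]\!]=\mathfrak D$ and $\sqcup,\sqcap,{}^c$ denote union, intersection and complement. *Transition terms* over a set $\Lambda$ of leaves are nested if-then-else terms $f::=\ell\mid(\alpha\,?\,f:f)$ with $\ell\in\Lambda$, $\alpha\in\Psi$; $f(a)$ is the leaf selected by the letter $a$, and operations on leaves are lifted to transition terms leafwise. An *alternating Büchi automaton* (ABA) modulo $\mathcal A$ has a finite set $Q$ of states, an initial combination in $\mathcal B^+(Q)$ (positive Boolean combinations of states), a transition function $\varrho$ from $Q$ to transition terms with leaves in $\mathcal B^+(Q)$, and a set $F\subseteq Q$ of accepting states. A run for $w\in\mathfrak D^\omega$ from $q$ is a $Q$-labelled tree with root label $q$ in which the children of each node at depth $n$ with label $p$ are labelled by the members of some $X$ in the disjunctive normal form (a set of sets of states) of $\varrho(p)(w_n)$;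 it is accepting if each of its infinite branches visits $F$ infinitely often. $L(M)$ is obtained by lifting the languages of the states to the initial combination ($\lor$ as union, $\land$ as intersection). $M$ is *nondeterministic* if $\land$ occurs neither in the initial combination nor in $\varrho$. A set $L\subseteq\mathfrak D^\omega$ is *$\omega_{\mathcal A}$-regular* if $L=L(M)$ for some nondeterministic $M$. *Extended regular expressions* are $R::=\alpha\mid\varepsilon\mid R|R\mid R\,\&\,R\mid R\cdot R\mid R^*\mid{\sim}R$ with the usual languages $\mathcal L(R)\subseteq\mathfrak D^*$, where $\alpha\in\Psi$ denotes the one-letter words in $[\![\alpha]\!]$. $R$ is nullable if $\epsilon\in\mathcal L(R)$, and alive if $\mathcal L(R)\ne\emptyset$, otherwise dead. Their symbolic derivatives are the transition terms $\delta(\varepsilon)=\bot$, $\delta(\alpha)=(\alpha\,?\,\varepsilon:\bot)$, $\delta(R|S)=\delta(R)|\delta(S)$, $\delta(R\&S)=\delta(R)\&\delta(S)$, $\delta({\sim}R)={\sim}\delta(R)$, $\delta(R^*)=\delta(R)\cdot R^*$, and $\delta(R\cdot S)=\delta(R)\cdot S\,|\,\delta(S)$ if $R$ is nullable, $\delta(R\cdot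 S)=\delta(R)\cdot S$ otherwise. $\mathrm{One}(R)$ is the predicate, computed from $\delta(R)$, that denotes the letters $a$ with $a\in\mathcal L(R)$. *Positive RLTL formulas* are $\phi::=\alpha\mid\phi\lor\phi\mid\phi\land\phi\mid\mathsf X\phi\mid\phi\,\mathsf U\,\phi\mid\phi\,\mathsf R\,\phi\mid R\mathbin{\diamond\!\!\to}\phi\mid R\mathbin{\square\!\!\to}\phi\mid\{R\}\mid\overline{\{R\}}\mid R^\omega$. For $w\in\mathfrak D^\omega$, $w\models\alpha$ iff $w_0\in[\![\alpha]\!]$; $\lor,\land,\mathsf X,\mathsf U,\mathsf R$ are as in LTL; $w\models R\mathbin{\diamond\!\!\to}\phi$ iff there are $u,v$ with $w=uv$, $uv_0\in\mathcal L(R)$ and $v\models\phi$; $w\models R\mathbin{\square\!\!\to}\phi$ iff $v\models\phi$ for all $u,v$ with $w=uv$ and $uv_0\in\mathcal L(R)$; $w\models\{R\}$ iff some finite prefix of $w$ (possibly empty) is in $\mathcal L(R)$ or every nonempty finite prefix of $w$ extends to a word of $\mathcal L(R)$; $w\models\overline{\{R\}}$ iff $w\not\models\{R\}$; $w\models R^\omega$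 iff $w\in(\mathcal L(R)\setminus\{\epsilon\})^\omega$. Let $L(\phi)=\{w\mid w\models\phi\}$. The formulas true and false are $\top,\bot\in\Psi$. *Derivatives of formulas* are the transition terms $\partial\alpha=(\alpha\,?\,\top:\bot)$, $\partial(\phi\lor\psi)=\partial\phi\lor\partial\psi$, $\partial(\phi\land\psi)=\partial\phi\land\partial\psi$, $\partial(\mathsf X\phi)=\phi$, $\partial(\phi\,\mathsf U\,\psi)=\partial\psi\lor(\partial\phi\land(\phi\,\mathsf U\,\psi))$, $\partial(\phi\,\mathsf R\,\psi)=\partial\psi\land(\partial\phi\lor(\phi\,\mathsf R\,\psi))$, $\partial(R\mathbin{\diamond\!\!\to}\phi)=(\partial\,\mathrm{One}(R)\land\partial\phi)\lor(\delta(R)\mathbin{\diamond\!\!\to}\phi)$, $\partial(R\mathbin{\square\!\!\to}\phi)=(\partial(\mathrm{One}(R)^c)\lor\partial\phi)\land(\delta(R)\mathbin{\square\!\!\to}\phi)$, $\partial\{R\}=\top$ if $R$ is nullable and $\{\delta(R)\}$ otherwise, $\partial\overline{\{R\}}=\bot$ if $R$ is nullable and $\overline{\{\delta(R)\}}$ otherwise,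 and $\partial(R^\omega)=\partial(R\mathbin{\diamond\!\!\to}\mathsf X R^\omega)$. *The automaton $M[\phi]$.* Its initial state is $\phi$. Its set $Q$ of states is the least set of formulas such that $\phi\in Q$ and, for $q\in Q$, all predicates and modal (i.e. not $\lor$, $\land$) formulas among the subformulas of leaves of $\varrho(q)$ are in $Q$. Here $\varrho(q)$ is a transition term such that for all $q\in Q$ and letters $a$ the formula $\varrho(q)(a)$ is a simplification of $\partial q(a)$, where leaves (read as positive Boolean combinations of predicates and modal formulas) may be simplified by equivalence of positive Boolean combinations, by language preserving rewriting of the regular expression $R$ in $R\mathbin{\diamond\!\!\to}\psi$, $R\mathbin{\square\!\!\to}\psi$, $\{R\}$ and $\overline{\{R\}}$, and by the rules $r\mathbin{\diamond\!\!\to}\psi\rightsquigarrow\bot$ and $r\mathbin{\square\!\!\to}\psi\rightsquigarrow\top$ for $r\in\{\bot,\varepsilon\}$, $\{\bot\}\rightsquigarrow\bot$, $\overline{\{\bot\}}\rightsquigarrow\top$, and $\{r\}\rightsquigarrow\top$, $\overline{\{r\}}\rightsquigarrow\bot$ for nullable $r$. The accepting states are the members of $Q$ that are $\top$, or of the form $\phi_1\,\mathsf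 R\,\phi_2$, $R\mathbin{\square\!\!\to}\psi$, $R^\omega$, $\{R\}$ with $R$ alive, or $\overline{\{R\}}$ with $R$ dead. **Theorem.** 1. A language $L\subseteq\mathfrak D^\omega$ is $\omega_{\mathcal A}$-regular if and only if $L=L(\phi)$ for some positive RLTL formula $\phi$. 2. For every positive RLTL formula $\phi$, the automaton $M[\phi]$ exists, that is, $\varrho$ can be chosen such that $Q$ is finite; and $L(\phi)=L(M[\phi])$ for every choice of $\varrho$ for which $Q$ is finite. -/

import Mathlib

universe u v w

/-- A Boolean algebra of predicates `Ψ` over a domain `D` of letters (the element algebra). -/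
structure EBA (D : Type u) (Ψ : Type v) where
  den : Ψ → Set D
  bot : Ψ
  top : Ψ
  or : Ψ → Ψ → Ψ
  and : Ψ → Ψ → Ψ
  not : Ψ → Ψ
  den_bot : den bot = ∅
  den_top : den top = Set.univ
  den_or : ∀ α β, den (or α β) = den α ∪ den β
  den_and : ∀ α β, den (and α β) = den α ∩ den β
  den_not : ∀ α, den (not α) = (den α)ᶜ

/-! ### Transition terms -/

/-- Transition terms: nested if-then-else terms with conditions in `Ψ` and leaves in `S`. -/
inductive TT (Ψ : Type v) (S : Type w) where
  | leaf (s : S) : TT Ψ S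
  | ite (α : Ψ) (f g : TT Ψ S) : TT Ψ S

namespace TT

variable {D : Type u} {Ψ : Type v} {S S₁ S₂ S₃ : Type w}

open Classical in
/-- The leaf of a transition term selected by the letter `a`. -/
noncomputable def leafOf (A : EBA D Ψ) (a : D) : TT Ψ S → S
  | leaf s => s
  | ite α f g => if a ∈ A.den α then leafOf A a f else leafOf A a g

/-- The set of all leaves of a transition term. -/
def leaves : TT Ψ S → Set S
  | leaf s => {s}
  | ite _ f g => leaves f ∪ leaves g

/-- Lifting of a unary operation on leaves. -/
def map (op : S₁ → S₂) : TT Ψ S₁ → TT Ψ S₂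
  | leaf s => leaf (op s)
  | ite α f g => ite α (map op f) (map op g)

/-- Lifting of a binary operation on leaves. -/
def map₂ (op : S₁ → S₂ → S₃) : TT Ψ S₁ → TT Ψ S₂ → TT Ψ S₃
  | leaf s, h => map (op s) h
  | ite α f g, h => ite α (map₂ op f h) (map₂ op g h)

end TT

/-! ### Positive Boolean combinations -/

/-- Positive Boolean combinations of elements of `S`. -/
inductive BCp (S : Type w) where
  | atom (s : S) : BCp S
  | tt : BCp S
  | ff : BCp S
  | and (f g : BCp S) : BCp S
  | or (f g : BCp S) : BCp S

namespace BCp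

variable {S : Type w}

/-- The set of elements that occur in a combination. -/
def atoms : BCp S → Set S
  | atom s => {s}
  | tt => ∅
  | ff => ∅
  | and f g => atoms f ∪ atoms g
  | or f g => atoms f ∪ atoms g

/-- Evaluation under a predicate on the elements; it gives both satisfaction by a set of elements
and the lifting of languages from elements to combinations. -/
def Sat (V : S → Prop) : BCp S → Prop
  | atom s => V s
  | tt => True
  | ff => False
  | and f g => Sat V f ∧ Sat V g
  | or f g => Sat V f ∨ Sat V g

/-- Disjunctive normal form as a set of sets. -/
def dnf : BCp S → Set (Set S)
  | atom s => {{s}}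
  | tt => {∅}
  | ff => ∅
  | and f g => {Z | ∃ X ∈ dnf f, ∃ Y ∈ dnf g, Z = X ∪ Y}
  | or f g => dnf f ∪ dnf g

/-- Conjunction does not occur. -/
def NoAnd : BCp S → Prop
  | atom _ => True
  | tt => True
  | ff => True
  | and _ _ => False
  | or f g => NoAnd f ∧ NoAnd g

end BCp

/-! ### Alternating Büchi automata -/

/-- Alternating Büchi automata with transition terms over the predicates `Ψ`; the finite set of
states is a set of elements of `S` (values of `tf` outside of `Q` are irrelevant). The Boolean
constants are constants of `BCp S`, not states: a run branch ends in `tt`, and never enters `ff`. -/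
structure ABA (Ψ : Type v) (S : Type w) where
  Q : Set S
  finite_Q : Q.Finite
  init : BCp S
  init_mem : init.atoms ⊆ Q
  tf : S → TT Ψ (BCp S)
  tf_mem : ∀ q ∈ Q, ∀ l ∈ (tf q).leaves, l.atoms ⊆ Q
  F : Set S
  F_subset : F ⊆ Q

/-- A (possibly infinite) tree with nodes labelled in `S`. A node is the list of child indices on
the path to it from the root `[]`. -/
structure LTree (S : Type w) where
  nodes : Set (List ℕ)
  root_mem : [] ∈ nodes
  parent_mem : ∀ u i, u ++ [i] ∈ nodes → u ∈ nodes
  label : List ℕ → S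

namespace LTree

variable {S : Type w}

/-- `b` is an infinite branch from the root: its `n`-th node is `[b 0, ..., b (n - 1)]`. -/
def IsBranch (τ : LTree S) (b : ℕ → ℕ) : Prop :=
  ∀ n, (List.range n).map b ∈ τ.nodes

/-- Every infinite branch visits `F` infinitely often. -/
def Accepting (τ : LTree S) (F : Set S) : Prop :=
  ∀ b, τ.IsBranch b → ∀ m, ∃ n ≥ m, τ.label ((List.range n).map b) ∈ F

end LTree

namespace ABA

variable {D : Type u} {Ψ : Type v} {S : Type w}

/-- `τ` is a run for the word `x` from the state `q`: at each node, the labels of the children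
are exactly the members of some `X` in the DNF of the transition for the letter at that depth. -/
structure IsRun (A : EBA D Ψ) (M : ABA Ψ S) (x : Stream' D) (q : S) (τ : LTree S) : Prop where
  label_root : τ.label [] = q
  step : ∀ u ∈ τ.nodes, ∃ X ∈ ((M.tf (τ.label u)).leafOf A (x.get u.length)).dnf,
    (∀ p ∈ X, ∃ i, u ++ [i] ∈ τ.nodes ∧ τ.label (u ++ [i]) = p) ∧
    (∀ i, u ++ [i] ∈ τ.nodes → τ.label (u ++ [i]) ∈ X)

/-- The word `x` is accepted from the state `q`. -/
def AcceptsFrom (A : EBA D Ψ) (M : ABA Ψ S) (x : Stream' D) (q : S) : Prop :=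
  ∃ τ : LTree S, M.IsRun A x q τ ∧ τ.Accepting M.F

/-- The language of the automaton. -/
def lang (A : EBA D Ψ) (M : ABA Ψ S) : Set (Stream' D) :=
  {x | M.init.Sat (M.AcceptsFrom A x)}

/-- The automaton is nondeterministic: conjunction occurs nowhere. -/
def IsNBA (M : ABA Ψ S) : Prop :=
  M.init.NoAnd ∧ ∀ q ∈ M.Q, ∀ l ∈ (M.tf q).leaves, l.NoAnd

end ABA

/-- A language of infinite words is ω-regular modulo `A` if it is the language of a
nondeterministic Büchi automaton modulo `A`. -/
def OmegaRegular {D : Type u} {Ψ : Type v} (A : EBA D Ψ) (L : Set (Stream' D)) : Prop :=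
  ∃ (S : Type) (M : ABA Ψ S), M.IsNBA ∧ L = M.lang A

/-! ### Extended regular expressions -/

/-- Extended regular expressions over the predicates `Ψ`. -/
inductive ERE (Ψ : Type v) where
  | pred (α : Ψ) : ERE Ψ
  | eps : ERE Ψ
  | union (R S : ERE Ψ) : ERE Ψ
  | inter (R S : ERE Ψ) : ERE Ψ
  | conc (R S : ERE Ψ) : ERE Ψ
  | star (R : ERE Ψ) : ERE Ψ
  | compl (R : ERE Ψ) : ERE Ψ

namespace ERE

variable {D : Type u} {Ψ : Type v}

/-- The language of finite words of an extended regular expression. -/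
def lang (A : EBA D Ψ) : ERE Ψ → Language D
  | pred α => {x | ∃ a ∈ A.den α, x = [a]}
  | eps => 1
  | union R S => lang A R + lang A S
  | inter R S => {x | x ∈ lang A R ∧ x ∈ lang A S}
  | conc R S => lang A R * lang A S
  | star R => KStar.kstar (lang A R)
  | compl R => {x | x ∉ lang A R}

/-- Nullability. -/
def nullable : ERE Ψ → Bool
  | pred _ => false
  | eps => true
  | union R S => nullable R || nullable S
  | inter R S => nullable R && nullable S
  | conc R S => nullable R && nullable S
  | star _ => true
  | compl R => !(nullable R)

/-- The regular expression of the empty language. -/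
def bot (A : EBA D Ψ) : ERE Ψ := pred A.bot

/-- The symbolic derivative, a transition term with regular expressions as leaves. -/
def der (A : EBA D Ψ) : ERE Ψ → TT Ψ (ERE Ψ)
  | pred α => .ite α (.leaf eps) (.leaf (bot A))
  | eps => .leaf (bot A)
  | union R S => (der A R).map₂ union (der A S)
  | inter R S => (der A R).map₂ inter (der A S)
  | conc R S =>
      if R.nullable then ((der A R).map (conc · S)).map₂ union (der A S)
      else (der A R).map (conc · S)
  | star R => (der A R).map (conc · (star R))
  | compl R => (der A R).map compl

/-- The disjunction of the branch conditions, relative to `β`, that lead to nullable leaves. -/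
def oneAux (A : EBA D Ψ) (β : Ψ) : TT Ψ (ERE Ψ) → Ψ
  | .leaf r => if r.nullable then β else A.bot
  | .ite α f g => A.or (oneAux A (A.and β α) f) (oneAux A (A.and β (A.not α)) g)

open Classical in
/-- The predicate that denotes the one-letter words of `R`, with unsatisfiable and valid
predicates normalized to `A.bot` and `A.top`. -/
noncomputable def one (A : EBA D Ψ) (R : ERE Ψ) : Ψ :=
  if A.den (oneAux A A.top (der A R)) = ∅ then A.bot
  else if A.den (oneAux A A.top (der A R)) = Set.univ then A.top
  else oneAux A A.top (der A R)

/-- `R` is alive if its language is nonempty, and dead otherwise. -/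
def Alive (A : EBA D Ψ) (R : ERE Ψ) : Prop := ∃ x, x ∈ R.lang A

end ERE

/-! ### Positive RLTL -/

/-- The positive fragment of LTL combined with extended regular expressions: all connectives but
negation, where `nwcl` is the negated weak closure. The formulas true and false are the predicates
`⊤` and `⊥` of the element algebra. -/
inductive RLTLp (Ψ : Type v) where
  | pred (α : Ψ) : RLTLp Ψ
  | or (φ ψ : RLTLp Ψ) : RLTLp Ψ
  | and (φ ψ : RLTLp Ψ) : RLTLp Ψ
  | next (φ : RLTLp Ψ) : RLTLp Ψ
  | until (φ ψ : RLTLp Ψ) : RLTLp Ψ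
  | release (φ ψ : RLTLp Ψ) : RLTLp Ψ
  | eimpl (R : ERE Ψ) (φ : RLTLp Ψ) : RLTLp Ψ
  | uimpl (R : ERE Ψ) (φ : RLTLp Ψ) : RLTLp Ψ
  | wcl (R : ERE Ψ) : RLTLp Ψ
  | nwcl (R : ERE Ψ) : RLTLp Ψ
  | ocl (R : ERE Ψ) : RLTLp Ψ

/-- The infinite words obtained by concatenating infinitely many nonempty words of `L`;
the `i`-th factor lies between the positions `k i` and `k (i + 1)`. -/
def omegaPow {D : Type u} (L : Set (List D)) : Set (Stream' D) :=
  {x | ∃ k : ℕ → ℕ, k 0 = 0 ∧ StrictMono k ∧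
    ∀ i, (x.drop (k i)).take (k (i + 1) - k i) ∈ L}

namespace RLTLp

variable {D : Type u} {Ψ : Type v}

/-- Weak closure: some finite prefix is in `L`, or every nonempty finite prefix extends to a
word of `L`. -/
def WeakClosure (L : Language D) (x : Stream' D) : Prop :=
  (∃ y z, x = Stream'.appendStream' y z ∧ y ∈ L) ∨
  (∀ y z, x = Stream'.appendStream' y z → y ≠ [] → ∃ t, y ++ t ∈ L)

/-- The semantics: `Models A φ x` says that the infinite word `x` is a model of `φ`. -/
def Models (A : EBA D Ψ) : RLTLp Ψ → Stream' D → Prop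
  | pred α, x => x.get 0 ∈ A.den α
  | or φ ψ, x => Models A φ x ∨ Models A ψ x
  | and φ ψ, x => Models A φ x ∧ Models A ψ x
  | next φ, x => Models A φ (x.drop 1)
  | .until φ ψ, x => ∃ j, Models A ψ (x.drop j) ∧ ∀ i < j, Models A φ (x.drop i)
  | release φ ψ, x => (∀ j, Models A ψ (x.drop j)) ∨
      ∃ j, Models A φ (x.drop j) ∧ ∀ i ≤ j, Models A ψ (x.drop i)
  | eimpl R φ, x => ∃ y z, x = Stream'.appendStream' y z ∧
      y ++ [z.get 0] ∈ R.lang A ∧ Models A φ z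
  | uimpl R φ, x => ∀ y z, x = Stream'.appendStream' y z →
      y ++ [z.get 0] ∈ R.lang A → Models A φ z
  | wcl R, x => WeakClosure (R.lang A) x
  | nwcl R, x => ¬ WeakClosure (R.lang A) x
  | ocl R, x => x ∈ omegaPow {y : List D | y ∈ R.lang A ∧ y ≠ []}

/-- The language of a formula. -/
def lang (A : EBA D Ψ) (φ : RLTLp Ψ) : Set (Stream' D) := {x | φ.Models A x}

/-- The formula true. -/
def top (A : EBA D Ψ) : RLTLp Ψ := pred A.top

/-- The formula false. -/
def bot (A : EBA D Ψ) : RLTLp Ψ := pred A.bot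

/-- The derivative of a predicate. -/
def derivPred (A : EBA D Ψ) (α : Ψ) : TT Ψ (RLTLp Ψ) := .ite α (.leaf (top A)) (.leaf (bot A))

/-- The symbolic derivative, a transition term with formulas as leaves. In the case of `uimpl`,
the negated predicate of the implication is taken inside the element algebra. -/
noncomputable def deriv (A : EBA D Ψ) : RLTLp Ψ → TT Ψ (RLTLp Ψ)
  | pred α => derivPred A α
  | or φ ψ => (deriv A φ).map₂ or (deriv A ψ)
  | and φ ψ => (deriv A φ).map₂ and (deriv A ψ)
  | next φ => .leaf φ
  | .until φ ψ => (deriv A ψ).map₂ or ((deriv A φ).map₂ and (.leaf (.until φ ψ)))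
  | release φ ψ => (deriv A ψ).map₂ and ((deriv A φ).map₂ or (.leaf (release φ ψ)))
  | eimpl R φ => ((derivPred A (R.one A)).map₂ and (deriv A φ)).map₂ or
      ((R.der A).map (eimpl · φ))
  | uimpl R φ => ((derivPred A (A.not (R.one A))).map₂ or (deriv A φ)).map₂ and
      ((R.der A).map (uimpl · φ))
  | wcl R => if R.nullable then .leaf (top A) else (R.der A).map wcl
  | nwcl R => if R.nullable then .leaf (bot A) else (R.der A).map nwcl
  | ocl R => ((derivPred A (R.one A)).map₂ and (.leaf (ocl R))).map₂ or
      ((R.der A).map (eimpl · (next (ocl R))))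

/-- All subformulas, the formula itself included. -/
def subformulas : RLTLp Ψ → Set (RLTLp Ψ)
  | pred α => {pred α}
  | or φ ψ => {or φ ψ} ∪ subformulas φ ∪ subformulas ψ
  | and φ ψ => {and φ ψ} ∪ subformulas φ ∪ subformulas ψ
  | next φ => {next φ} ∪ subformulas φ
  | .until φ ψ => {.until φ ψ} ∪ subformulas φ ∪ subformulas ψ
  | release φ ψ => {release φ ψ} ∪ subformulas φ ∪ subformulas ψ
  | eimpl R φ => {eimpl R φ} ∪ subformulas φ
  | uimpl R φ => {uimpl R φ} ∪ subformulas φ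
  | wcl R => {wcl R}
  | nwcl R => {nwcl R}
  | ocl R => {ocl R}

/-- Non-Boolean formulas: the predicates and the modal formulas. -/
def NonBoolean : RLTLp Ψ → Prop
  | or _ _ => False
  | and _ _ => False
  | _ => True

open Classical in
/-- A formula as a positive Boolean combination of non-Boolean formulas. -/
noncomputable def toBCp (A : EBA D Ψ) : RLTLp Ψ → BCp (RLTLp Ψ)
  | or φ ψ => .or (toBCp A φ) (toBCp A ψ)
  | and φ ψ => .and (toBCp A φ) (toBCp A ψ)
  | φ => if φ = top A then .tt else if φ = bot A then .ff else .atom φ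

/-- `Simp A φ ψ`: the leaf `φ` can be simplified to `ψ`, by equivalence of positive Boolean
combinations, by language preserving rewriting of the regular expressions in suffix implications
and weak closures, and by the rewrite rules to `⊥` and `⊤` of these formulas. -/
inductive Simp (A : EBA D Ψ) : RLTLp Ψ → RLTLp Ψ → Prop
  | bool {φ ψ} (h : ∀ V, (toBCp A φ).Sat V ↔ (toBCp A ψ).Sat V) : Simp A φ ψ
  | trans {φ ψ χ} : Simp A φ ψ → Simp A ψ χ → Simp A φ χ
  | or {φ φ₁ ψ ψ₁} : Simp A φ φ₁ → Simp A ψ ψ₁ → Simp A (or φ ψ) (or φ₁ ψ₁)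
  | and {φ φ₁ ψ ψ₁} : Simp A φ φ₁ → Simp A ψ ψ₁ → Simp A (and φ ψ) (and φ₁ ψ₁)
  | eimpl {r s : ERE Ψ} (φ) (h : r.lang A = s.lang A) : Simp A (eimpl r φ) (eimpl s φ)
  | uimpl {r s : ERE Ψ} (φ) (h : r.lang A = s.lang A) : Simp A (uimpl r φ) (uimpl s φ)
  | wcl {r s : ERE Ψ} (h : r.lang A = s.lang A) : Simp A (wcl r) (wcl s)
  | nwcl {r s : ERE Ψ} (h : r.lang A = s.lang A) : Simp A (nwcl r) (nwcl s)
  | eimpl_bot (φ) : Simp A (eimpl (ERE.bot A) φ) (bot A)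
  | eimpl_eps (φ) : Simp A (eimpl ERE.eps φ) (bot A)
  | uimpl_bot (φ) : Simp A (uimpl (ERE.bot A) φ) (top A)
  | uimpl_eps (φ) : Simp A (uimpl ERE.eps φ) (top A)
  | wcl_bot : Simp A (wcl (ERE.bot A)) (bot A)
  | nwcl_bot : Simp A (nwcl (ERE.bot A)) (top A)
  | wcl_nullable {r : ERE Ψ} (h : r.nullable) : Simp A (wcl r) (top A)
  | nwcl_nullable {r : ERE Ψ} (h : r.nullable) : Simp A (nwcl r) (bot A)

/-- The least set of states for the transition function `tf` that contains `φ` and all non-Boolean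
subformulas of the leaves of the transition terms of its members. -/
inductive States (tf : RLTLp Ψ → TT Ψ (RLTLp Ψ)) (φ : RLTLp Ψ) : RLTLp Ψ → Prop
  | init : States tf φ φ
  | step {q l p} : States tf φ q → l ∈ (tf q).leaves → p ∈ l.subformulas → p.NonBoolean →
      States tf φ p

/-- On all states, `tf` is the derivative, up to functional equivalence modulo simplification. -/
def IsDerivTF (A : EBA D Ψ) (tf : RLTLp Ψ → TT Ψ (RLTLp Ψ)) (φ : RLTLp Ψ) : Prop :=
  ∀ q, States tf φ q → ∀ a, Simp A ((deriv A q).leafOf A a) ((tf q).leafOf A a)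

/-- The formulas that are accepting as states. -/
def Acc (A : EBA D Ψ) : RLTLp Ψ → Prop
  | pred α => α = A.top
  | release _ _ => True
  | uimpl _ _ => True
  | wcl R => R.Alive A
  | nwcl R => ¬ R.Alive A
  | ocl _ => True
  | _ => False

theorem mem_subformulas_self (φ : RLTLp Ψ) : φ ∈ φ.subformulas := by
  cases φ <;> simp [subformulas]

theorem atoms_toBCp (A : EBA D Ψ) (φ : RLTLp Ψ) :
    ∀ p ∈ (toBCp A φ).atoms, p ∈ φ.subformulas ∧ p.NonBoolean := by
  induction φ with
  | or φ ψ h₁ h₂ =>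
    rintro p (hp | hp)
    · exact ⟨Or.inl (Or.inr (h₁ p hp).1), (h₁ p hp).2⟩
    · exact ⟨Or.inr (h₂ p hp).1, (h₂ p hp).2⟩
  | and φ ψ h₁ h₂ =>
    rintro p (hp | hp)
    · exact ⟨Or.inl (Or.inr (h₁ p hp).1), (h₁ p hp).2⟩
    · exact ⟨Or.inr (h₂ p hp).1, (h₂ p hp).2⟩
  | _ =>
    intro p hp
    unfold toBCp at hp
    split_ifs at hp
    · exact hp.elim
    · exact hp.elim
    · cases hp
      exact ⟨mem_subformulas_self _, trivial⟩

theorem exists_mem_leaves_map {S₁ S₂ : Type w} (op : S₁ → S₂) (f : TT Ψ S₁) :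
    ∀ l ∈ (f.map op).leaves, ∃ s ∈ f.leaves, l = op s := by
  induction f with
  | leaf s =>
    intro l hl
    exact ⟨s, rfl, hl⟩
  | ite α f g hf hg =>
    rintro l (hl | hl)
    · obtain ⟨s, hs, rfl⟩ := hf l hl
      exact ⟨s, Or.inl hs, rfl⟩
    · obtain ⟨s, hs, rfl⟩ := hg l hl
      exact ⟨s, Or.inr hs, rfl⟩

/-- The alternating Büchi automaton of `φ`, for the transition function `tf`: the initial state is
`φ`, the states are those generated from `φ`, and the leaves of the transition terms are read as
positive Boolean combinations of states. -/
noncomputable def aba (A : EBA D Ψ) (tf : RLTLp Ψ → TT Ψ (RLTLp Ψ)) (φ : RLTLp Ψ)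
    (hfin : {q | States tf φ q}.Finite) : ABA Ψ (RLTLp Ψ) where
  Q := {q | States tf φ q}
  finite_Q := hfin
  init := .atom φ
  init_mem := by
    rintro p rfl
    exact States.init
  tf q := (tf q).map (toBCp A)
  tf_mem := by
    intro q hq l hl p hp
    obtain ⟨s, hs, rfl⟩ := exists_mem_leaves_map _ _ l hl
    exact States.step hq hs (atoms_toBCp A s p hp).1 (atoms_toBCp A s p hp).2
  F := {q | States tf φ q ∧ Acc A q}
  F_subset := fun _ h => h.1

end RLTLp

/-! Acceptance by run trees is first replaced by a local certificate (`ABA.Ranked`): a set of good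
states at each position, with ordinal ranks, such that the transition of each good state is
satisfied by good successors that are accepting or of smaller rank. A certificate unfolds into an
accepting tree because ordinals cannot descend forever. Conversely, in an accepting tree the child
relation into non-accepting nodes is well-founded and so supplies the ranks
(`acceptsFrom_of_ranked`, `ranked_of_acceptsFrom`).

For the correctness of the automaton of a formula, derivatives are read as expansion laws. If a word
is a model, the good states are those that hold at the current position, ranked by the number of
unfoldings needed to reach accepting formulas (`Att`, `exists_satD_and_satF`). Conversely, a
certificate yields evaluations that are consistent with the derivatives (`Consistent`). Induction on
ranks then fulfils the eventualities `U`, `◇→`, negated closure and each factor of an ω-power, while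
the safety formulas follow by induction on positions. Simplification of leaves does no harm:
evaluations are kept invariant under rewriting of regular expressions to others with the same
language, false on the formulas that may be rewritten to `⊥` (`Contra`) or true on those that may be
rewritten to `⊤` (`Triv`), as the direction requires.

The states can be kept finite because a regular language has finitely many left quotients, over any
alphabet. Replacing each regular expression by a representative of its language leaves finitely many
derivatives (`exists_closedFor`).

Every formula thus has an alternating automaton, and the breakpoint construction of Miyano and
Hayashi removes alternation (`omegaRegular_lang`). In the other direction, an accepting run of a
nondeterministic automaton ends, or revisits some accepting state forever. Kleene's construction
gives regular expressions for the paths involved, and `◇→`, `X` and the ω-power assemble them into a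
formula (`exists_models_iff_acceptsByPaths`). -/

namespace TT

variable {D : Type u} {Ψ : Type v} {S S₁ S₂ S₃ : Type w}

theorem leafOf_mem_leaves (A : EBA D Ψ) (a : D) (f : TT Ψ S) : f.leafOf A a ∈ f.leaves := by
  induction f with
  | leaf s => simp [leafOf, leaves]
  | ite α f g hf hg =>
    simp only [leafOf, leaves]
    split_ifs
    · exact Or.inl hf
    · exact Or.inr hg

@[simp] theorem leafOf_map (A : EBA D Ψ) (a : D) (op : S₁ → S₂) (f : TT Ψ S₁) :
    (f.map op).leafOf A a = op (f.leafOf A a) := by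
  induction f with
  | leaf s => simp [leafOf, map]
  | ite α f g hf hg =>
    simp only [leafOf, map]
    split_ifs <;> assumption

@[simp] theorem leafOf_map₂ (A : EBA D Ψ) (a : D) (op : S₁ → S₂ → S₃) (f : TT Ψ S₁)
    (g : TT Ψ S₂) : (f.map₂ op g).leafOf A a = op (f.leafOf A a) (g.leafOf A a) := by
  induction f with
  | leaf s => simp [leafOf, map₂]
  | ite α f g hf hg =>
    simp only [leafOf, map₂]
    split_ifs <;> assumption

end TT

namespace BCp

variable {S : Type w}

theorem Sat.mono {V W : S → Prop} {f : BCp S} (h : f.Sat V) (hVW : ∀ p ∈ f.atoms, V p → W p) :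
    f.Sat W := by
  induction f with
  | atom s => exact hVW s rfl h
  | tt => trivial
  | ff => exact h
  | and f g hf hg =>
    exact ⟨hf h.1 fun p hp => hVW p (Or.inl hp), hg h.2 fun p hp => hVW p (Or.inr hp)⟩
  | or f g hf hg =>
    exact h.imp (fun h => hf h fun p hp => hVW p (Or.inl hp))
      (fun h => hg h fun p hp => hVW p (Or.inr hp))

theorem subset_atoms_of_mem_dnf {f : BCp S} : ∀ X ∈ f.dnf, X ⊆ f.atoms := by
  induction f with
  | atom s => rintro X rfl; exact subset_rfl
  | tt => rintro X rfl; exact subset_rfl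
  | ff => rintro X ⟨⟩
  | and f g hf hg =>
    rintro X ⟨Y, hY, Z, hZ, rfl⟩
    exact Set.union_subset_union (hf Y hY) (hg Z hZ)
  | or f g hf hg =>
    rintro X (hX | hX)
    · exact (hf X hX).trans Set.subset_union_left
    · exact (hg X hX).trans Set.subset_union_right

theorem sat_iff_exists_dnf {V : S → Prop} {f : BCp S} :
    f.Sat V ↔ ∃ X ∈ f.dnf, ∀ p ∈ X, V p := by
  induction f with
  | atom s => simp [Sat, dnf]
  | tt => simp [Sat, dnf]
  | ff => simp [Sat, dnf]
  | and f g hf hg =>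
    simp only [Sat, dnf, hf, hg]
    constructor
    · rintro ⟨⟨X, hX, h⟩, Y, hY, h'⟩
      exact ⟨_, ⟨X, hX, Y, hY, rfl⟩, fun p hp => hp.elim (h p) (h' p)⟩
    · rintro ⟨_, ⟨X, hX, Y, hY, rfl⟩, h⟩
      exact ⟨⟨X, hX, fun p hp => h p (Or.inl hp)⟩, Y, hY, fun p hp => h p (Or.inr hp)⟩
  | or f g hf hg =>
    simp only [Sat, dnf, hf, hg, Set.mem_union]
    grind

end BCp

/-- There is no infinite descent in a well-founded order. -/
theorem not_forall_ge_lt {α : Type w} [Preorder α] [WellFoundedLT α] (f : ℕ → α) (m : ℕ) :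
    ¬ ∀ n ≥ m, f (n + 1) < f n := by
  intro h
  refine (wellFounded_iff_isEmpty_descending_chain.1
    (wellFounded_lt (α := α))).false ⟨fun n => f (m + n), fun n => h (m + n) (Nat.le_add_right m n)⟩

/-! ### Acceptance as existence of positional ranks -/

namespace ABA

variable {D : Type u} {Ψ : Type v} {S : Type w}

/-- Positional witnesses of acceptance: `G k p` says that the state `p` is good at position `k`,
and `r k p` bounds the time until an accepting state is visited. -/
def Ranked (A : EBA D Ψ) (M : ABA Ψ S) (x : Stream' D) (G : ℕ → S → Prop)
    (r : ℕ → S → Ordinal.{0}) : Prop :=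
  ∀ k p, G k p → ((M.tf p).leafOf A (x.get k)).Sat
    (fun p' => G (k + 1) p' ∧ (p' ∈ M.F ∨ r (k + 1) p' < r k p))

theorem atoms_leafOf_subset (A : EBA D Ψ) (M : ABA Ψ S) {q : S} (hq : q ∈ M.Q) (a : D) :
    ((M.tf q).leafOf A a).atoms ⊆ M.Q :=
  M.tf_mem q hq _ (TT.leafOf_mem_leaves A a _)

/-- At each good position and state, fix a DNF member witnessing the rank condition and unfold these
choices into a tree. A branch that avoids accepting states from some point on would be an infinite
descent of ordinals. -/
theorem acceptsFrom_of_ranked (A : EBA D Ψ) (M : ABA Ψ S) {x : Stream' D} {q : S}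
    {G : ℕ → S → Prop} {r : ℕ → S → Ordinal.{0}} (h : M.Ranked A x G r) (hq : q ∈ M.Q)
    (hG : G 0 q) : M.AcceptsFrom A x q := by
  have hX : ∀ k p, ∃ X : Set S, G k p → p ∈ M.Q → X ∈ ((M.tf p).leafOf A (x.get k)).dnf ∧
      ∀ p' ∈ X, p' ∈ M.Q ∧ G (k + 1) p' ∧ (p' ∈ M.F ∨ r (k + 1) p' < r k p) := by
    intro k p
    by_cases hp : G k p ∧ p ∈ M.Q
    · obtain ⟨X, hX, hX'⟩ := BCp.sat_iff_exists_dnf.1 (h k p hp.1)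
      refine ⟨X, fun _ _ => ⟨hX, fun p' hp' => ⟨?_, hX' p' hp'⟩⟩⟩
      exact M.atoms_leafOf_subset A hp.2 _ (BCp.subset_atoms_of_mem_dnf X hX hp')
    · exact ⟨∅, fun h₁ h₂ => (hp ⟨h₁, h₂⟩).elim⟩
  choose X hX using hX
  -- Child index `i` stands for the state `dec i`, so the label of a node depends only on its last
  -- index. The enumeration may repeat states, which only duplicates children.
  obtain ⟨dec, hdec⟩ := M.finite_Q.countable.exists_eq_range ⟨q, hq⟩
  let lab : List ℕ → S := fun u => match u.getLast? with
    | none => q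
    | some i => dec i
  have lab_nil : lab [] = q := rfl
  have lab_concat : ∀ u i, lab (u ++ [i]) = dec i := by
    intro u i
    simp [lab]
  let τ : LTree S :=
    { nodes := {u | ∀ v i, v ++ [i] <+: u → dec i ∈ X v.length (lab v)}
      root_mem := by
        intro v i hv
        simp at hv
      parent_mem := by
        intro u i hu v j hv
        exact hu v j (hv.trans (List.prefix_append _ _))
      label := lab }
  have mem_concat : ∀ u i, u ++ [i] ∈ τ.nodes ↔ u ∈ τ.nodes ∧ dec i ∈ X u.length (lab u) := by
    intro u i
    constructor
    · intro hu
      exact ⟨τ.parent_mem u i hu, hu u i (List.prefix_rfl)⟩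
    · rintro ⟨hu, hi⟩ v j hv
      rw [List.prefix_concat_iff] at hv
      rcases hv with hv | hv
      · obtain ⟨rfl, hji⟩ := List.append_inj' hv rfl
        obtain rfl : j = i := by simpa using hji
        exact hi
      · exact hu v j hv
  have good : ∀ u ∈ τ.nodes, G u.length (lab u) ∧ lab u ∈ M.Q := by
    intro u
    induction u using List.reverseRecOn with
    | nil => intro _; exact ⟨hG, hq⟩
    | append_singleton u i ih =>
      intro hu
      rw [mem_concat] at hu
      obtain ⟨h₁, h₂⟩ := ih hu.1
      have := (hX _ _ h₁ h₂).2 _ hu.2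
      rw [lab_concat, List.length_append]
      exact ⟨this.2.1, this.1⟩
  refine ⟨τ, ⟨lab_nil, fun u hu => ?_⟩, ?_⟩
  · obtain ⟨h₁, h₂⟩ := good u hu
    refine ⟨_, (hX _ _ h₁ h₂).1, fun p hp => ?_, fun i hi => ?_⟩
    · have hpQ := ((hX _ _ h₁ h₂).2 p hp).1
      rw [hdec] at hpQ
      obtain ⟨i, rfl⟩ := hpQ
      exact ⟨i, (mem_concat u i).2 ⟨hu, hp⟩, lab_concat u i⟩
    · have := ((mem_concat u i).1 hi).2
      change lab (u ++ [i]) ∈ _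
      rwa [lab_concat]
  · intro b hb m
    by_contra hcon
    push Not at hcon
    refine not_forall_ge_lt (fun n => r n (lab ((List.range n).map b))) m fun n hn => ?_
    have h₀ := hb n
    have h₁ := hb (n + 1)
    have e : (List.range (n + 1)).map b = (List.range n).map b ++ [b n] := by
      simp [List.range_succ]
    obtain ⟨g₁, g₂⟩ := good _ h₀
    have hF := hcon (n + 1) (by omega)
    change lab _ ∉ _ at hF
    rw [e] at h₁ hF
    have := ((hX _ _ g₁ g₂).2 _ ((mem_concat _ _).1 h₁).2).2.2
    rw [lab_concat] at hF
    have := this.resolve_left hF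
    simp only [List.length_map, List.length_range] at this
    simpa only [e, lab_concat] using this

theorem _root_.LTree.mem_of_prefix (τ : LTree S) {u v : List ℕ} (h : u <+: v)
    (hv : v ∈ τ.nodes) : u ∈ τ.nodes := by
  induction v using List.reverseRecOn with
  | nil => simpa [List.prefix_nil.1 h] using hv
  | append_singleton v i ih =>
    rcases List.prefix_concat_iff.1 h with h | h
    · rwa [h]
    · exact ih h (τ.parent_mem v i hv)

/-- The child relation of a tree, restricted to nodes outside of `F`, is well-founded if the tree
is accepting. -/
theorem _root_.LTree.Accepting.wellFounded {τ : LTree S} {F : Set S} (h : τ.Accepting F) :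
    WellFounded fun v u : List ℕ => (∃ i, v = u ++ [i]) ∧ v ∈ τ.nodes ∧ τ.label v ∉ F := by
  rw [wellFounded_iff_isEmpty_descending_chain]
  refine ⟨fun ⟨f, hf⟩ => ?_⟩
  have hlen : ∀ n, (f n).length = (f 0).length + n := by
    intro n
    induction n with
    | zero => rfl
    | succ n ih =>
      obtain ⟨⟨i, hi⟩, -⟩ := hf n
      rw [hi, List.length_append, ih]
      rfl
  have hpre : ∀ m n, m ≤ n → f m <+: f n := by
    intro m n hmn
    induction hmn with
    | refl => exact List.prefix_rfl
    | step _ ih =>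
      obtain ⟨⟨i, hi⟩, -⟩ := hf _
      exact ih.trans (hi ▸ List.prefix_append _ _)
  have hmem : ∀ n, f n ∈ τ.nodes := fun n =>
    τ.mem_of_prefix (hpre n (n + 1) (by omega)) (hf n).2.1
  -- The nodes `f n` extend one another and `f (j + 1)` has more than `j` entries, so the default
  -- `0` is never used. The chain need not start at the root, and `b` also covers the path to `f 0`.
  let b : ℕ → ℕ := fun j => (f (j + 1)).getD j 0
  have hb : ∀ n, (List.range n).map b = (f n).take n := by
    intro n
    refine List.ext_getElem
      (by rw [List.length_map, List.length_range, List.length_take, hlen]; omega) fun j hj₁ hj₂ => ?_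
    have hjn : j < n := by simpa using hj₁
    have hj : j < (f (j + 1)).length := by rw [hlen]; omega
    simp only [List.getElem_map, List.getElem_range, List.getElem_take, b]
    rw [List.getD_eq_getElem _ _ hj]
    exact (hpre (j + 1) n (by omega)).getElem hj
  have hbr : τ.IsBranch b := fun n => by
    rw [hb]
    exact τ.mem_of_prefix (List.take_prefix _ _) (hmem n)
  -- Beyond the length of `f 0`, every node of the branch is some `f (m + 1)`, which the chain
  -- places outside `F`.
  obtain ⟨n, hn, hF⟩ := h b hbr ((f 0).length + 1)
  obtain ⟨m, rfl⟩ : ∃ m, n = (f 0).length + 1 + m := ⟨n - ((f 0).length + 1), by omega⟩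
  have : (f ((f 0).length + 1 + m)).take ((f 0).length + 1 + m) = f (m + 1) := by
    have h₁ := List.prefix_iff_eq_take.1 (hpre (m + 1) ((f 0).length + 1 + m) (by omega))
    rw [hlen] at h₁
    rw [h₁]
    congr 1
    omega
  rw [hb, this] at hF
  exact (hf m).2.2 hF

/-- Nodes get their rank in the well-founded child relation into non-accepting nodes. A state may
label many nodes of one level, so its rank there is the least one. Following the node that attains
the minimum makes the choice positional. -/
theorem ranked_of_acceptsFrom (A : EBA D Ψ) (M : ABA Ψ S) {x : Stream' D} {q : S}
    (hq : q ∈ M.Q) (h : M.AcceptsFrom A x q) :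
    ∃ G r, M.Ranked A x G r ∧ G 0 q ∧ ∀ k p, G k p → p ∈ M.Q := by
  obtain ⟨τ, ⟨hroot, hstep⟩, hacc⟩ := h
  have hwf := hacc.wellFounded
  have : IsWellFounded (List ℕ) _ := ⟨hwf⟩
  let ρ : List ℕ → Ordinal.{0} := IsWellFounded.rank
    fun v u : List ℕ => (∃ i, v = u ++ [i]) ∧ v ∈ τ.nodes ∧ τ.label v ∉ M.F
  let N : ℕ → S → Set Ordinal.{0} := fun k p => ρ '' {u | u ∈ τ.nodes ∧ u.length = k ∧ τ.label u = p}
  refine ⟨fun k p => ∃ u ∈ τ.nodes, u.length = k ∧ τ.label u = p, fun k p => sInf (N k p),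
    ?_, ⟨[], τ.root_mem, rfl, hroot⟩, ?_⟩
  · rintro k p ⟨u₀, hu₀⟩
    obtain ⟨u, ⟨hu, rfl, rfl⟩, hmin⟩ : sInf (N k p) ∈ N k p := csInf_mem ⟨_, u₀, hu₀, rfl⟩
    obtain ⟨X, hX, hX₁, hX₂⟩ := hstep u hu
    refine BCp.sat_iff_exists_dnf.2 ⟨X, hX, fun p hp => ?_⟩
    obtain ⟨i, hi, rfl⟩ := hX₁ p hp
    refine ⟨⟨_, hi, by simp, rfl⟩, ?_⟩
    by_cases hF : τ.label (u ++ [i]) ∈ M.F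
    · exact Or.inl hF
    · right
      change sInf (N _ _) < sInf (N _ _)
      rw [← hmin]
      refine lt_of_le_of_lt (csInf_le' ⟨u ++ [i], ⟨hi, by simp, rfl⟩, rfl⟩) ?_
      exact IsWellFounded.rank_lt_of_rel (r := fun v u : List ℕ =>
        (∃ i, v = u ++ [i]) ∧ v ∈ τ.nodes ∧ τ.label v ∉ M.F) ⟨⟨i, rfl⟩, hi, hF⟩
  · rintro k p ⟨u, hu, -, rfl⟩
    clear k
    induction u using List.reverseRecOn with
    | nil => rwa [hroot]
    | append_singleton u i ih =>
      have hu' := τ.parent_mem u i hu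
      obtain ⟨X, hX, -, hX₂⟩ := hstep u hu'
      exact M.atoms_leafOf_subset A (ih hu') _ (BCp.subset_atoms_of_mem_dnf X hX (hX₂ i hu))

end ABA

/-! ### Correctness of symbolic derivatives of regular expressions -/

namespace ERE

variable {D : Type u} {Ψ : Type v}

theorem nullable_iff (A : EBA D Ψ) (R : ERE Ψ) : R.nullable = true ↔ [] ∈ R.lang A := by
  induction R with
  | pred α => exact iff_of_false (by simp [nullable]) (by rintro ⟨a, -, h⟩; cases h)
  | eps => simp [nullable, lang, Language.mem_one]
  | union R S hR hS => simp [nullable, lang, Language.mem_add, hR, hS]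
  | inter R S hR hS =>
    simp only [nullable, lang, Bool.and_eq_true, hR, hS]
    rfl
  | conc R S hR hS => simp [nullable, lang, Language.mem_mul, hR, hS]
  | star R hR => simp [nullable, lang, Language.nil_mem_kstar]
  | compl R hR =>
    simp only [nullable, lang, Bool.not_eq_true', ← Bool.not_eq_true, hR]
    rfl

/-- The derivative by the letter `a`. -/
noncomputable def lder (A : EBA D Ψ) (a : D) (R : ERE Ψ) : ERE Ψ := (R.der A).leafOf A a

theorem notMem_lang_bot (A : EBA D Ψ) (y : List D) : y ∉ (bot A).lang A := by
  rintro ⟨a, ha, -⟩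
  rw [A.den_bot] at ha
  exact ha

theorem cons_mem_mul {L M : Language D} {a : D} {y : List D} :
    a :: y ∈ L * M ↔ (∃ u v, a :: u ∈ L ∧ v ∈ M ∧ u ++ v = y) ∨ ([] ∈ L ∧ a :: y ∈ M) := by
  rw [Language.mem_mul]
  constructor
  · rintro ⟨u, hu, v, hv, h⟩
    cases u with
    | nil =>
      rw [List.nil_append] at h
      exact Or.inr ⟨hu, h ▸ hv⟩
    | cons b u =>
      rw [List.cons_append, List.cons.injEq] at h
      obtain ⟨rfl, rfl⟩ := h
      exact Or.inl ⟨u, v, hu, hv, rfl⟩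
  · rintro (⟨u, v, hu, hv, rfl⟩ | ⟨h₁, h₂⟩)
    · exact ⟨_, hu, v, hv, rfl⟩
    · exact ⟨[], h₁, _, h₂, rfl⟩

/-- Empty factors can be dropped, so the first letter lies in the first factor. -/
theorem cons_mem_kstar {L : Language D} {a : D} {y : List D} :
    a :: y ∈ KStar.kstar L ↔ ∃ u v, a :: u ∈ L ∧ v ∈ KStar.kstar L ∧ u ++ v = y := by
  constructor
  · intro h
    obtain ⟨l, hl, hl'⟩ := Language.mem_kstar_iff_exists_nonempty.1 h
    cases l with
    | nil => simp at hl
    | cons z l =>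
      obtain ⟨hz, hz'⟩ := hl' z (by simp)
      cases z with
      | nil => exact (hz' rfl).elim
      | cons b z =>
        rw [List.flatten_cons, List.cons_append, List.cons.injEq] at hl
        obtain ⟨rfl, rfl⟩ := hl
        exact ⟨z, _, hz, Language.join_mem_kstar fun w hw => (hl' w (by simp [hw])).1, rfl⟩
  · rintro ⟨u, v, hu, hv, rfl⟩
    rw [← Language.one_add_self_mul_kstar_eq_kstar]
    exact Or.inr (Language.append_mem_mul hu hv)

theorem mem_lang_lder (A : EBA D Ψ) (a : D) (R : ERE Ψ) (y : List D) :
    y ∈ (R.lder A a).lang A ↔ a :: y ∈ R.lang A := by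
  unfold lder
  induction R generalizing y with
  | pred α =>
    simp only [der, TT.leafOf]
    split_ifs with h
    · simp only [lang, Language.mem_one]
      exact ⟨by rintro rfl; exact ⟨a, h, rfl⟩, by rintro ⟨b, hb, h⟩; simpa using (List.cons.inj h).2⟩
    · refine iff_of_false (notMem_lang_bot A y) ?_
      rintro ⟨b, hb, h'⟩
      rw [List.cons.injEq] at h'
      exact h (h'.1 ▸ hb)
  | eps => exact iff_of_false (notMem_lang_bot A y) (by simp [lang, Language.mem_one])
  | union R S hR hS => simp [der, lang, Language.mem_add, hR, hS]
  | inter R S hR hS =>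
    simp only [der, lang, TT.leafOf_map₂]
    exact and_congr (hR y) (hS y)
  | conc R S hR hS =>
    have key : y ∈ (((R.der A).leafOf A a).conc S).lang A ↔
        ∃ u v, a :: u ∈ R.lang A ∧ v ∈ S.lang A ∧ u ++ v = y := by
      simp only [lang, Language.mem_mul, hR]
      grind
    rw [lang, cons_mem_mul, ← key, ← nullable_iff]
    simp only [der]
    split_ifs with h
    · rw [TT.leafOf_map₂, TT.leafOf_map, lang, Language.mem_add, hS]
      simp [h]
    · simp [h]
  | star R hR =>
    rw [lang, cons_mem_kstar]
    simp only [der, TT.leafOf_map, lang, Language.mem_mul, hR]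
    grind
  | compl R hR =>
    simp only [der, lang, TT.leafOf_map]
    exact not_congr (hR y)

/-- The parameter `β` accumulates the conditions on the path to the current subterm, and exactly one
branch is compatible with a given letter. -/
theorem mem_den_oneAux (A : EBA D Ψ) (a : D) (f : TT Ψ (ERE Ψ)) (β : Ψ) :
    a ∈ A.den (oneAux A β f) ↔ a ∈ A.den β ∧ (f.leafOf A a).nullable = true := by
  induction f generalizing β with
  | leaf r =>
    simp only [oneAux, TT.leafOf]
    split_ifs with h <;> simp [h, A.den_bot]
  | ite α f g hf hg =>
    simp only [oneAux, TT.leafOf, A.den_or, Set.mem_union, hf, hg, A.den_and, A.den_not]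
    by_cases h : a ∈ A.den α <;> simp [h]

theorem mem_den_one (A : EBA D Ψ) (a : D) (R : ERE Ψ) : a ∈ A.den (R.one A) ↔ [a] ∈ R.lang A := by
  have h : a ∈ A.den (oneAux A A.top (der A R)) ↔ [a] ∈ R.lang A := by
    rw [mem_den_oneAux, A.den_top, nullable_iff A, ← lder, mem_lang_lder]
    simp
  unfold one
  split_ifs with h₁ h₂
  · rw [← h, h₁, A.den_bot]
  · rw [← h, h₂, A.den_top]
  · exact h

theorem lang_lder_congr {A : EBA D Ψ} {R S : ERE Ψ} (h : R.lang A = S.lang A) (a : D) :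
    (R.lder A a).lang A = (S.lder A a).lang A := by
  ext y
  rw [mem_lang_lder, mem_lang_lder, h]

end ERE

namespace RLTLp

variable {D : Type u} {Ψ : Type v}

/-! ### Satisfaction of formulas and derivatives as positive Boolean combinations -/

/-- Evaluation of a formula as a positive Boolean combination of non-Boolean formulas. -/
def SatF (A : EBA D Ψ) (V : RLTLp Ψ → Prop) (φ : RLTLp Ψ) : Prop := (toBCp A φ).Sat V

/-- Evaluation of the derivative of a formula by a letter. -/
def SatD (A : EBA D Ψ) (V : RLTLp Ψ → Prop) (a : D) (φ : RLTLp Ψ) : Prop :=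
  SatF A V ((deriv A φ).leafOf A a)

/-- `toBCp` tests for `⊤` before `⊥`; if the two predicates were the same, false would be read as
true. -/
theorem top_ne_bot [Nonempty D] (A : EBA D Ψ) : A.top ≠ A.bot := by
  intro h
  have := A.den_top
  rw [h, A.den_bot] at this
  exact Set.empty_ne_univ this

section Sat

variable (A : EBA D Ψ) (V : RLTLp Ψ → Prop)

@[simp] theorem satF_or (φ ψ : RLTLp Ψ) : SatF A V (or φ ψ) ↔ SatF A V φ ∨ SatF A V ψ := by
  simp [SatF, toBCp, BCp.Sat]

@[simp] theorem satF_and (φ ψ : RLTLp Ψ) : SatF A V (and φ ψ) ↔ SatF A V φ ∧ SatF A V ψ := by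
  simp [SatF, toBCp, BCp.Sat]

@[simp] theorem satF_top : SatF A V (top A) := by
  simp [SatF, top, toBCp, BCp.Sat]

@[simp] theorem satF_bot [Nonempty D] : ¬ SatF A V (bot A) := by
  simp [SatF, top, bot, toBCp, (top_ne_bot A).symm, BCp.Sat]

@[simp] theorem satF_next (φ : RLTLp Ψ) : SatF A V (next φ) ↔ V (next φ) := by
  simp [SatF, top, bot, toBCp, BCp.Sat]

@[simp] theorem satF_until (φ ψ : RLTLp Ψ) : SatF A V (.until φ ψ) ↔ V (.until φ ψ) := by
  simp [SatF, top, bot, toBCp, BCp.Sat]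

@[simp] theorem satF_release (φ ψ : RLTLp Ψ) : SatF A V (release φ ψ) ↔ V (release φ ψ) := by
  simp [SatF, top, bot, toBCp, BCp.Sat]

@[simp] theorem satF_eimpl (R : ERE Ψ) (φ : RLTLp Ψ) : SatF A V (eimpl R φ) ↔ V (eimpl R φ) := by
  simp [SatF, top, bot, toBCp, BCp.Sat]

@[simp] theorem satF_uimpl (R : ERE Ψ) (φ : RLTLp Ψ) : SatF A V (uimpl R φ) ↔ V (uimpl R φ) := by
  simp [SatF, top, bot, toBCp, BCp.Sat]

@[simp] theorem satF_wcl (R : ERE Ψ) : SatF A V (wcl R) ↔ V (wcl R) := by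
  simp [SatF, top, bot, toBCp, BCp.Sat]

@[simp] theorem satF_nwcl (R : ERE Ψ) : SatF A V (nwcl R) ↔ V (nwcl R) := by
  simp [SatF, top, bot, toBCp, BCp.Sat]

@[simp] theorem satF_ocl (R : ERE Ψ) : SatF A V (ocl R) ↔ V (ocl R) := by
  simp [SatF, top, bot, toBCp, BCp.Sat]

variable {V} in
theorem SatF.mono {W : RLTLp Ψ → Prop} {φ : RLTLp Ψ} (h : SatF A V φ) (hVW : ∀ p, V p → W p) :
    SatF A W φ :=
  BCp.Sat.mono h fun p _ => hVW p

variable (a : D)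

@[simp] theorem satF_derivPred (α : Ψ) :
    SatF A V ((derivPred A α).leafOf A a) ↔ a ∈ A.den α := by
  have : Nonempty D := ⟨a⟩
  simp only [derivPred, TT.leafOf]
  split_ifs with h <;> simp [h]

-- This and the following lemmas are the expansion laws of the connectives. Both directions of the
-- correctness proof use derivatives through them.
@[simp] theorem satD_pred (α : Ψ) : SatD A V a (pred α) ↔ a ∈ A.den α :=
  satF_derivPred A V a α

@[simp] theorem satD_or (φ ψ : RLTLp Ψ) :
    SatD A V a (or φ ψ) ↔ SatD A V a φ ∨ SatD A V a ψ := by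
  simp [SatD, deriv]

@[simp] theorem satD_and (φ ψ : RLTLp Ψ) :
    SatD A V a (and φ ψ) ↔ SatD A V a φ ∧ SatD A V a ψ := by
  simp [SatD, deriv]

@[simp] theorem satD_next (φ : RLTLp Ψ) : SatD A V a (next φ) ↔ SatF A V φ := by
  simp [SatD, deriv, TT.leafOf]

@[simp] theorem satD_until (φ ψ : RLTLp Ψ) : SatD A V a (.until φ ψ) ↔
    SatD A V a ψ ∨ (SatD A V a φ ∧ V (.until φ ψ)) := by
  simp [SatD, deriv, TT.leafOf]

@[simp] theorem satD_release (φ ψ : RLTLp Ψ) : SatD A V a (release φ ψ) ↔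
    SatD A V a ψ ∧ (SatD A V a φ ∨ V (release φ ψ)) := by
  simp [SatD, deriv, TT.leafOf]

@[simp] theorem satD_eimpl (R : ERE Ψ) (φ : RLTLp Ψ) : SatD A V a (eimpl R φ) ↔
    ([a] ∈ R.lang A ∧ SatD A V a φ) ∨ V (eimpl (R.lder A a) φ) := by
  simp [SatD, deriv, ERE.mem_den_one, ERE.lder]

@[simp] theorem satD_uimpl (R : ERE Ψ) (φ : RLTLp Ψ) : SatD A V a (uimpl R φ) ↔
    ([a] ∈ R.lang A → SatD A V a φ) ∧ V (uimpl (R.lder A a) φ) := by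
  simp [SatD, deriv, ERE.mem_den_one, ERE.lder, A.den_not, imp_iff_not_or]

@[simp] theorem satD_wcl (R : ERE Ψ) : SatD A V a (wcl R) ↔
    [] ∈ R.lang A ∨ V (wcl (R.lder A a)) := by
  have : Nonempty D := ⟨a⟩
  rw [← ERE.nullable_iff]
  simp only [SatD, deriv, ERE.lder]
  split_ifs with h <;> simp [h, TT.leafOf]

@[simp] theorem satD_nwcl (R : ERE Ψ) : SatD A V a (nwcl R) ↔
    [] ∉ R.lang A ∧ V (nwcl (R.lder A a)) := by
  have : Nonempty D := ⟨a⟩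
  rw [← ERE.nullable_iff]
  simp only [SatD, deriv, ERE.lder]
  split_ifs with h <;> simp [h, TT.leafOf]

@[simp] theorem satD_ocl (R : ERE Ψ) : SatD A V a (ocl R) ↔
    ([a] ∈ R.lang A ∧ V (ocl R)) ∨ V (eimpl (R.lder A a) (next (ocl R))) := by
  simp [SatD, deriv, ERE.mem_den_one, ERE.lder, TT.leafOf]

variable {V a} in
theorem SatD.mono {W : RLTLp Ψ → Prop} {φ : RLTLp Ψ} (h : SatD A V a φ) (hVW : ∀ p, V p → W p) :
    SatD A W a φ :=
  SatF.mono A h hVW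

end Sat

/-! ### Invariance under simplification -/

/-- Equality of formulas up to the language of the outermost regular expression. -/
inductive Equ (A : EBA D Ψ) : RLTLp Ψ → RLTLp Ψ → Prop
  | refl (φ) : Equ A φ φ
  | eimpl {r s : ERE Ψ} (φ) (h : r.lang A = s.lang A) : Equ A (eimpl r φ) (eimpl s φ)
  | uimpl {r s : ERE Ψ} (φ) (h : r.lang A = s.lang A) : Equ A (uimpl r φ) (uimpl s φ)
  | wcl {r s : ERE Ψ} (h : r.lang A = s.lang A) : Equ A (wcl r) (wcl s)
  | nwcl {r s : ERE Ψ} (h : r.lang A = s.lang A) : Equ A (nwcl r) (nwcl s)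

theorem Equ.symm {A : EBA D Ψ} {φ ψ : RLTLp Ψ} (h : Equ A φ ψ) : Equ A ψ φ := by
  cases h with
  | refl => exact .refl _
  | eimpl φ h => exact .eimpl φ h.symm
  | uimpl φ h => exact .uimpl φ h.symm
  | wcl h => exact .wcl h.symm
  | nwcl h => exact .nwcl h.symm

theorem Equ.trans {A : EBA D Ψ} {φ ψ χ : RLTLp Ψ} (h : Equ A φ ψ) (h' : Equ A ψ χ) :
    Equ A φ χ := by
  cases h with
  | refl => exact h'
  | eimpl φ h =>
    cases h' with
    | refl => exact .eimpl φ h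
    | eimpl _ h' => exact .eimpl φ (h.trans h')
  | uimpl φ h =>
    cases h' with
    | refl => exact .uimpl φ h
    | uimpl _ h' => exact .uimpl φ (h.trans h')
  | wcl h =>
    cases h' with
    | refl => exact .wcl h
    | wcl h' => exact .wcl (h.trans h')
  | nwcl h =>
    cases h' with
    | refl => exact .nwcl h
    | nwcl h' => exact .nwcl (h.trans h')

/-- A predicate on formulas that is invariant under language preserving rewriting. -/
def Invariant (A : EBA D Ψ) (V : RLTLp Ψ → Prop) : Prop := ∀ p p', Equ A p p' → V p → V p'

theorem Equ.acc_iff {A : EBA D Ψ} {φ ψ : RLTLp Ψ} (h : Equ A φ ψ) : Acc A φ ↔ Acc A ψ := by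
  cases h with
  | refl => rfl
  | eimpl => rfl
  | uimpl => rfl
  | wcl h => simp [Acc, ERE.Alive, h]
  | nwcl h => simp [Acc, ERE.Alive, h]

theorem Equ.models_iff {A : EBA D Ψ} {φ ψ : RLTLp Ψ} (h : Equ A φ ψ) (x : Stream' D) :
    Models A φ x ↔ Models A ψ x := by
  cases h with
  | refl => rfl
  | eimpl φ h => simp [Models, h]
  | uimpl φ h => simp [Models, h]
  | wcl h => simp [Models, h]
  | nwcl h => simp [Models, h]

theorem Equ.satD {A : EBA D Ψ} {V : RLTLp Ψ → Prop} (hV : Invariant A V)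
    {φ ψ : RLTLp Ψ} (h : Equ A φ ψ) {a : D} : SatD A V a φ → SatD A V a ψ := by
  cases h with
  | refl => exact id
  | eimpl φ h =>
    rw [satD_eimpl, satD_eimpl, h]
    exact Or.imp id (hV _ _ (.eimpl φ (ERE.lang_lder_congr h a)))
  | uimpl φ h =>
    rw [satD_uimpl, satD_uimpl, h]
    exact And.imp id (hV _ _ (.uimpl φ (ERE.lang_lder_congr h a)))
  | wcl h =>
    rw [satD_wcl, satD_wcl, h]
    exact Or.imp id (hV _ _ (.wcl (ERE.lang_lder_congr h a)))
  | nwcl h =>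
    rw [satD_nwcl, satD_nwcl, h]
    exact And.imp id (hV _ _ (.nwcl (ERE.lang_lder_congr h a)))

/-- Formulas that are valid because of the shape of the outermost regular expression. -/
def Triv (A : EBA D Ψ) : RLTLp Ψ → Prop
  | uimpl R _ => ∀ y ∈ R.lang A, y = []
  | wcl R => [] ∈ R.lang A
  | nwcl R => ∀ y, y ∉ R.lang A
  | _ => False

/-- Formulas that are unsatisfiable because of the shape of the outermost regular expression. -/
def Contra (A : EBA D Ψ) : RLTLp Ψ → Prop
  | eimpl R _ => ∀ y ∈ R.lang A, y = []
  | wcl R => ∀ y, y ∉ R.lang A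
  | nwcl R => [] ∈ R.lang A
  | _ => False

theorem Equ.triv {A : EBA D Ψ} {φ ψ : RLTLp Ψ} (h : Equ A φ ψ) : Triv A φ → Triv A ψ := by
  cases h with
  | refl => exact id
  | eimpl => exact id
  | uimpl φ h => simp [Triv, h]
  | wcl h => simp [Triv, h]
  | nwcl h => simp [Triv, h]

/-- Only the rules to `⊥` can lose truth, and they apply to formulas of the form `Contra`, which `V`
rejects. -/
theorem Simp.satF [Nonempty D] {A : EBA D Ψ} {V : RLTLp Ψ → Prop} (hV : Invariant A V)
    (hC : ∀ p, Contra A p → ¬ V p) {φ ψ : RLTLp Ψ} (h : Simp A φ ψ) :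
    SatF A V φ → SatF A V ψ := by
  induction h with
  | bool h => exact (h V).1
  | trans _ _ h₁ h₂ => exact h₂ ∘ h₁
  | or _ _ h₁ h₂ => simpa using Or.imp h₁ h₂
  | and _ _ h₁ h₂ => simpa using And.imp h₁ h₂
  | eimpl φ h => simpa using hV _ _ (.eimpl φ h)
  | uimpl φ h => simpa using hV _ _ (.uimpl φ h)
  | wcl h => simpa using hV _ _ (.wcl h)
  | nwcl h => simpa using hV _ _ (.nwcl h)
  | eimpl_bot φ =>
    simpa using hC (RLTLp.eimpl _ φ) fun y hy => (ERE.notMem_lang_bot A y hy).elim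
  | eimpl_eps φ => simpa using hC (RLTLp.eimpl ERE.eps φ) fun y => (Language.mem_one y).1
  | uimpl_bot φ => simp
  | uimpl_eps φ => simp
  | wcl_bot => simpa using hC (RLTLp.wcl _) (ERE.notMem_lang_bot A)
  | nwcl_bot => simp
  | wcl_nullable h => simp
  | nwcl_nullable h => simpa using hC (RLTLp.nwcl _) ((ERE.nullable_iff A _).1 h)

/-- Read backwards, only the rules to `⊤` can lose truth, and they apply to formulas of the form
`Triv`, which `V` accepts. -/
theorem Simp.satF_of_satF [Nonempty D] {A : EBA D Ψ} {V : RLTLp Ψ → Prop} (hV : Invariant A V)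
    (hT : ∀ p, Triv A p → V p) {φ ψ : RLTLp Ψ} (h : Simp A φ ψ) :
    SatF A V ψ → SatF A V φ := by
  induction h with
  | bool h => exact (h V).2
  | trans _ _ h₁ h₂ => exact h₁ ∘ h₂
  | or _ _ h₁ h₂ => simpa using Or.imp h₁ h₂
  | and _ _ h₁ h₂ => simpa using And.imp h₁ h₂
  | eimpl φ h => simpa using hV _ _ (.eimpl φ h.symm)
  | uimpl φ h => simpa using hV _ _ (.uimpl φ h.symm)
  | wcl h => simpa using hV _ _ (.wcl h.symm)
  | nwcl h => simpa using hV _ _ (.nwcl h.symm)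
  | eimpl_bot φ => simp
  | eimpl_eps φ => simp
  | uimpl_bot φ =>
    simpa using hT (RLTLp.uimpl _ φ) fun y hy => (ERE.notMem_lang_bot A y hy).elim
  | uimpl_eps φ => simpa using hT (RLTLp.uimpl ERE.eps φ) fun y => (Language.mem_one y).1
  | wcl_bot => simp
  | nwcl_bot => simpa using hT (RLTLp.nwcl _) (ERE.notMem_lang_bot A)
  | wcl_nullable h => simpa using hT (RLTLp.wcl _) ((ERE.nullable_iff A _).1 h)
  | nwcl_nullable h => simp

/-! ### Semantics by positions -/

theorem eq_appendStream'_iff {x z : Stream' D} {y : List D} :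
    x = Stream'.appendStream' y z ↔ y = x.take y.length ∧ z = x.drop y.length := by
  constructor
  · rintro rfl
    refine ⟨?_, (Stream'.drop_append_stream y z).symm⟩
    rw [Stream'.take_append_of_le_length _ _ _ le_rfl, List.take_length]
  · rintro ⟨h₁, h₂⟩
    have := Stream'.append_take_drop y.length x
    rw [← h₁, ← h₂] at this
    exact this.symm

/-- The match and its continuation overlap in the letter at position `j`: the match takes `j + 1`
letters, but only `j` are dropped. -/
theorem models_eimpl (A : EBA D Ψ) (R : ERE Ψ) (φ : RLTLp Ψ) (x : Stream' D) :
    Models A (eimpl R φ) x ↔ ∃ j, x.take (j + 1) ∈ R.lang A ∧ Models A φ (x.drop j) := by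
  simp only [Models, eq_appendStream'_iff]
  constructor
  · rintro ⟨y, z, ⟨h₁, rfl⟩, h₂, h₃⟩
    refine ⟨y.length, ?_, h₃⟩
    rw [Stream'.take_succ', ← h₁]
    simpa [Stream'.get_drop] using h₂
  · rintro ⟨j, h₁, h₂⟩
    refine ⟨x.take j, x.drop j, by simp, ?_, h₂⟩
    rwa [Stream'.get_drop, Nat.add_zero, ← Stream'.take_succ']

theorem models_uimpl (A : EBA D Ψ) (R : ERE Ψ) (φ : RLTLp Ψ) (x : Stream' D) :
    Models A (uimpl R φ) x ↔ ∀ j, x.take (j + 1) ∈ R.lang A → Models A φ (x.drop j) := by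
  simp only [Models, eq_appendStream'_iff]
  constructor
  · intro h j hj
    refine h (x.take j) (x.drop j) (by simp) ?_
    rwa [Stream'.get_drop, Nat.add_zero, ← Stream'.take_succ']
  · rintro h y z ⟨h₁, rfl⟩ h₂
    refine h y.length ?_
    rw [Stream'.take_succ', ← h₁]
    simpa [Stream'.get_drop] using h₂

theorem weakClosure_iff (L : Language D) (x : Stream' D) :
    WeakClosure L x ↔ (∃ j, x.take j ∈ L) ∨ ∀ j, ∃ t, x.take (j + 1) ++ t ∈ L := by
  simp only [WeakClosure, eq_appendStream'_iff]
  refine or_congr ⟨?_, ?_⟩ ⟨?_, ?_⟩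
  · rintro ⟨y, z, ⟨h₁, -⟩, h₂⟩
    exact ⟨y.length, h₁ ▸ h₂⟩
  · rintro ⟨j, hj⟩
    exact ⟨x.take j, x.drop j, by simp, hj⟩
  · intro h j
    refine h (x.take (j + 1)) (x.drop (j + 1)) (by simp) ?_
    rw [Stream'.take_succ]
    exact List.cons_ne_nil _ _
  · rintro h y z ⟨h₁, -⟩ hy
    cases y with
    | nil => exact (hy rfl).elim
    | cons a y =>
      rw [h₁]
      exact h _

theorem take_succ_mem_iff (A : EBA D Ψ) (R : ERE Ψ) (x : Stream' D) (j : ℕ) :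
    x.take (j + 1) ∈ R.lang A ↔ (x.drop 1).take j ∈ (R.lder A (x.get 0)).lang A := by
  rw [ERE.mem_lang_lder, Stream'.take_succ]
  rfl

theorem take_succ_append_mem_iff (A : EBA D Ψ) (R : ERE Ψ) (x : Stream' D) (j : ℕ) (t : List D) :
    x.take (j + 1) ++ t ∈ R.lang A ↔
      (x.drop 1).take j ++ t ∈ (R.lder A (x.get 0)).lang A := by
  rw [ERE.mem_lang_lder, Stream'.take_succ]
  rfl

/-- An infinite product of nonempty words splits into its first factor and the rest. -/
theorem mem_omegaPow_iff (L : Set (List D)) (x : Stream' D) :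
    x ∈ omegaPow L ↔ ∃ j, x.take (j + 1) ∈ L ∧ x.drop (j + 1) ∈ omegaPow L := by
  constructor
  · rintro ⟨k, h0, hk, h⟩
    have h1 : 0 < k 1 := by simpa [h0] using hk zero_lt_one
    obtain ⟨j, hj⟩ : ∃ j, k 1 = j + 1 := ⟨k 1 - 1, by omega⟩
    refine ⟨j, by simpa [h0, hj] using h 0, fun i => k (i + 1) - (j + 1), by simp [hj], ?_, ?_⟩
    · intro a b hab
      have h₁ : k 1 ≤ k (a + 1) := hk.monotone (by omega)
      have h₂ : k (a + 1) < k (b + 1) := hk (by omega)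
      change k (a + 1) - (j + 1) < k (b + 1) - (j + 1)
      omega
    · intro i
      have h₁ : k 1 ≤ k (i + 1) := hk.monotone (by omega)
      have h₂ : k (i + 1) < k (i + 2) := hk (by omega)
      have h₃ := h (i + 1)
      rw [Stream'.drop_drop]
      change (x.drop (j + 1 + (k (i + 1) - (j + 1)))).take
        (k (i + 2) - (j + 1) - (k (i + 1) - (j + 1))) ∈ L
      rwa [show j + 1 + (k (i + 1) - (j + 1)) = k (i + 1) by omega,
        show k (i + 2) - (j + 1) - (k (i + 1) - (j + 1)) = k (i + 2) - k (i + 1) by omega]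
  · rintro ⟨j, hj, k, h0, hk, h⟩
    refine ⟨fun i => Nat.casesOn i 0 fun i => k i + (j + 1), rfl, ?_, ?_⟩
    · refine strictMono_nat_of_lt_succ fun i => ?_
      cases i with
      | zero => simp
      | succ i =>
        have := hk (Nat.lt_succ_self i)
        simpa using this
    · intro i
      cases i with
      | zero => simpa [h0] using hj
      | succ i =>
        have := h i
        rw [Stream'.drop_drop] at this
        rw [Nat.add_comm (j + 1)] at this
        change (x.drop (k i + (j + 1))).take (k (i + 1) + (j + 1) - (k i + (j + 1))) ∈ L
        rwa [Nat.add_sub_add_right]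

/-- The coinduction principle for ω-powers: an invariant that lets one nonempty factor be split off
at a time yields all cut positions by recursion. -/
theorem mem_omegaPow_of_forall {L : Set (List D)} {P : Stream' D → Prop}
    (hP : ∀ x, P x → ∃ j, x.take (j + 1) ∈ L ∧ P (x.drop (j + 1))) {x : Stream' D} (hx : P x) :
    x ∈ omegaPow L := by
  choose! j hj using hP
  let k : ℕ → ℕ := fun i => Nat.rec 0 (fun _ k => k + (j (x.drop k) + 1)) i
  have hk : ∀ i, k (i + 1) = k i + (j (x.drop (k i)) + 1) := fun i => rfl
  have hPk : ∀ i, P (x.drop (k i)) := by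
    intro i
    induction i with
    | zero => exact hx
    | succ i ih =>
      have := (hj _ ih).2
      rwa [Stream'.drop_drop, ← hk] at this
  refine ⟨k, rfl, strictMono_nat_of_lt_succ fun i => by rw [hk]; omega, fun i => ?_⟩
  rw [hk, Nat.add_sub_cancel_left]
  exact (hj _ (hPk i)).1

end RLTLp

namespace RLTLp

variable {D : Type u} {Ψ : Type v}

theorem toBCp_of_nonBoolean (A : EBA D Ψ) {φ : RLTLp Ψ} (h : φ.NonBoolean) [Decidable (φ = top A)]
    [Decidable (φ = bot A)] :
    toBCp A φ = if φ = top A then .tt else if φ = bot A then .ff else .atom φ := by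
  cases φ <;> first | exact h.elim | (simp only [toBCp]; congr)

theorem satF_of_nonBoolean {A : EBA D Ψ} {V : RLTLp Ψ → Prop} {φ : RLTLp Ψ} (h : φ.NonBoolean)
    (hb : φ ≠ bot A) (hV : V φ) : SatF A V φ := by
  classical
  rw [SatF, toBCp_of_nonBoolean A h]
  split_ifs
  · trivial
  · exact hV

theorem SatF.of_nonBoolean {A : EBA D Ψ} {V : RLTLp Ψ → Prop} {φ : RLTLp Ψ} (h : φ.NonBoolean)
    (hV : SatF A V φ) : φ = top A ∨ V φ := by
  classical
  rw [SatF, toBCp_of_nonBoolean A h] at hV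
  split_ifs at hV with h₁ h₂
  · exact Or.inl h₁
  · exact hV.elim
  · exact Or.inr hV

theorem not_models_bot (A : EBA D Ψ) (x : Stream' D) : ¬ Models A (bot A) x := by
  simp [bot, Models, A.den_bot]

theorem models_top (A : EBA D Ψ) (x : Stream' D) : Models A (top A) x := by
  simp [top, Models, A.den_top]

/-! ### Models are accepted -/

/-- `Att A n y p`: the word `y` is a model of `p`, and by unfolding derivatives for at most `n`
steps one arrives at accepting formulas that are satisfied by the rest of the word. -/
def Att (A : EBA D Ψ) : ℕ → Stream' D → RLTLp Ψ → Prop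
  | 0, y, p => Models A p y ∧ Acc A p
  | n + 1, y, p => Models A p y ∧ (Acc A p ∨ SatD A (Att A n (y.drop 1)) (y.get 0) p)

section Att

variable {A : EBA D Ψ}

theorem Att.models {n : ℕ} {y : Stream' D} {p : RLTLp Ψ} (h : Att A n y p) : Models A p y := by
  cases n <;> exact h.1

theorem att_of_acc {y : Stream' D} {p : RLTLp Ψ} (h : Models A p y) (h' : Acc A p) (n : ℕ) :
    Att A n y p := by
  cases n with
  | zero => exact ⟨h, h'⟩
  | succ n => exact ⟨h, Or.inl h'⟩

theorem Att.succ {n : ℕ} {y : Stream' D} {p : RLTLp Ψ} (h : Att A n y p) : Att A (n + 1) y p := by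
  induction n generalizing y p with
  | zero => exact att_of_acc h.1 h.2 _
  | succ n ih => exact ⟨h.1, h.2.imp id fun h => h.mono A fun _ => ih⟩

theorem Att.mono {n m : ℕ} (hnm : n ≤ m) {y : Stream' D} {p : RLTLp Ψ} (h : Att A n y p) :
    Att A m y p := by
  induction hnm with
  | refl => exact h
  | step _ ih => exact ih.succ

theorem invariant_att (n : ℕ) (y : Stream' D) : Invariant A (Att A n y) := by
  intro p p' hp h
  induction n generalizing y p p' with
  | zero => exact ⟨(hp.models_iff y).1 h.1, hp.acc_iff.1 h.2⟩
  | succ n ih =>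
    exact ⟨(hp.models_iff y).1 h.1, h.2.imp hp.acc_iff.1 (hp.satD (ih _))⟩

theorem not_att_of_contra {n : ℕ} {y : Stream' D} (p : RLTLp Ψ) (hp : Contra A p) :
    ¬ Att A n y p := by
  intro h
  have h := h.models
  cases p <;> try exact hp
  · obtain ⟨j, hj, -⟩ := (models_eimpl _ _ _ _).1 h
    have := congrArg List.length (hp _ hj)
    simp at this
  · rcases (weakClosure_iff _ _).1 h with ⟨j, hj⟩ | h
    · exact hp _ hj
    · exact hp _ (h 0).choose_spec
  · exact h ((weakClosure_iff _ _).2 (Or.inl ⟨0, hp⟩))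

theorem satD_max {n m : ℕ} {y : Stream' D} {a : D} {φ ψ : RLTLp Ψ} (h : SatD A (Att A n y) a φ)
    (h' : SatD A (Att A m y) a ψ) :
    SatD A (Att A (max n m) y) a φ ∧ SatD A (Att A (max n m) y) a ψ :=
  ⟨h.mono A fun _ => Att.mono (le_max_left _ _), h'.mono A fun _ => Att.mono (le_max_right _ _)⟩

/-- Each letter before the end of the match costs one more unfolding, after which the bound for `φ`
takes over. -/
theorem exists_satD_eimpl {φ : RLTLp Ψ} {j : ℕ} {R : ERE Ψ} {y : Stream' D}
    (hR : y.take (j + 1) ∈ R.lang A) (hφ : Models A φ (y.drop j))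
    (h : ∃ n, SatD A (Att A n ((y.drop j).drop 1)) ((y.drop j).get 0) φ) :
    ∃ n, SatD A (Att A n (y.drop 1)) (y.get 0) (eimpl R φ) := by
  induction j generalizing R y with
  | zero =>
    obtain ⟨n, hn⟩ := h
    refine ⟨n, ?_⟩
    rw [satD_eimpl]
    exact Or.inl ⟨hR, hn⟩
  | succ j ih =>
    rw [take_succ_mem_iff] at hR
    have e : y.drop (j + 1) = (y.drop 1).drop j := by rw [Stream'.drop_drop, Nat.add_comm]
    rw [e] at h hφ
    obtain ⟨n, hn⟩ := ih hR hφ h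
    refine ⟨n + 1, ?_⟩
    rw [satD_eimpl]
    exact Or.inr ⟨(models_eimpl _ _ _ _).2 ⟨j, hR, hφ⟩, Or.inr hn⟩

/-- Aliveness of the derivative is what makes the successor state accepting. -/
theorem models_wcl_lder {R : ERE Ψ} {y : Stream' D} (h : WeakClosure (R.lang A) y)
    (hR : [] ∉ R.lang A) : WeakClosure ((R.lder A (y.get 0)).lang A) (y.drop 1) ∧
      (R.lder A (y.get 0)).Alive A := by
  rw [weakClosure_iff] at h ⊢
  rcases h with ⟨j, hj⟩ | h
  · cases j with
    | zero => exact (hR hj).elim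
    | succ j =>
      rw [take_succ_mem_iff] at hj
      exact ⟨Or.inl ⟨j, hj⟩, _, hj⟩
  · simp only [take_succ_append_mem_iff] at h
    exact ⟨Or.inr fun j => h (j + 1), _, (h 0).choose_spec⟩

theorem weakClosure_of_lder {R : ERE Ψ} {y : Stream' D}
    (h : WeakClosure ((R.lder A (y.get 0)).lang A) (y.drop 1)) : WeakClosure (R.lang A) y := by
  rw [weakClosure_iff] at h ⊢
  rcases h with ⟨j, hj⟩ | h
  · rw [← take_succ_mem_iff] at hj
    exact Or.inl ⟨_, hj⟩
  · simp only [← take_succ_append_mem_iff] at h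
    refine Or.inr fun j => ?_
    cases j with
    | zero =>
      obtain ⟨t, ht⟩ := h 0
      -- The derivative only speaks of prefixes of `y` of length at least two; the one-letter prefix
      -- is extended through the second letter.
      refine ⟨[y.get 1] ++ t, ?_⟩
      rw [← List.append_assoc]
      exact ht
    | succ j => exact h j

/-- Once the prefix without extensions has been read, the derivative of `R` is dead and its negated
closure is accepting. The length of that prefix bounds the number of unfoldings. -/
theorem exists_satD_nwcl {j : ℕ} {R : ERE Ψ} {y : Stream' D} (h : ¬ WeakClosure (R.lang A) y)
    (hj : ∀ t, y.take (j + 1) ++ t ∉ R.lang A) :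
    ∃ n, SatD A (Att A n (y.drop 1)) (y.get 0) (nwcl R) := by
  induction j generalizing R y with
  | zero =>
    refine ⟨0, ?_⟩
    rw [satD_nwcl]
    refine ⟨fun hR => h ((weakClosure_iff _ _).2 (Or.inl ⟨0, hR⟩)), mt weakClosure_of_lder h, ?_⟩
    rintro ⟨t, ht⟩
    rw [ERE.mem_lang_lder] at ht
    exact hj t ht
  | succ j ih =>
    obtain ⟨n, hn⟩ := ih (mt weakClosure_of_lder h) fun t ht =>
      hj t ((take_succ_append_mem_iff A R y _ t).2 ht)
    refine ⟨n + 1, ?_⟩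
    rw [satD_nwcl]
    exact ⟨fun hR => h ((weakClosure_iff _ _).2 (Or.inl ⟨0, hR⟩)), mt weakClosure_of_lder h,
      Or.inr hn⟩

theorem exists_satF_of_satD {φ : RLTLp Ψ} (hφ : φ.NonBoolean) {y : Stream' D}
    (h : Models A φ y) (h' : ∃ n, SatD A (Att A n (y.drop 1)) (y.get 0) φ) :
    ∃ n, SatF A (Att A n y) φ := by
  obtain ⟨n, hn⟩ := h'
  refine ⟨n + 1, satF_of_nonBoolean hφ ?_ ⟨h, Or.inr hn⟩⟩
  rintro rfl
  exact not_models_bot A y h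

/-- The two halves are proved together because the derivative of `next φ` is `φ` itself, which is
then evaluated without a further derivative. Eventualities are bounded by the position of their
fulfilment, accepting successors need no unfolding, and conjunctions take the maximum of two bounds.
-/
theorem exists_satD_and_satF (φ : RLTLp Ψ) :
    (∀ y, Models A φ y → ∃ n, SatD A (Att A n (y.drop 1)) (y.get 0) φ) ∧
    (∀ y, Models A φ y → ∃ n, SatF A (Att A n y) φ) := by
  induction φ with
  | or φ ψ h₁ h₂ =>
    simp only [satD_or, satF_or]
    refine ⟨fun y hy => ?_, fun y hy => ?_⟩
    · rcases hy with hy | hy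
      · exact (h₁.1 y hy).imp fun _ => Or.inl
      · exact (h₂.1 y hy).imp fun _ => Or.inr
    · rcases hy with hy | hy
      · exact (h₁.2 y hy).imp fun _ => Or.inl
      · exact (h₂.2 y hy).imp fun _ => Or.inr
  | and φ ψ h₁ h₂ =>
    simp only [satD_and, satF_and]
    refine ⟨fun y hy => ?_, fun y hy => ?_⟩
    · obtain ⟨n, hn⟩ := h₁.1 y hy.1
      obtain ⟨m, hm⟩ := h₂.1 y hy.2
      exact ⟨_, satD_max hn hm⟩
    · obtain ⟨n, hn⟩ := h₁.2 y hy.1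
      obtain ⟨m, hm⟩ := h₂.2 y hy.2
      exact ⟨max n m, hn.mono A fun _ => Att.mono (le_max_left _ _),
        hm.mono A fun _ => Att.mono (le_max_right _ _)⟩
  | pred α =>
    have key : ∀ y, Models A (pred α) y →
        ∃ n, SatD A (Att A n (y.drop 1)) (y.get 0) (pred α) := fun y hy =>
      ⟨0, (satD_pred A _ _ α).2 hy⟩
    exact ⟨key, fun y hy => exists_satF_of_satD (by exact trivial) hy (key y hy)⟩
  | next φ h =>
    have key : ∀ y, Models A (next φ) y →
        ∃ n, SatD A (Att A n (y.drop 1)) (y.get 0) (next φ) := fun y hy => by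
      simpa only [satD_next] using h.2 _ hy
    exact ⟨key, fun y hy => exists_satF_of_satD (by exact trivial) hy (key y hy)⟩
  | release φ ψ h₁ h₂ =>
    have key : ∀ y, Models A (release φ ψ) y →
        ∃ n, SatD A (Att A n (y.drop 1)) (y.get 0) (release φ ψ) := by
      intro y hy
      simp only [satD_release]
      have e : ∀ i, (y.drop 1).drop i = y.drop (i + 1) := fun i => by
        rw [Stream'.drop_drop, Nat.add_comm]
      have hcase : Models A ψ y ∧ (Models A φ y ∨ Models A (release φ ψ) (y.drop 1)) := by
        rcases hy with hy | ⟨j, hj, hj'⟩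
        · exact ⟨hy 0, Or.inr (Or.inl fun j => by rw [e]; exact hy _)⟩
        · refine ⟨hj' 0 (by omega), ?_⟩
          cases j with
          | zero => exact Or.inl hj
          | succ j =>
            exact Or.inr (Or.inr ⟨j, by rwa [e], fun i hi => by rw [e]; exact hj' _ (by omega)⟩)
      obtain ⟨n, hn⟩ := h₂.1 y hcase.1
      rcases hcase.2 with h | h
      · obtain ⟨m, hm⟩ := h₁.1 y h
        have := satD_max hn hm
        exact ⟨_, this.1, Or.inl this.2⟩
      · exact ⟨n, hn, Or.inr (att_of_acc h trivial _)⟩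
    exact ⟨key, fun y hy => exists_satF_of_satD (by exact trivial) hy (key y hy)⟩
  | eimpl R φ h =>
    have key : ∀ y, Models A (eimpl R φ) y →
        ∃ n, SatD A (Att A n (y.drop 1)) (y.get 0) (eimpl R φ) := by
      intro y hy
      obtain ⟨j, hj, hφ⟩ := (models_eimpl _ _ _ _).1 hy
      exact exists_satD_eimpl hj hφ (h.1 _ hφ)
    exact ⟨key, fun y hy => exists_satF_of_satD (by exact trivial) hy (key y hy)⟩
  | uimpl R φ h =>
    have key : ∀ y, Models A (uimpl R φ) y →
        ∃ n, SatD A (Att A n (y.drop 1)) (y.get 0) (uimpl R φ) := by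
      intro y hy
      simp only [satD_uimpl]
      rw [models_uimpl] at hy
      have hm : ∀ n, Att A n (y.drop 1) (uimpl (R.lder A (y.get 0)) φ) := by
        refine att_of_acc ((models_uimpl _ _ _ _).2 fun j hj => ?_) trivial
        rw [← take_succ_mem_iff] at hj
        rw [Stream'.drop_drop, Nat.add_comm]
        exact hy _ hj
      by_cases hR : [y.get 0] ∈ R.lang A
      · obtain ⟨n, hn⟩ := h.1 y (hy 0 hR)
        exact ⟨n, fun _ => hn, hm n⟩
      · exact ⟨0, fun h => (hR h).elim, hm 0⟩
    exact ⟨key, fun y hy => exists_satF_of_satD (by exact trivial) hy (key y hy)⟩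
  | wcl R =>
    have key : ∀ y, Models A (wcl R) y →
        ∃ n, SatD A (Att A n (y.drop 1)) (y.get 0) (wcl R) := by
      intro y hy
      simp only [satD_wcl]
      by_cases hR : [] ∈ R.lang A
      · exact ⟨0, Or.inl hR⟩
      · have := models_wcl_lder hy hR
        exact ⟨0, Or.inr this⟩
    exact ⟨key, fun y hy => exists_satF_of_satD (by exact trivial) hy (key y hy)⟩
  | nwcl R =>
    have key : ∀ y, Models A (nwcl R) y →
        ∃ n, SatD A (Att A n (y.drop 1)) (y.get 0) (nwcl R) := by
      intro y hy
      have h := mt (weakClosure_iff _ _).2 hy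
      push Not at h
      obtain ⟨j, hj⟩ := h.2
      exact exists_satD_nwcl hy hj
    exact ⟨key, fun y hy => exists_satF_of_satD (by exact trivial) hy (key y hy)⟩
  | ocl R =>
    have key : ∀ y, Models A (ocl R) y →
        ∃ n, SatD A (Att A n (y.drop 1)) (y.get 0) (ocl R) := by
      intro y hy
      obtain ⟨j, hj, hj'⟩ := (mem_omegaPow_iff _ _).1 hy
      have hm : Models A (next (ocl R)) (y.drop j) := by
        rw [Models, Stream'.drop_drop]
        exact hj'
      obtain ⟨n, hn⟩ := exists_satD_eimpl hj.1 hm ⟨0, by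
        rw [satD_next, satF_ocl]
        exact att_of_acc (p := RLTLp.ocl R) hm trivial 0⟩
      rw [satD_eimpl, satD_next, satF_ocl, ← satD_ocl] at hn
      exact ⟨n, hn⟩
    exact ⟨key, fun y hy => exists_satF_of_satD (by exact trivial) hy (key y hy)⟩
  | _ φ ψ h₁ h₂ =>
    have key : ∀ y, Models A (.until φ ψ) y →
        ∃ n, SatD A (Att A n (y.drop 1)) (y.get 0) (.until φ ψ) := by
      rintro y ⟨j, hj, hj'⟩
      simp only [satD_until]
      induction j generalizing y with
      | zero => exact (h₂.1 y hj).imp fun _ => Or.inl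
      | succ j ih =>
        obtain ⟨n, hn⟩ := h₁.1 y (hj' 0 (by omega))
        have e : ∀ i, y.drop (i + 1) = (y.drop 1).drop i := fun i => by
          rw [Stream'.drop_drop, Nat.add_comm]
        rw [e] at hj
        have hj'' : ∀ i < j, Models A φ ((y.drop 1).drop i) := fun i hi =>
          e i ▸ hj' (i + 1) (by omega)
        obtain ⟨m, hm⟩ := ih (y.drop 1) hj hj''
        rw [← satD_until] at hm
        have hU : Att A (m + 1) (y.drop 1) (.until φ ψ) := ⟨⟨j, hj, hj''⟩, Or.inr hm⟩
        exact ⟨max n (m + 1), Or.inr ⟨hn.mono A fun _ => Att.mono (le_max_left _ _),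
          hU.mono (le_max_right _ _)⟩⟩
    exact ⟨key, fun y hy => exists_satF_of_satD (by exact trivial) hy (key y hy)⟩

end Att

/-- The rank of a true state is the least bound `n` with which `Att` satisfies its derivative. At
rank `0` all chosen successors are accepting; at rank `n + 1` a non-accepting one has a derivative
satisfied with bound `n`, hence smaller rank. -/
theorem acceptsFrom_of_models [Nonempty D] {A : EBA D Ψ} {tf : RLTLp Ψ → TT Ψ (RLTLp Ψ)}
    {φ : RLTLp Ψ} (hfin : {q | States tf φ q}.Finite) (htf : IsDerivTF A tf φ) {x : Stream' D}
    (h : Models A φ x) : (aba A tf φ hfin).AcceptsFrom A x φ := by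
  classical
  have hex : ∀ k p, Models A p (x.drop k) →
      ∃ n, SatD A (Att A n (x.drop (k + 1))) (x.get k) p := by
    intro k p hp
    have := (exists_satD_and_satF p).1 _ hp
    rwa [Stream'.drop_drop, Stream'.get_drop] at this
  let r : ℕ → RLTLp Ψ → ℕ := fun k p => sInf {n | SatD A (Att A n (x.drop (k + 1))) (x.get k) p}
  refine ABA.acceptsFrom_of_ranked A _
    (G := fun k p => States tf φ p ∧ Models A p (x.drop k)) (r := fun k p => r k p)
    ?_ States.init ⟨States.init, h⟩
  rintro k p ⟨hp, hm⟩
  have hr : SatD A (Att A (r k p) (x.drop (k + 1))) (x.get k) p := Nat.sInf_mem (hex k p hm)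
  have hs := (htf p hp (x.get k)).satF (invariant_att _ _) not_att_of_contra hr
  have hatoms := ABA.atoms_leafOf_subset A (aba A tf φ hfin) hp (x.get k)
  simp only [aba, TT.leafOf_map] at hatoms ⊢
  refine BCp.Sat.mono hs fun p' hp' h' => ⟨⟨hatoms hp', h'.models⟩, ?_⟩
  by_cases hacc : Acc A p'
  · exact Or.inl ⟨hatoms hp', hacc⟩
  · right
    rw [Nat.cast_lt]
    cases hn : r k p with
    | zero =>
      rw [hn] at h'
      exact (hacc h'.2).elim
    | succ n =>
      rw [hn] at h'
      refine Nat.lt_succ_of_le (Nat.sInf_le ?_)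
      have := h'.2.resolve_left hacc
      rwa [Stream'.drop_drop, Stream'.get_drop] at this

/-! ### Accepted words are models -/

theorem models_of_triv {A : EBA D Ψ} {p : RLTLp Ψ} (h : Triv A p) (x : Stream' D) :
    Models A p x := by
  cases p <;> try exact h.elim
  · refine (models_uimpl _ _ _ _).2 fun j hj => ?_
    have := congrArg List.length (h _ hj)
    simp at this
  · exact (weakClosure_iff _ _).2 (Or.inl ⟨0, h⟩)
  · intro hw
    rcases (weakClosure_iff _ _).1 hw with ⟨j, hj⟩ | hw
    · exact h _ hj
    · exact h _ (hw 0).choose_spec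

/-- A family of evaluations along a word that is consistent with the derivatives, and bounds the
time until an accepting formula is visited. -/
def Consistent (A : EBA D Ψ) (x : Stream' D) (V : Ordinal.{0} → ℕ → RLTLp Ψ → Prop) : Prop :=
  ∀ n k p, V n k p → Triv A p ∨
    ∃ m, SatD A (V m (k + 1)) (x.get k) p ∧ (¬ Acc A p → m < n)

section Consistent

variable {A : EBA D Ψ} {x : Stream' D} {V : Ordinal.{0} → ℕ → RLTLp Ψ → Prop}

theorem take_drop_succ_mem_iff (R : ERE Ψ) (k j : ℕ) : (x.drop k).take (j + 1) ∈ R.lang A ↔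
    (x.drop (k + 1)).take j ∈ (R.lder A (x.get k)).lang A := by
  rw [take_succ_mem_iff, Stream'.drop_drop, Stream'.get_drop, Nat.add_zero]

theorem weakClosure_drop_of_lder {R : ERE Ψ} {k : ℕ}
    (h : WeakClosure ((R.lder A (x.get k)).lang A) (x.drop (k + 1))) :
    WeakClosure (R.lang A) (x.drop k) := by
  refine weakClosure_of_lder ?_
  rwa [Stream'.drop_drop, Stream'.get_drop, Nat.add_zero]

/-- A suffix implication `◇→` is never accepting, so postponing the match lowers the rank, and this
cannot go on forever. -/
theorem Consistent.eimpl (hV : Consistent A x V) (n : Ordinal.{0}) {k : ℕ} {R : ERE Ψ}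
    {φ : RLTLp Ψ} (h : SatD A (V n (k + 1)) (x.get k) (eimpl R φ)) :
    ∃ j, (x.drop k).take (j + 1) ∈ R.lang A ∧
      ∃ m, SatD A (V m (k + j + 1)) (x.get (k + j)) φ := by
  induction n using WellFoundedLT.induction generalizing k R with
  | ind n ih =>
    rw [satD_eimpl] at h
    rcases h with ⟨hR, hφ⟩ | h
    · refine ⟨0, ?_, n, hφ⟩
      rw [Stream'.take_succ, Stream'.take_zero]
      simpa using hR
    · obtain ⟨m, hm, hmn⟩ := (hV _ _ _ h).resolve_left id
      obtain ⟨j, hj, m', hm'⟩ := ih m (hmn id) hm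
      refine ⟨j + 1, (take_drop_succ_mem_iff R k _).2 hj, m', ?_⟩
      rwa [show k + (j + 1) = k + 1 + j by omega]

/-- Derivatives of a dead expression are dead, so the closure would stay non-accepting with ever
smaller ranks. -/
theorem Consistent.not_wcl_dead (hV : Consistent A x V) (n : Ordinal.{0}) {k : ℕ} {R : ERE Ψ}
    (hR : ∀ y, y ∉ R.lang A) : ¬ V n k (wcl R) := by
  induction n using WellFoundedLT.induction generalizing k R with
  | ind n ih =>
    intro h
    rcases hV _ _ _ h with h | ⟨m, hm, hmn⟩
    · exact hR _ h
    · rw [satD_wcl] at hm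
      exact ih m (hmn fun ⟨y, hy⟩ => hR y hy) (fun y hy => hR _ ((ERE.mem_lang_lder _ _ _ _).1 hy))
        (hm.resolve_left (hR _))

/-- If the closure failed, some prefix would have no extension in the language. Reading it would
lead to a dead expression, excluded by `not_wcl_dead`. -/
theorem Consistent.wcl (hV : Consistent A x V) {n : Ordinal.{0}} {k : ℕ} {R : ERE Ψ}
    (h : V n k (wcl R)) : WeakClosure (R.lang A) (x.drop k) := by
  by_contra hcon
  have hw := mt (weakClosure_iff _ _).2 hcon
  push Not at hw
  obtain ⟨j, hj⟩ := hw.2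
  clear hw
  -- Allowing prefix length `0` makes a dead expression the base case of the induction.
  generalize hi : j + 1 = i at hj
  clear hi j
  induction i generalizing n k R with
  | zero => exact hV.not_wcl_dead n hj h
  | succ i ih =>
    rcases hV _ _ _ h with h | ⟨m, hm, -⟩
    · exact hcon (models_of_triv (p := RLTLp.wcl R) h _)
    · rw [satD_wcl] at hm
      rcases hm with hm | hm
      · exact hcon (models_of_triv (p := RLTLp.wcl R) hm _)
      · refine ih hm (mt weakClosure_drop_of_lder hcon) fun t ht => hj t ?_
        rw [take_succ_append_mem_iff, Stream'.drop_drop, Stream'.get_drop]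
        exact ht

/-- If the closure held, all derivatives along the word would be alive with closures that hold. The
state would never be accepting, and its ranks would descend forever. -/
theorem Consistent.nwcl (hV : Consistent A x V) (n : Ordinal.{0}) {k : ℕ} {R : ERE Ψ}
    (h : V n k (nwcl R)) : ¬ WeakClosure (R.lang A) (x.drop k) := by
  induction n using WellFoundedLT.induction generalizing k R with
  | ind n ih =>
    intro hw
    rcases hV _ _ _ h with h | ⟨m, hm, hmn⟩
    · exact models_of_triv (p := RLTLp.nwcl R) h _ hw
    · rw [satD_nwcl] at hm
      have hw' := (models_wcl_lder hw hm.1).1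
      rw [Stream'.drop_drop, Stream'.get_drop] at hw'
      refine ih m (hmn ?_) hm.2 hw'
      rintro hdead
      rcases (weakClosure_iff _ _).1 hw with ⟨j, hj⟩ | hw
      · exact hdead ⟨_, hj⟩
      · exact hdead ⟨_, (hw 0).choose_spec⟩

theorem Consistent.until (hV : Consistent A x V) {φ ψ : RLTLp Ψ}
    (hφ : ∀ n k, SatD A (V n (k + 1)) (x.get k) φ → Models A φ (x.drop k))
    (hψ : ∀ n k, SatD A (V n (k + 1)) (x.get k) ψ → Models A ψ (x.drop k))
    (n : Ordinal.{0}) {k : ℕ} (h : SatD A (V n (k + 1)) (x.get k) (.until φ ψ)) :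
    Models A (.until φ ψ) (x.drop k) := by
  induction n using WellFoundedLT.induction generalizing k with
  | ind n ih =>
    rw [satD_until] at h
    rcases h with h | ⟨h, h'⟩
    · exact ⟨0, hψ n k h, by simp⟩
    · obtain ⟨m, hm, hmn⟩ := (hV _ _ _ h').resolve_left id
      obtain ⟨j, hj, hj'⟩ := ih m (hmn id) hm
      simp only [Stream'.drop_drop] at hj hj'
      refine ⟨j + 1, ?_, fun i hi => ?_⟩
      · rw [Stream'.drop_drop, show k + (j + 1) = k + 1 + j by omega]
        exact hj
      · cases i with
        | zero => exact hφ n k h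
        | succ i =>
          rw [Stream'.drop_drop, show k + (i + 1) = k + 1 + i by omega]
          exact hj' i (by omega)

/-- The obligation is passed on, together with `ψ`, until the first position at which `φ` holds, or
forever. Ranks play no role. -/
theorem Consistent.release (hV : Consistent A x V) {φ ψ : RLTLp Ψ}
    (hφ : ∀ n k, SatD A (V n (k + 1)) (x.get k) φ → Models A φ (x.drop k))
    (hψ : ∀ n k, SatD A (V n (k + 1)) (x.get k) ψ → Models A ψ (x.drop k))
    {n : Ordinal.{0}} {k : ℕ} (h : SatD A (V n (k + 1)) (x.get k) (release φ ψ)) :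
    Models A (release φ ψ) (x.drop k) := by
  have step : ∀ n k, SatD A (V n (k + 1)) (x.get k) (.release φ ψ) → Models A ψ (x.drop k) ∧
      (Models A φ (x.drop k) ∨ ∃ m, SatD A (V m (k + 1 + 1)) (x.get (k + 1)) (.release φ ψ)) := by
    intro n k h
    rw [satD_release] at h
    refine ⟨hψ n k h.1, h.2.imp (hφ n k) fun h => ?_⟩
    obtain ⟨m, hm, -⟩ := (hV _ _ _ h).resolve_left id
    exact ⟨m, hm⟩
  by_cases hex : ∃ j, Models A φ (x.drop (k + j))
  · classical
    right
    refine ⟨Nat.find hex, by rw [Stream'.drop_drop]; exact Nat.find_spec hex, fun i hi => ?_⟩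
    have : ∃ m, SatD A (V m (k + i + 1)) (x.get (k + i)) (.release φ ψ) := by
      induction i with
      | zero => exact ⟨n, h⟩
      | succ i ih =>
        obtain ⟨m, hm⟩ := ih (by omega)
        exact (step m _ hm).2.resolve_left (Nat.find_min hex (by omega))
    obtain ⟨m, hm⟩ := this
    rw [Stream'.drop_drop]
    exact (step m _ hm).1
  · left
    intro i
    have : ∃ m, SatD A (V m (k + i + 1)) (x.get (k + i)) (.release φ ψ) := by
      induction i with
      | zero => exact ⟨n, h⟩
      | succ i ih =>
        obtain ⟨m, hm⟩ := ih
        exact (step m _ hm).2.resolve_left fun h => hex ⟨i, h⟩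
    obtain ⟨m, hm⟩ := this
    rw [Stream'.drop_drop]
    exact (step m _ hm).1

theorem Consistent.uimpl (hV : Consistent A x V) {φ : RLTLp Ψ}
    (hφ : ∀ n k, SatD A (V n (k + 1)) (x.get k) φ → Models A φ (x.drop k))
    {n : Ordinal.{0}} {k : ℕ} {R : ERE Ψ} (h : SatD A (V n (k + 1)) (x.get k) (uimpl R φ)) :
    Models A (uimpl R φ) (x.drop k) := by
  rw [models_uimpl]
  intro j hj
  induction j generalizing n k R with
  | zero =>
    rw [satD_uimpl] at h
    refine hφ n k (h.1 ?_)
    rw [Stream'.take_succ, Stream'.take_zero] at hj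
    simpa using hj
  | succ j ih =>
    rw [satD_uimpl] at h
    rw [take_drop_succ_mem_iff] at hj
    have e : (x.drop k).drop (j + 1) = (x.drop (k + 1)).drop j := by
      rw [Stream'.drop_drop, Stream'.drop_drop, show k + (j + 1) = k + 1 + j by omega]
    rw [e]
    rcases hV _ _ _ h.2 with h | ⟨m, hm, -⟩
    · exact (models_uimpl _ _ _ _).1 (models_of_triv h _) j hj
    · exact ih hm hj

/-- Coinduction on the positions at which the ω-power is an obligation. Each single factor is an
instance of `◇→` and therefore ends. -/
theorem Consistent.ocl (hV : Consistent A x V) {n : Ordinal.{0}} {k : ℕ} {R : ERE Ψ}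
    (h : V n k (ocl R)) : Models A (ocl R) (x.drop k) := by
  refine mem_omegaPow_of_forall (P := fun y => ∃ n k, y = x.drop k ∧ V n k (RLTLp.ocl R)) ?_
    ⟨n, k, rfl, h⟩
  rintro _ ⟨n, k, rfl, h⟩
  obtain ⟨m, hm, -⟩ := (hV _ _ _ h).resolve_left id
  -- The ω-power has the same expansion as `R ◇→ X R^ω`.
  have hm' : SatD A (V m (k + 1)) (x.get k) (.eimpl R (next (.ocl R))) := by
    rw [satD_eimpl, satD_next, satF_ocl, ← satD_ocl]
    exact hm
  obtain ⟨j, hj, m', hm'⟩ := hV.eimpl m hm'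
  rw [satD_next, satF_ocl] at hm'
  refine ⟨j, ⟨hj, ?_⟩, m', k + j + 1, Stream'.drop_drop _ _ _, hm'⟩
  rw [Stream'.take_succ]
  exact List.cons_ne_nil _ _

theorem Consistent.models_of_satF (hV : Consistent A x V) {φ : RLTLp Ψ} (hφ : φ.NonBoolean)
    (h : ∀ n k, SatD A (V n (k + 1)) (x.get k) φ → Models A φ (x.drop k)) {n : Ordinal.{0}}
    {k : ℕ} (h' : SatF A (V n k) φ) : Models A φ (x.drop k) := by
  rcases h'.of_nonBoolean hφ with rfl | h'
  · exact models_top A _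
  · rcases hV _ _ _ h' with h' | ⟨m, hm, -⟩
    · exact models_of_triv h' _
    · exact h m k hm

theorem Consistent.models (hV : Consistent A x V) (φ : RLTLp Ψ) :
    (∀ n k, SatD A (V n (k + 1)) (x.get k) φ → Models A φ (x.drop k)) ∧
    (∀ n k, SatF A (V n k) φ → Models A φ (x.drop k)) := by
  induction φ with
  | or φ ψ h₁ h₂ =>
    simp only [satD_or, satF_or]
    exact ⟨fun n k => Or.imp (h₁.1 n k) (h₂.1 n k), fun n k => Or.imp (h₁.2 n k) (h₂.2 n k)⟩
  | and φ ψ h₁ h₂ =>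
    simp only [satD_and, satF_and]
    exact ⟨fun n k => And.imp (h₁.1 n k) (h₂.1 n k), fun n k => And.imp (h₁.2 n k) (h₂.2 n k)⟩
  | pred α =>
    have key : ∀ n k, SatD A (V n (k + 1)) (x.get k) (.pred α) →
        Models A (.pred α) (x.drop k) := fun n k h => by
      rw [satD_pred] at h
      rwa [Models, Stream'.get_drop]
    exact ⟨key, fun n k => hV.models_of_satF (by exact trivial) key⟩
  | next φ h =>
    have key : ∀ n k, SatD A (V n (k + 1)) (x.get k) (.next φ) →
        Models A (.next φ) (x.drop k) := fun n k h' => by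
      rw [satD_next] at h'
      rw [Models, Stream'.drop_drop]
      exact h.2 n _ h'
    exact ⟨key, fun n k => hV.models_of_satF (by exact trivial) key⟩
  | release φ ψ h₁ h₂ =>
    have key := fun n k => hV.release h₁.1 h₂.1 (n := n) (k := k)
    exact ⟨key, fun n k => hV.models_of_satF (by exact trivial) key⟩
  | eimpl R φ h =>
    have key : ∀ n k, SatD A (V n (k + 1)) (x.get k) (.eimpl R φ) →
        Models A (.eimpl R φ) (x.drop k) := fun n k h' => by
      obtain ⟨j, hj, m, hm⟩ := hV.eimpl n h'
      refine (models_eimpl _ _ _ _).2 ⟨j, hj, ?_⟩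
      rw [Stream'.drop_drop]
      exact h.1 m _ hm
    exact ⟨key, fun n k => hV.models_of_satF (by exact trivial) key⟩
  | uimpl R φ h =>
    have key := fun n k => hV.uimpl h.1 (n := n) (k := k) (R := R)
    exact ⟨key, fun n k => hV.models_of_satF (by exact trivial) key⟩
  | wcl R =>
    have key : ∀ n k, SatD A (V n (k + 1)) (x.get k) (.wcl R) →
        Models A (.wcl R) (x.drop k) := fun n k h => by
      rw [satD_wcl] at h
      exact h.elim (fun h => models_of_triv (p := RLTLp.wcl R) h _)
        fun h => weakClosure_drop_of_lder (hV.wcl h)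
    exact ⟨key, fun n k => hV.models_of_satF (by exact trivial) key⟩
  | nwcl R =>
    have key : ∀ n k, SatD A (V n (k + 1)) (x.get k) (.nwcl R) →
        Models A (.nwcl R) (x.drop k) := fun n k h hw => by
      rw [satD_nwcl] at h
      have := (models_wcl_lder hw h.1).1
      rw [Stream'.drop_drop, Stream'.get_drop] at this
      exact hV.nwcl n h.2 this
    exact ⟨key, fun n k => hV.models_of_satF (by exact trivial) key⟩
  | ocl R =>
    refine ⟨fun n k h => ?_, fun n k h => hV.ocl ((satF_ocl _ _ _).1 h)⟩
    have h' : SatD A (V n (k + 1)) (x.get k) (.eimpl R (next (.ocl R))) := by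
      rw [satD_eimpl, satD_next, satF_ocl, ← satD_ocl]
      exact h
    obtain ⟨j, hj, m, hm⟩ := hV.eimpl n h'
    rw [satD_next, satF_ocl] at hm
    refine (mem_omegaPow_iff _ _).2 ⟨j, ⟨hj, ?_⟩, ?_⟩
    · rw [Stream'.take_succ]
      exact List.cons_ne_nil _ _
    · rw [Stream'.drop_drop]
      exact hV.ocl hm
  | _ φ ψ h₁ h₂ =>
    have key := fun n k => hV.until h₁.1 h₂.1 n (k := k)
    exact ⟨key, fun n k => hV.models_of_satF (by exact trivial) key⟩

end Consistent

/-- The certificate satisfies the simplified transitions only. To recover the unsimplified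
derivatives, the good states are closed under language preserving rewriting and enlarged by the
`Triv` formulas that simplification may have erased. -/
theorem models_of_acceptsFrom [Nonempty D] {A : EBA D Ψ} {tf : RLTLp Ψ → TT Ψ (RLTLp Ψ)}
    {φ : RLTLp Ψ} (hfin : {q | States tf φ q}.Finite) (htf : IsDerivTF A tf φ) {x : Stream' D}
    (h : (aba A tf φ hfin).AcceptsFrom A x φ) : Models A φ x := by
  obtain ⟨G, r, hGr, hG, hQ⟩ := ABA.ranked_of_acceptsFrom A _ States.init h
  -- The bound `n` constrains non-accepting states only, as `Ranked` does for successors; with `n`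
  -- the rank of a state, this is exactly what its transition provides.
  let V : Ordinal.{0} → ℕ → RLTLp Ψ → Prop := fun n k p =>
    Triv A p ∨ ∃ p', Equ A p' p ∧ G k p' ∧ (Acc A p' ∨ r k p' < n)
  have hinv : ∀ n k, Invariant A (V n k) := by
    intro n k p p' hp
    exact Or.imp hp.triv fun ⟨q, hq, h⟩ => ⟨q, hq.trans hp, h⟩
  have hstep : ∀ k p, G k p → SatD A (V (r k p) (k + 1)) (x.get k) p := by
    intro k p hp
    refine (htf p (hQ k p hp) (x.get k)).satF_of_satF (hinv _ _) (fun _ => Or.inl) ?_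
    have := hGr k p hp
    simp only [aba, TT.leafOf_map] at this
    exact BCp.Sat.mono this fun p' _ h => Or.inr ⟨p', .refl _, h.1, h.2.imp And.right id⟩
  have hV : Consistent A x V := by
    rintro n k p (h | ⟨p', hp', hGp', h⟩)
    · exact Or.inl h
    · refine Or.inr ⟨_, hp'.satD (hinv _ _) (hstep k p' hGp'), fun hacc => ?_⟩
      exact h.resolve_left fun h => hacc (hp'.acc_iff.1 h)
  exact (hV.models φ).1 _ 0 (hstep 0 φ hG)

theorem lang_eq_lang_aba [Nonempty D] {A : EBA D Ψ} {tf : RLTLp Ψ → TT Ψ (RLTLp Ψ)}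
    {φ : RLTLp Ψ} (hfin : {q | States tf φ q}.Finite) (htf : IsDerivTF A tf φ) :
    φ.lang A = (aba A tf φ hfin).lang A :=
  Set.ext fun _ => ⟨acceptsFrom_of_models hfin htf, models_of_acceptsFrom hfin htf⟩

end RLTLp

/-! ### Finiteness of the set of left quotients -/

/-- The word `u` ends inside the first factor, or is split as `v ++ w` with `v ∈ L` and `w` a prefix
of the second. A quotient of `L * M` is hence determined by a quotient of `L` and a set of quotients
of `M`. -/
theorem Language.finite_range_leftQuotient_mul {D : Type u} {L M : Language D}
    (hL : (Set.range L.leftQuotient).Finite) (hM : (Set.range M.leftQuotient).Finite) :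
    (Set.range (L * M).leftQuotient).Finite := by
  refine (hL.image2 (fun K (s : Set (Language D)) => K * M + ⨆ N : s, (N : Language D))
    hM.powerset).subset ?_
  rintro _ ⟨u, rfl⟩
  refine ⟨_, ⟨u, rfl⟩, {N | ∃ v w, u = v ++ w ∧ v ∈ L ∧ N = M.leftQuotient w}, ?_, ?_⟩
  · rintro _ ⟨v, w, -, -, rfl⟩
    exact ⟨w, rfl⟩
  · ext y
    simp only [Language.mem_add, Language.mem_mul, Language.mem_iSup, Language.mem_leftQuotient]
    constructor
    · rintro (⟨z, hz, t, ht, rfl⟩ | ⟨⟨_, v, w, rfl, hv, rfl⟩, hy⟩)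
      · exact ⟨_, hz, t, ht, by simp⟩
      · exact ⟨v, hv, _, hy, by simp⟩
    · rintro ⟨p, hp, q, hq, h⟩
      rcases List.append_eq_append_iff.1 h with ⟨c, rfl, rfl⟩ | ⟨c, rfl, rfl⟩
      · exact Or.inr ⟨⟨_, p, c, rfl, hp, rfl⟩, hq⟩
      · exact Or.inl ⟨c, hp, q, hq, rfl⟩

/-- The border between `u` and `y` falls in, or at the end of, a factor `w ++ z`, with whole factors
on either side. For empty `u` there need not be any factor. -/
theorem Language.append_mem_kstar_iff {D : Type u} {L : Language D} {u y : List D} (hu : u ≠ []) :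
    u ++ y ∈ KStar.kstar L ↔ ∃ v w z t, u = v ++ w ∧ y = z ++ t ∧ v ∈ KStar.kstar L ∧
      w ++ z ∈ L ∧ t ∈ KStar.kstar L := by
  constructor
  · intro h
    induction hn : u.length using Nat.strong_induction_on generalizing u with
    | _ n ih =>
      subst hn
      cases u with
      | nil => exact (hu rfl).elim
      | cons a u =>
        obtain ⟨p, q, hp, hq, e⟩ := ERE.cons_mem_kstar.1 h
        rcases List.append_eq_append_iff.1 e with ⟨c, rfl, rfl⟩ | ⟨c, rfl, rfl⟩
        · by_cases hc : c = []
          · subst hc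
            exact ⟨[], _, [], y, rfl, rfl, Language.nil_mem_kstar L, by simpa using hp,
              by simpa using hq⟩
          · obtain ⟨v, w, z, t, rfl, rfl, hv, hw, ht⟩ := ih c.length (by simp) hc hq rfl
            exact ⟨(a :: p) ++ v, w, z, t, by simp, rfl,
              ERE.cons_mem_kstar.2 ⟨p, v, hp, hv, rfl⟩, hw, ht⟩
        · exact ⟨[], _, c, q, rfl, rfl, Language.nil_mem_kstar L, hp, hq⟩
  · rintro ⟨v, w, z, t, rfl, rfl, ⟨l₁, rfl, h₁⟩, hw, ⟨l₂, rfl, h₂⟩⟩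
    refine ⟨l₁ ++ (w ++ z) :: l₂, by simp, fun y hy => ?_⟩
    rw [List.mem_append, List.mem_cons] at hy
    rcases hy with hy | rfl | hy
    · exact h₁ y hy
    · exact hw
    · exact h₂ y hy

theorem Language.finite_range_leftQuotient_kstar {D : Type u} {L : Language D}
    (hL : (Set.range L.leftQuotient).Finite) :
    (Set.range (KStar.kstar L).leftQuotient).Finite := by
  -- A quotient by a nonempty word is a union of quotients of `L` followed by `L*`; the quotient by
  -- the empty word is added separately.
  refine ((hL.powerset.image
    fun s : Set (Language D) => (⨆ N : s, (N : Language D)) * KStar.kstar L).insert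
      (KStar.kstar L)).subset ?_
  rintro _ ⟨u, rfl⟩
  by_cases hu : u = []
  · subst hu
    exact Or.inl rfl
  refine Or.inr ⟨{N | ∃ v w, u = v ++ w ∧ v ∈ KStar.kstar L ∧ N = L.leftQuotient w}, ?_, ?_⟩
  · rintro _ ⟨v, w, -, -, rfl⟩
    exact ⟨w, rfl⟩
  · ext y
    simp only [Language.mem_mul, Language.mem_iSup, Language.mem_leftQuotient,
      Language.append_mem_kstar_iff hu]
    constructor
    · rintro ⟨z, ⟨⟨_, v, w, rfl, hv, rfl⟩, hz⟩, t, ht, rfl⟩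
      exact ⟨v, w, z, t, rfl, rfl, hv, hz, ht⟩
    · rintro ⟨v, w, z, t, rfl, rfl, hv, hz, ht⟩
      exact ⟨z, ⟨⟨_, v, w, rfl, hv, rfl⟩, hz⟩, t, ht, rfl⟩

namespace ERE

variable {D : Type u} {Ψ : Type v}

/-- Finiteness does not depend on the alphabet: a predicate has at most the quotients itself, `1`
and `0`, and every operation preserves finiteness. -/
theorem finite_range_leftQuotient (A : EBA D Ψ) (R : ERE Ψ) :
    (Set.range (R.lang A).leftQuotient).Finite := by
  induction R with
  | pred α =>
    refine (Set.toFinite {(pred α).lang A, 1, 0}).subset ?_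
    rintro _ ⟨u, rfl⟩
    match u with
    | [] => exact Or.inl rfl
    | [a] =>
      by_cases ha : a ∈ A.den α
      · refine Or.inr (Or.inl ?_)
        ext y
        refine ⟨?_, ?_⟩
        · rintro ⟨b, -, h⟩
          exact (List.cons.inj h).2
        · intro hy
          rw [Language.mem_one] at hy
          subst hy
          exact ⟨a, ha, rfl⟩
      · refine Or.inr (Or.inr ?_)
        ext y
        refine iff_of_false ?_ (Language.notMem_zero y)
        rintro ⟨b, hb, h⟩
        exact ha ((List.cons.inj h).1 ▸ hb)
    | a :: b :: u =>
      refine Or.inr (Or.inr ?_)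
      ext y
      refine iff_of_false ?_ (Language.notMem_zero y)
      rintro ⟨c, -, h⟩
      simp at h
  | eps =>
    refine (Set.toFinite {1, 0}).subset ?_
    rintro _ ⟨u, rfl⟩
    cases u with
    | nil => exact Or.inl rfl
    | cons a u =>
      refine Or.inr ?_
      ext y
      refine iff_of_false ?_ (Language.notMem_zero y)
      rintro ⟨⟩
  | union R S hR hS =>
    refine (hR.image2 (fun K L => K + L) hS).subset ?_
    rintro _ ⟨u, rfl⟩
    exact ⟨_, ⟨u, rfl⟩, _, ⟨u, rfl⟩, rfl⟩
  | inter R S hR hS =>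
    refine (hR.image2 (fun K L => K ⊓ L) hS).subset ?_
    rintro _ ⟨u, rfl⟩
    exact ⟨_, ⟨u, rfl⟩, _, ⟨u, rfl⟩, rfl⟩
  | conc R S hR hS => exact Language.finite_range_leftQuotient_mul hR hS
  | star R hR => exact Language.finite_range_leftQuotient_kstar hR
  | compl R hR =>
    refine (hR.image fun K => Kᶜ).subset ?_
    rintro _ ⟨u, rfl⟩
    exact ⟨_, ⟨u, rfl⟩, rfl⟩

open Classical in
/-- A regular expression for the language `L`, if there is one. -/
noncomputable def ofLang (A : EBA D Ψ) (L : Language D) : ERE Ψ :=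
  if h : ∃ R : ERE Ψ, R.lang A = L then h.choose else eps

/-- The canonical representative of the regular expressions with the language of `R`. -/
noncomputable def rep (A : EBA D Ψ) (R : ERE Ψ) : ERE Ψ := ofLang A (R.lang A)

theorem lang_rep (A : EBA D Ψ) (R : ERE Ψ) : (R.rep A).lang A = R.lang A := by
  have h : ∃ S : ERE Ψ, S.lang A = R.lang A := ⟨R, rfl⟩
  rw [rep, ofLang, dif_pos h]
  exact h.choose_spec

/-- Guarantees that `ofLang` never falls back to its default on a left quotient. -/
theorem exists_lang_eq_leftQuotient (A : EBA D Ψ) (R : ERE Ψ) (u : List D) :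
    ∃ S : ERE Ψ, S.lang A = (R.lang A).leftQuotient u := by
  induction u generalizing R with
  | nil => exact ⟨R, rfl⟩
  | cons a u ih =>
    obtain ⟨S, hS⟩ := ih (R.lder A a)
    refine ⟨S, hS.trans ?_⟩
    ext y
    exact mem_lang_lder A a R (u ++ y)

/-- The regular expression `R` and the canonical representatives of its iterated derivatives. -/
def derivatives (A : EBA D Ψ) (R : ERE Ψ) : Set (ERE Ψ) :=
  {R} ∪ ofLang A '' Set.range (R.lang A).leftQuotient

theorem finite_derivatives (A : EBA D Ψ) (R : ERE Ψ) : (R.derivatives A).Finite :=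
  (Set.finite_singleton R).union ((finite_range_leftQuotient A R).image _)

theorem self_mem_derivatives (A : EBA D Ψ) (R : ERE Ψ) : R ∈ R.derivatives A := Or.inl rfl

theorem rep_mem_derivatives (A : EBA D Ψ) (R : ERE Ψ) : R.rep A ∈ R.derivatives A :=
  Or.inr ⟨_, ⟨[], rfl⟩, rfl⟩

theorem rep_lder_mem_derivatives (A : EBA D Ψ) {R S : ERE Ψ} (hS : S ∈ R.derivatives A) (a : D) :
    (S.lder A a).rep A ∈ R.derivatives A := by
  obtain ⟨u, hu⟩ : ∃ u, S.lang A = (R.lang A).leftQuotient u := by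
    rcases hS with rfl | ⟨_, ⟨u, rfl⟩, rfl⟩
    · exact ⟨[], rfl⟩
    · obtain ⟨T, hT⟩ := exists_lang_eq_leftQuotient A R u
      exact ⟨u, by rw [← hT]; exact lang_rep A T⟩
  refine Or.inr ⟨_, ⟨u ++ [a], rfl⟩, ?_⟩
  rw [rep]
  congr 1
  ext y
  rw [mem_lang_lder, hu, Language.mem_leftQuotient, Language.mem_leftQuotient]
  simp

end ERE

/-! ### Pruning of unreachable leaves -/

namespace TT

variable {D : Type u} {Ψ : Type v} {S : Type w}

/-- `X` collects the letters that can reach the current subterm. Where it is empty, the leaf is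
replaced by the default `d`. -/
theorem exists_leaves_reachable_on (A : EBA D Ψ) (d : S) (f : TT Ψ S) (X : Set D) :
    ∃ g : TT Ψ S, (∀ a ∈ X, g.leafOf A a = f.leafOf A a) ∧
      ∀ l ∈ g.leaves, l = d ∨ ∃ a ∈ X, l = f.leafOf A a := by
  induction f generalizing X with
  | leaf s =>
    rcases X.eq_empty_or_nonempty with rfl | ⟨a, ha⟩
    · exact ⟨.leaf d, by simp, fun l hl => Or.inl hl⟩
    · exact ⟨.leaf s, fun _ _ => rfl, fun l hl => Or.inr ⟨a, ha, hl⟩⟩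
  | ite α f₁ f₂ h₁ h₂ =>
    obtain ⟨g₁, hg₁, hl₁⟩ := h₁ (X ∩ A.den α)
    obtain ⟨g₂, hg₂, hl₂⟩ := h₂ (X \ A.den α)
    refine ⟨.ite α g₁ g₂, fun a ha => ?_, ?_⟩
    · simp only [leafOf]
      split_ifs with h
      · exact hg₁ a ⟨ha, h⟩
      · exact hg₂ a ⟨ha, h⟩
    · rintro l (hl | hl)
      · refine (hl₁ l hl).imp id ?_
        rintro ⟨a, ha, rfl⟩
        exact ⟨a, ha.1, by simp [leafOf, ha.2]⟩
      · refine (hl₂ l hl).imp id ?_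
        rintro ⟨a, ha, rfl⟩
        exact ⟨a, ha.1, by simp [leafOf, ha.2]⟩

/-- Up to functional equivalence, all leaves of a transition term are reachable. -/
theorem exists_leaves_reachable [Nonempty D] (A : EBA D Ψ) (f : TT Ψ S) :
    ∃ g : TT Ψ S, (∀ a, g.leafOf A a = f.leafOf A a) ∧
      ∀ l ∈ g.leaves, ∃ a, l = f.leafOf A a := by
  obtain ⟨a₀⟩ := ‹Nonempty D›
  obtain ⟨g, hg, hl⟩ := exists_leaves_reachable_on A (f.leafOf A a₀) f Set.univ
  refine ⟨g, fun a => hg a trivial, fun l hl' => ?_⟩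
  rcases hl l hl' with h | ⟨a, -, h⟩
  · exact ⟨a₀, h⟩
  · exact ⟨a, h⟩

end TT

/-! ### Finiteness of the state set -/

namespace RLTLp

variable {D : Type u} {Ψ : Type v}

/-- Normalization of the regular expressions outside of modal operators. -/
noncomputable def canon (A : EBA D Ψ) : RLTLp Ψ → RLTLp Ψ
  | or φ ψ => or (canon A φ) (canon A ψ)
  | and φ ψ => and (canon A φ) (canon A ψ)
  | eimpl R φ => eimpl (R.rep A) φ
  | uimpl R φ => uimpl (R.rep A) φ
  | wcl R => wcl (R.rep A)
  | nwcl R => nwcl (R.rep A)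
  | φ => φ

theorem simp_canon (A : EBA D Ψ) (φ : RLTLp Ψ) : Simp A φ (canon A φ) := by
  induction φ with
  | or φ ψ h₁ h₂ => exact .or h₁ h₂
  | and φ ψ h₁ h₂ => exact .and h₁ h₂
  | eimpl R φ => exact .eimpl φ (ERE.lang_rep A R).symm
  | uimpl R φ => exact .uimpl φ (ERE.lang_rep A R).symm
  | wcl R => exact .wcl (ERE.lang_rep A R).symm
  | nwcl R => exact .nwcl (ERE.lang_rep A R).symm
  | _ => exact .bool fun _ => Iff.rfl

/-- The non-Boolean subformulas of a formula. -/
def modalSubs (φ : RLTLp Ψ) : Set (RLTLp Ψ) := {p | p ∈ φ.subformulas ∧ p.NonBoolean}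

section modalSubs

variable (φ ψ : RLTLp Ψ) (R : ERE Ψ) (N : Set (RLTLp Ψ))

theorem modalSubs_or_subset :
    (or φ ψ).modalSubs ⊆ N ↔ φ.modalSubs ⊆ N ∧ ψ.modalSubs ⊆ N := by
  have : (or φ ψ).modalSubs = φ.modalSubs ∪ ψ.modalSubs := by
    ext p
    simp only [modalSubs, subformulas, Set.mem_ofPred_eq, Set.mem_union, Set.mem_singleton_iff]
    constructor
    · rintro ⟨(rfl | h) | h, h'⟩
      · exact h'.elim
      · exact Or.inl ⟨h, h'⟩
      · exact Or.inr ⟨h, h'⟩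
    · rintro (⟨h, h'⟩ | ⟨h, h'⟩)
      · exact ⟨Or.inl (Or.inr h), h'⟩
      · exact ⟨Or.inr h, h'⟩
  rw [this, Set.union_subset_iff]

theorem modalSubs_and_subset :
    (and φ ψ).modalSubs ⊆ N ↔ φ.modalSubs ⊆ N ∧ ψ.modalSubs ⊆ N := by
  have : (and φ ψ).modalSubs = φ.modalSubs ∪ ψ.modalSubs := by
    ext p
    simp only [modalSubs, subformulas, Set.mem_ofPred_eq, Set.mem_union, Set.mem_singleton_iff]
    constructor
    · rintro ⟨(rfl | h) | h, h'⟩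
      · exact h'.elim
      · exact Or.inl ⟨h, h'⟩
      · exact Or.inr ⟨h, h'⟩
    · rintro (⟨h, h'⟩ | ⟨h, h'⟩)
      · exact ⟨Or.inl (Or.inr h), h'⟩
      · exact ⟨Or.inr h, h'⟩
  rw [this, Set.union_subset_iff]

variable {φ ψ R N}

theorem modalSubs_pred_subset {α : Ψ} (h : pred α ∈ N) : (pred α).modalSubs ⊆ N := by
  rintro p ⟨rfl, -⟩
  exact h

theorem modalSubs_next_subset (h : next φ ∈ N) (h' : φ.modalSubs ⊆ N) :
    (next φ).modalSubs ⊆ N := by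
  rintro p ⟨rfl | hp, hp'⟩
  · exact h
  · exact h' ⟨hp, hp'⟩

theorem modalSubs_until_subset (h : .until φ ψ ∈ N) (h₁ : φ.modalSubs ⊆ N)
    (h₂ : ψ.modalSubs ⊆ N) : (RLTLp.until φ ψ).modalSubs ⊆ N := by
  rintro p ⟨(rfl | hp) | hp, hp'⟩
  · exact h
  · exact h₁ ⟨hp, hp'⟩
  · exact h₂ ⟨hp, hp'⟩

theorem modalSubs_release_subset (h : release φ ψ ∈ N) (h₁ : φ.modalSubs ⊆ N)
    (h₂ : ψ.modalSubs ⊆ N) : (release φ ψ).modalSubs ⊆ N := by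
  rintro p ⟨(rfl | hp) | hp, hp'⟩
  · exact h
  · exact h₁ ⟨hp, hp'⟩
  · exact h₂ ⟨hp, hp'⟩

theorem modalSubs_eimpl_subset (h : eimpl R φ ∈ N) (h' : φ.modalSubs ⊆ N) :
    (eimpl R φ).modalSubs ⊆ N := by
  rintro p ⟨rfl | hp, hp'⟩
  · exact h
  · exact h' ⟨hp, hp'⟩

theorem modalSubs_uimpl_subset (h : uimpl R φ ∈ N) (h' : φ.modalSubs ⊆ N) :
    (uimpl R φ).modalSubs ⊆ N := by
  rintro p ⟨rfl | hp, hp'⟩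
  · exact h
  · exact h' ⟨hp, hp'⟩

theorem modalSubs_wcl_subset (h : wcl R ∈ N) : (wcl R).modalSubs ⊆ N := by
  rintro p ⟨rfl, -⟩
  exact h

theorem modalSubs_nwcl_subset (h : nwcl R ∈ N) : (nwcl R).modalSubs ⊆ N := by
  rintro p ⟨rfl, -⟩
  exact h

theorem modalSubs_ocl_subset (h : ocl R ∈ N) : (ocl R).modalSubs ⊆ N := by
  rintro p ⟨rfl, -⟩
  exact h

end modalSubs

/-- The non-Boolean formulas in the normalized derivatives of `φ` belong to `N`. -/
def DerivIn (A : EBA D Ψ) (N : Set (RLTLp Ψ)) (φ : RLTLp Ψ) : Prop :=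
  ∀ a, (canon A ((deriv A φ).leafOf A a)).modalSubs ⊆ N

section DerivIn

variable {A : EBA D Ψ} {N : Set (RLTLp Ψ)} {φ ψ : RLTLp Ψ} {R : ERE Ψ}

theorem DerivIn.mono {N' : Set (RLTLp Ψ)} (h : DerivIn A N φ) (hN : N ⊆ N') : DerivIn A N' φ :=
  fun a => (h a).trans hN

theorem canon_derivPred_subset (hN : {top A, bot A} ⊆ N) (α : Ψ) (a : D) :
    (canon A ((derivPred A α).leafOf A a)).modalSubs ⊆ N := by
  simp only [derivPred, TT.leafOf]
  split_ifs
  · exact modalSubs_pred_subset (hN (Or.inl rfl))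
  · exact modalSubs_pred_subset (hN (Or.inr rfl))

theorem derivIn_pred (hN : {top A, bot A} ⊆ N) (α : Ψ) : DerivIn A N (pred α) :=
  canon_derivPred_subset hN α

theorem DerivIn.or (h₁ : DerivIn A N φ) (h₂ : DerivIn A N ψ) : DerivIn A N (or φ ψ) := by
  intro a
  simp only [deriv, TT.leafOf_map₂, canon, modalSubs_or_subset]
  exact ⟨h₁ a, h₂ a⟩

theorem DerivIn.and (h₁ : DerivIn A N φ) (h₂ : DerivIn A N ψ) : DerivIn A N (and φ ψ) := by
  intro a
  simp only [deriv, TT.leafOf_map₂, canon, modalSubs_and_subset]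
  exact ⟨h₁ a, h₂ a⟩

theorem derivIn_next (h : (canon A φ).modalSubs ⊆ N) : DerivIn A N (next φ) :=
  fun _ => h

theorem DerivIn.until (h₁ : DerivIn A N φ) (h₂ : DerivIn A N ψ)
    (h : (RLTLp.until φ ψ).modalSubs ⊆ N) : DerivIn A N (.until φ ψ) := by
  intro a
  simp only [deriv, TT.leafOf_map₂, TT.leafOf, canon, modalSubs_or_subset, modalSubs_and_subset]
  exact ⟨h₂ a, h₁ a, h⟩

theorem DerivIn.release (h₁ : DerivIn A N φ) (h₂ : DerivIn A N ψ)
    (h : (RLTLp.release φ ψ).modalSubs ⊆ N) : DerivIn A N (.release φ ψ) := by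
  intro a
  simp only [deriv, TT.leafOf_map₂, TT.leafOf, canon, modalSubs_or_subset, modalSubs_and_subset]
  exact ⟨h₂ a, h₁ a, h⟩

theorem DerivIn.eimpl (hN : {top A, bot A} ⊆ N) (h : DerivIn A N φ) (hφ : φ.modalSubs ⊆ N)
    (hR : ∀ a, RLTLp.eimpl ((R.lder A a).rep A) φ ∈ N) : DerivIn A N (.eimpl R φ) := by
  intro a
  simp only [deriv, TT.leafOf_map₂, TT.leafOf_map, canon, modalSubs_or_subset,
    modalSubs_and_subset]
  exact ⟨⟨canon_derivPred_subset hN _ a, h a⟩, modalSubs_eimpl_subset (hR a) hφ⟩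

theorem DerivIn.uimpl (hN : {top A, bot A} ⊆ N) (h : DerivIn A N φ) (hφ : φ.modalSubs ⊆ N)
    (hR : ∀ a, RLTLp.uimpl ((R.lder A a).rep A) φ ∈ N) : DerivIn A N (.uimpl R φ) := by
  intro a
  simp only [deriv, TT.leafOf_map₂, TT.leafOf_map, canon, modalSubs_or_subset,
    modalSubs_and_subset]
  exact ⟨⟨canon_derivPred_subset hN _ a, h a⟩, modalSubs_uimpl_subset (hR a) hφ⟩

theorem derivIn_wcl (hN : {top A, bot A} ⊆ N) (hR : ∀ a, wcl ((R.lder A a).rep A) ∈ N) :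
    DerivIn A N (wcl R) := by
  intro a
  simp only [deriv]
  split_ifs
  · exact modalSubs_pred_subset (hN (Or.inl rfl))
  · rw [TT.leafOf_map]
    exact modalSubs_wcl_subset (hR a)

theorem derivIn_nwcl (hN : {top A, bot A} ⊆ N) (hR : ∀ a, nwcl ((R.lder A a).rep A) ∈ N) :
    DerivIn A N (nwcl R) := by
  intro a
  simp only [deriv]
  split_ifs
  · exact modalSubs_pred_subset (hN (Or.inr rfl))
  · rw [TT.leafOf_map]
    exact modalSubs_nwcl_subset (hR a)

theorem derivIn_ocl (hN : {top A, bot A} ⊆ N) (h : ocl R ∈ N) (h' : next (ocl R) ∈ N)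
    (hR : ∀ a, RLTLp.eimpl ((R.lder A a).rep A) (next (ocl R)) ∈ N) : DerivIn A N (ocl R) := by
  intro a
  simp only [deriv, TT.leafOf_map₂, TT.leafOf_map, TT.leafOf, canon, modalSubs_or_subset,
    modalSubs_and_subset]
  exact ⟨⟨canon_derivPred_subset hN _ a, modalSubs_ocl_subset h⟩,
    modalSubs_eimpl_subset (hR a) (modalSubs_next_subset h' (modalSubs_ocl_subset h))⟩

end DerivIn

/-- `N` is closed under normalized derivatives and contains the non-Boolean formulas of `φ`, its
normalization and its normalized derivatives. -/
structure ClosedFor (A : EBA D Ψ) (φ : RLTLp Ψ) (N : Set (RLTLp Ψ)) : Prop where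
  finite : N.Finite
  subs : φ.modalSubs ⊆ N
  subs_canon : (canon A φ).modalSubs ⊆ N
  deriv : DerivIn A N φ
  closed : ∀ q ∈ N, DerivIn A N q

/-- Structural induction: to the sets of the immediate subformulas, add the formula itself or its
variants over the finite set of representatives of iterated derivatives of `R`. The field
`subs_canon` serves `next φ`, whose normalized derivative is the normalization of `φ`. -/
theorem exists_closedFor (A : EBA D Ψ) (φ : RLTLp Ψ) : ∃ N, ClosedFor A φ N := by
  have hfin : ({top A, bot A} : Set (RLTLp Ψ)).Finite := Set.toFinite _
  have hclosed : ∀ {N : Set (RLTLp Ψ)}, {top A, bot A} ⊆ N →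
      ∀ q ∈ ({top A, bot A} : Set (RLTLp Ψ)), DerivIn A N q := by
    rintro N hN q (rfl | rfl)
    · exact derivIn_pred hN _
    · exact derivIn_pred hN _
  induction φ with
  | pred α =>
    have hN : {top A, bot A} ⊆ (insert (pred α) {top A, bot A} : Set (RLTLp Ψ)) :=
      Set.subset_insert _ _
    refine ⟨insert (pred α) {top A, bot A}, hfin.insert _, modalSubs_pred_subset (Or.inl rfl),
      modalSubs_pred_subset (Or.inl rfl), derivIn_pred hN _, ?_⟩
    rintro q (rfl | hq)
    · exact derivIn_pred hN _
    · exact hclosed hN q hq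
  | or φ ψ h₁ h₂ =>
    obtain ⟨N₁, h₁⟩ := h₁
    obtain ⟨N₂, h₂⟩ := h₂
    have s₁ : N₁ ⊆ N₁ ∪ N₂ := Set.subset_union_left
    have s₂ : N₂ ⊆ N₁ ∪ N₂ := Set.subset_union_right
    refine ⟨N₁ ∪ N₂, h₁.finite.union h₂.finite,
      (modalSubs_or_subset _ _ _).2 ⟨h₁.subs.trans s₁, h₂.subs.trans s₂⟩,
      (modalSubs_or_subset _ _ _).2 ⟨h₁.subs_canon.trans s₁, h₂.subs_canon.trans s₂⟩,
      (h₁.deriv.mono s₁).or (h₂.deriv.mono s₂), ?_⟩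
    rintro q (hq | hq)
    · exact (h₁.closed q hq).mono s₁
    · exact (h₂.closed q hq).mono s₂
  | and φ ψ h₁ h₂ =>
    obtain ⟨N₁, h₁⟩ := h₁
    obtain ⟨N₂, h₂⟩ := h₂
    have s₁ : N₁ ⊆ N₁ ∪ N₂ := Set.subset_union_left
    have s₂ : N₂ ⊆ N₁ ∪ N₂ := Set.subset_union_right
    refine ⟨N₁ ∪ N₂, h₁.finite.union h₂.finite,
      (modalSubs_and_subset _ _ _).2 ⟨h₁.subs.trans s₁, h₂.subs.trans s₂⟩,
      (modalSubs_and_subset _ _ _).2 ⟨h₁.subs_canon.trans s₁, h₂.subs_canon.trans s₂⟩,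
      (h₁.deriv.mono s₁).and (h₂.deriv.mono s₂), ?_⟩
    rintro q (hq | hq)
    · exact (h₁.closed q hq).mono s₁
    · exact (h₂.closed q hq).mono s₂
  | next φ h =>
    obtain ⟨N, h⟩ := h
    have s : N ⊆ insert (next φ) N := Set.subset_insert _ _
    have hd : DerivIn A (insert (next φ) N) (next φ) := derivIn_next (h.subs_canon.trans s)
    have hs := modalSubs_next_subset (Set.mem_insert (next φ) N) (h.subs.trans s)
    refine ⟨insert (next φ) N, h.finite.insert _, hs, hs, hd, ?_⟩
    rintro q (rfl | hq)
    · exact hd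
    · exact (h.closed q hq).mono s
  | release φ ψ h₁ h₂ =>
    obtain ⟨N₁, h₁⟩ := h₁
    obtain ⟨N₂, h₂⟩ := h₂
    have s₁ : N₁ ⊆ insert (release φ ψ) (N₁ ∪ N₂) :=
      Set.subset_union_left.trans (Set.subset_insert _ _)
    have s₂ : N₂ ⊆ insert (release φ ψ) (N₁ ∪ N₂) :=
      Set.subset_union_right.trans (Set.subset_insert _ _)
    have hs := modalSubs_release_subset (Set.mem_insert (release φ ψ) (N₁ ∪ N₂))
      (h₁.subs.trans s₁) (h₂.subs.trans s₂)
    have hd := (h₁.deriv.mono s₁).release (h₂.deriv.mono s₂) hs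
    refine ⟨_, (h₁.finite.union h₂.finite).insert _, hs, hs, hd, ?_⟩
    rintro q (rfl | hq | hq)
    · exact hd
    · exact (h₁.closed q hq).mono s₁
    · exact (h₂.closed q hq).mono s₂
  | eimpl R φ h =>
    obtain ⟨N, h⟩ := h
    obtain ⟨N', e⟩ : ∃ N', N' = N ∪ ({top A, bot A} ∪ (eimpl · φ) '' R.derivatives A) := ⟨_, rfl⟩
    have s : N ⊆ N' := e ▸ Set.subset_union_left
    have hN : {top A, bot A} ⊆ N' := e ▸ Set.subset_union_left.trans Set.subset_union_right
    have hm : ∀ S ∈ R.derivatives A, eimpl S φ ∈ N' := fun S hS =>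
      e ▸ Or.inr (Or.inr ⟨S, hS, rfl⟩)
    have hd : ∀ S ∈ R.derivatives A, DerivIn A N' (eimpl S φ) := fun S hS =>
      (h.deriv.mono s).eimpl hN (h.subs.trans s) fun a => hm _ (ERE.rep_lder_mem_derivatives A hS a)
    refine ⟨N', e ▸ h.finite.union (hfin.union ((R.finite_derivatives A).image _)),
      modalSubs_eimpl_subset (hm _ (R.self_mem_derivatives A)) (h.subs.trans s),
      modalSubs_eimpl_subset (hm _ (R.rep_mem_derivatives A)) (h.subs.trans s),
      hd _ (R.self_mem_derivatives A), fun q hq => ?_⟩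
    rw [e] at hq
    rcases hq with hq | hq | ⟨S, hS, rfl⟩
    · exact (h.closed q hq).mono s
    · exact hclosed hN q hq
    · exact hd S hS
  | uimpl R φ h =>
    obtain ⟨N, h⟩ := h
    obtain ⟨N', e⟩ : ∃ N', N' = N ∪ ({top A, bot A} ∪ (uimpl · φ) '' R.derivatives A) := ⟨_, rfl⟩
    have s : N ⊆ N' := e ▸ Set.subset_union_left
    have hN : {top A, bot A} ⊆ N' := e ▸ Set.subset_union_left.trans Set.subset_union_right
    have hm : ∀ S ∈ R.derivatives A, uimpl S φ ∈ N' := fun S hS =>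
      e ▸ Or.inr (Or.inr ⟨S, hS, rfl⟩)
    have hd : ∀ S ∈ R.derivatives A, DerivIn A N' (uimpl S φ) := fun S hS =>
      (h.deriv.mono s).uimpl hN (h.subs.trans s) fun a => hm _ (ERE.rep_lder_mem_derivatives A hS a)
    refine ⟨N', e ▸ h.finite.union (hfin.union ((R.finite_derivatives A).image _)),
      modalSubs_uimpl_subset (hm _ (R.self_mem_derivatives A)) (h.subs.trans s),
      modalSubs_uimpl_subset (hm _ (R.rep_mem_derivatives A)) (h.subs.trans s),
      hd _ (R.self_mem_derivatives A), fun q hq => ?_⟩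
    rw [e] at hq
    rcases hq with hq | hq | ⟨S, hS, rfl⟩
    · exact (h.closed q hq).mono s
    · exact hclosed hN q hq
    · exact hd S hS
  | wcl R =>
    obtain ⟨N, e⟩ : ∃ N, N = ({top A, bot A} ∪ wcl '' R.derivatives A) := ⟨_, rfl⟩
    have hN : ({top A, bot A} : Set (RLTLp Ψ)) ⊆ N := e ▸ Set.subset_union_left
    have hm : ∀ S ∈ R.derivatives A, wcl S ∈ N := fun S hS => e ▸ Or.inr ⟨S, hS, rfl⟩
    have hd : ∀ S ∈ R.derivatives A, DerivIn A N (wcl S) := fun S hS =>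
      derivIn_wcl hN fun a => hm _ (ERE.rep_lder_mem_derivatives A hS a)
    refine ⟨N, e ▸ hfin.union ((R.finite_derivatives A).image _),
      modalSubs_wcl_subset (hm _ (R.self_mem_derivatives A)),
      modalSubs_wcl_subset (hm _ (R.rep_mem_derivatives A)),
      hd _ (R.self_mem_derivatives A), fun q hq => ?_⟩
    rw [e] at hq
    rcases hq with hq | ⟨S, hS, rfl⟩
    · exact hclosed hN q hq
    · exact hd S hS
  | nwcl R =>
    obtain ⟨N, e⟩ : ∃ N, N = ({top A, bot A} ∪ nwcl '' R.derivatives A) := ⟨_, rfl⟩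
    have hN : ({top A, bot A} : Set (RLTLp Ψ)) ⊆ N := e ▸ Set.subset_union_left
    have hm : ∀ S ∈ R.derivatives A, nwcl S ∈ N := fun S hS => e ▸ Or.inr ⟨S, hS, rfl⟩
    have hd : ∀ S ∈ R.derivatives A, DerivIn A N (nwcl S) := fun S hS =>
      derivIn_nwcl hN fun a => hm _ (ERE.rep_lder_mem_derivatives A hS a)
    refine ⟨N, e ▸ hfin.union ((R.finite_derivatives A).image _),
      modalSubs_nwcl_subset (hm _ (R.self_mem_derivatives A)),
      modalSubs_nwcl_subset (hm _ (R.rep_mem_derivatives A)),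
      hd _ (R.self_mem_derivatives A), fun q hq => ?_⟩
    rw [e] at hq
    rcases hq with hq | ⟨S, hS, rfl⟩
    · exact hclosed hN q hq
    · exact hd S hS
  | ocl R =>
    obtain ⟨N, e⟩ : ∃ N, N = insert (ocl R) (insert (next (ocl R))
      ({top A, bot A} ∪ (eimpl · (next (ocl R))) '' R.derivatives A)) := ⟨_, rfl⟩
    have ho : ocl R ∈ N := e ▸ Or.inl rfl
    have hn : next (ocl R) ∈ N := e ▸ Or.inr (Or.inl rfl)
    have hN : ({top A, bot A} : Set (RLTLp Ψ)) ⊆ N := by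
      rw [e]
      exact Set.subset_union_left.trans ((Set.subset_insert _ _).trans (Set.subset_insert _ _))
    have hso := modalSubs_ocl_subset ho
    have hsn := modalSubs_next_subset hn hso
    have hdn : DerivIn A N (next (ocl R)) := derivIn_next hso
    have hm : ∀ S ∈ R.derivatives A, eimpl S (next (ocl R)) ∈ N := fun S hS =>
      e ▸ Or.inr (Or.inr (Or.inr ⟨S, hS, rfl⟩))
    have hdo : DerivIn A N (ocl R) := derivIn_ocl hN ho hn fun a =>
      hm _ (ERE.rep_lder_mem_derivatives A (R.self_mem_derivatives A) a)
    refine ⟨N, e ▸ ((hfin.union ((R.finite_derivatives A).image _)).insert _).insert _,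
      hso, hso, hdo, fun q hq => ?_⟩
    rw [e] at hq
    rcases hq with rfl | rfl | hq | ⟨S, hS, rfl⟩
    · exact hdo
    · exact hdn
    · exact hclosed hN q hq
    · exact hdn.eimpl hN hsn fun a => hm _ (ERE.rep_lder_mem_derivatives A hS a)
  | _ φ ψ h₁ h₂ =>
    obtain ⟨N₁, h₁⟩ := h₁
    obtain ⟨N₂, h₂⟩ := h₂
    have s₁ : N₁ ⊆ insert (.until φ ψ) (N₁ ∪ N₂) :=
      Set.subset_union_left.trans (Set.subset_insert _ _)
    have s₂ : N₂ ⊆ insert (.until φ ψ) (N₁ ∪ N₂) :=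
      Set.subset_union_right.trans (Set.subset_insert _ _)
    have hs := modalSubs_until_subset (Set.mem_insert (.until φ ψ) (N₁ ∪ N₂)) (h₁.subs.trans s₁)
      (h₂.subs.trans s₂)
    have hd := (h₁.deriv.mono s₁).until (h₂.deriv.mono s₂) hs
    refine ⟨_, (h₁.finite.union h₂.finite).insert _, hs, hs, hd, ?_⟩
    rintro q (rfl | hq | hq)
    · exact hd
    · exact (h₁.closed q hq).mono s₁
    · exact (h₂.closed q hq).mono s₂

/-- `States` counts all leaves, `DerivIn` only those selected by a letter. Pruning makes these
agree, so that the states stay in the closed set. -/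
theorem exists_isDerivTF_finite_states [Nonempty D] (A : EBA D Ψ) (φ : RLTLp Ψ) :
    ∃ tf : RLTLp Ψ → TT Ψ (RLTLp Ψ), IsDerivTF A tf φ ∧ {q | States tf φ q}.Finite := by
  choose tf htf hleaves using fun q : RLTLp Ψ =>
    TT.exists_leaves_reachable A ((deriv A q).map (canon A))
  simp only [TT.leafOf_map] at htf hleaves
  obtain ⟨N, hN⟩ := exists_closedFor A φ
  refine ⟨tf, fun q _ a => ?_, (hN.finite.insert φ).subset ?_⟩
  · rw [htf]
    exact simp_canon A _
  · intro q hq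
    induction hq with
    | init => exact Or.inl rfl
    | step hq hl hp hp' ih =>
      obtain ⟨a, rfl⟩ := hleaves _ _ hl
      refine Or.inr ?_
      rcases ih with rfl | ih
      · exact hN.deriv a ⟨hp, hp'⟩
      · exact hN.closed _ ih a ⟨hp, hp'⟩

end RLTLp

/-! ### Tools for the nondeterministic automaton -/

namespace TT

variable {D : Type u} {Ψ : Type v} {S : Type w}

/-- Unlike `map`, this allows the new leaves to live in another universe. -/
theorem exists_leafOf_eq_comp {S' : Type*} (A : EBA D Ψ) (f : TT Ψ S) (h : S → S') :
    ∃ g : TT Ψ S', ∀ a, g.leafOf A a = h (f.leafOf A a) := by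
  induction f with
  | leaf s => exact ⟨.leaf (h s), fun _ => rfl⟩
  | ite α f₁ f₂ h₁ h₂ =>
    obtain ⟨g₁, h₁⟩ := h₁
    obtain ⟨g₂, h₂⟩ := h₂
    refine ⟨.ite α g₁ g₂, fun a => ?_⟩
    simp only [leafOf]
    split_ifs
    · exact h₁ a
    · exact h₂ a

theorem exists_leafOf_eq_tuple (A : EBA D Ψ) (n : ℕ) (f : Fin n → TT Ψ S) :
    ∃ g : TT Ψ (Fin n → S), ∀ a, g.leafOf A a = fun i => (f i).leafOf A a := by
  induction n with
  | zero => exact ⟨.leaf Fin.elim0, fun a => funext fun i => i.elim0⟩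
  | succ n ih =>
    obtain ⟨g, hg⟩ := ih fun i => f i.succ
    refine ⟨(f 0).map₂ (fun s t => Fin.cons s t) g, fun a => ?_⟩
    rw [leafOf_map₂, hg]
    funext i
    refine Fin.cases rfl (fun i => rfl) i

end TT

namespace BCp

variable {S : Type w}

/-- Without conjunction, the members of the DNF are singletons or empty, so runs can be chosen
linear. -/
theorem Sat.exists_of_noAnd {V : S → Prop} {f : BCp S} (hf : f.NoAnd) (h : f.Sat V) :
    ∅ ∈ f.dnf ∨ ∃ p, V p ∧ {p} ∈ f.dnf := by
  induction f with
  | atom s => exact Or.inr ⟨s, h, rfl⟩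
  | tt => exact Or.inl rfl
  | ff => exact h.elim
  | and f g => exact hf.elim
  | or f g h₁ h₂ =>
    rcases h with h | h
    · exact (h₁ hf.1 h).imp Or.inl fun ⟨p, hp, hp'⟩ => ⟨p, hp, Or.inl hp'⟩
    · exact (h₂ hf.2 h).imp Or.inr fun ⟨p, hp, hp'⟩ => ⟨p, hp, Or.inr hp'⟩

/-- The disjunction of the elements of a list. -/
def disj : List S → BCp S
  | [] => ff
  | s :: l => or (atom s) (disj l)

theorem noAnd_disj (l : List S) : (disj l).NoAnd := by
  induction l with
  | nil => trivial
  | cons s l ih => exact ⟨trivial, ih⟩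

theorem mem_dnf_disj (l : List S) (X : Set S) : X ∈ (disj l).dnf ↔ ∃ s ∈ l, X = {s} := by
  induction l with
  | nil => simp [disj, dnf]
  | cons s l ih => simp [disj, dnf, ih]

theorem sat_disj (l : List S) (V : S → Prop) : (disj l).Sat V ↔ ∃ s ∈ l, V s := by
  induction l with
  | nil => simp [disj, Sat]
  | cons s l ih => simp [disj, Sat, ih]

end BCp

namespace ABA

variable {D : Type u} {Ψ : Type v} {S : Type w}

/-! ### Linear runs -/

/-- The state `p'` is a possible successor on its own of the state `p` for the letter `a`. -/
def Edge (A : EBA D Ψ) (M : ABA Ψ S) (a : D) (p p' : S) : Prop :=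
  {p'} ∈ ((M.tf p).leafOf A a).dnf

/-- A run may end in the state `p` for the letter `a`. -/
def Final (A : EBA D Ψ) (M : ABA Ψ S) (a : D) (p : S) : Prop :=
  ∅ ∈ ((M.tf p).leafOf A a).dnf

variable {A : EBA D Ψ} {M : ABA Ψ S} {x : Stream' D}

theorem Edge.sat {a : D} {p p' : S} (h : M.Edge A a p p') {V : S → Prop} (hV : V p') :
    ((M.tf p).leafOf A a).Sat V :=
  BCp.sat_iff_exists_dnf.2 ⟨_, h, by rintro _ rfl; exact hV⟩

theorem Final.sat {a : D} {p : S} (h : M.Final A a p) (V : S → Prop) :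
    ((M.tf p).leafOf A a).Sat V :=
  BCp.sat_iff_exists_dnf.2 ⟨_, h, by rintro _ ⟨⟩⟩

theorem Edge.mem {a : D} {p p' : S} (h : M.Edge A a p p') (hp : p ∈ M.Q) : p' ∈ M.Q :=
  M.atoms_leafOf_subset A hp a (BCp.subset_atoms_of_mem_dnf _ h rfl)

/-- The rank at position `k` is the waiting time, counted from `k + 1`, until the path next visits
`F`. -/
theorem acceptsFrom_of_path {ρ : ℕ → S} (h₀ : ρ 0 ∈ M.Q)
    (hstep : ∀ k, M.Edge A (x.get k) (ρ k) (ρ (k + 1))) (hinf : ∀ m, ∃ n ≥ m, ρ n ∈ M.F) :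
    M.AcceptsFrom A x (ρ 0) := by
  have hd : ∀ k, ∃ n, ρ (k + 1 + n) ∈ M.F := by
    intro k
    obtain ⟨n, hn, hF⟩ := hinf (k + 1)
    exact ⟨n - (k + 1), by rwa [Nat.add_sub_cancel' hn]⟩
  let d : ℕ → ℕ := fun k => sInf {n | ρ (k + 1 + n) ∈ M.F}
  refine acceptsFrom_of_ranked A M (G := fun k p => p = ρ k) (r := fun k _ => d k) ?_ h₀ rfl
  rintro k _ rfl
  refine (hstep k).sat ⟨rfl, ?_⟩
  by_cases hF : ρ (k + 1) ∈ M.F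
  · exact Or.inl hF
  · right
    rw [Nat.cast_lt]
    have hk : ρ (k + 1 + d k) ∈ M.F := Nat.sInf_mem (hd k)
    cases hdk : d k with
    | zero =>
      rw [hdk] at hk
      exact (hF hk).elim
    | succ n =>
      rw [hdk, show k + 1 + (n + 1) = k + 1 + 1 + n by omega] at hk
      exact Nat.lt_succ_of_le (Nat.sInf_le hk)

/-- Follow rank-respecting successors until the run may end. If it never may, avoiding `F` from some
point on would give an infinite descent of ranks. -/
theorem exists_path_of_acceptsFrom (hM : M.IsNBA) {q : S} (hq : q ∈ M.Q)
    (h : M.AcceptsFrom A x q) :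
    ∃ ρ : ℕ → S, ρ 0 = q ∧
      (((∀ k, M.Edge A (x.get k) (ρ k) (ρ (k + 1))) ∧ ∀ m, ∃ n ≥ m, ρ n ∈ M.F) ∨
        ∃ n, (∀ k < n, M.Edge A (x.get k) (ρ k) (ρ (k + 1))) ∧ M.Final A (x.get n) (ρ n)) := by
  classical
  obtain ⟨G, r, hr, hG, hQ⟩ := ranked_of_acceptsFrom A M hq h
  have hnext : ∀ k p, ∃ p', G k p → ¬ M.Final A (x.get k) p →
      M.Edge A (x.get k) p p' ∧ G (k + 1) p' ∧ (p' ∈ M.F ∨ r (k + 1) p' < r k p) := by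
    intro k p
    by_cases hp : G k p ∧ ¬ M.Final A (x.get k) p
    · have hno := hM.2 p (hQ k p hp.1) _ (TT.leafOf_mem_leaves A (x.get k) _)
      obtain ⟨p', hV, he⟩ := ((hr k p hp.1).exists_of_noAnd hno).resolve_left hp.2
      exact ⟨p', fun _ _ => ⟨he, hV⟩⟩
    · exact ⟨p, fun h₁ h₂ => (hp ⟨h₁, h₂⟩).elim⟩
  choose nx hnx using hnext
  let ρ : ℕ → S := fun k => Nat.rec q (fun k p => nx k p) k
  have hρ : ∀ k, ρ (k + 1) = nx k (ρ k) := fun _ => rfl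
  have hGρ : ∀ n, (∀ k < n, ¬ M.Final A (x.get k) (ρ k)) → G n (ρ n) := by
    intro n hn
    induction n with
    | zero => exact hG
    | succ n ih =>
      rw [hρ]
      exact (hnx n _ (ih fun k hk => hn k (by omega)) (hn n (by omega))).2.1
  refine ⟨ρ, rfl, ?_⟩
  by_cases hex : ∃ n, M.Final A (x.get n) (ρ n)
  · right
    refine ⟨Nat.find hex, fun k hk => ?_, Nat.find_spec hex⟩
    exact (hnx k _ (hGρ k fun j hj => Nat.find_min hex (hj.trans hk)) (Nat.find_min hex hk)).1
  · left
    push Not at hex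
    have hk := fun k => hnx k _ (hGρ k fun j _ => hex j) (hex k)
    refine ⟨fun k => (hk k).1, fun m => ?_⟩
    by_contra hcon
    push Not at hcon
    exact not_forall_ge_lt (fun n => r n (ρ n)) m fun n hn =>
      (hk n).2.2.resolve_left (hcon (n + 1) (by omega))

/-! ### Elimination of alternation -/

/-- A step of the breakpoint construction from the macrostate `(X, O)` to `(X', O')`. -/
def BreakpointStep (A : EBA D Ψ) (M : ABA Ψ S) (a : D) (X O X' O' : Set S) : Prop :=
  (∀ p ∈ X, ((M.tf p).leafOf A a).Sat (· ∈ X')) ∧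
  (O.Nonempty → ∀ p ∈ O, ((M.tf p).leafOf A a).Sat (fun p' => p' ∈ X' ∧ (p' ∈ M.F ∨ p' ∈ O'))) ∧
  (O = ∅ → ∀ p' ∈ X', p' ∈ M.F ∨ p' ∈ O')

/-- `O` holds the states that still owe a visit to `F`, and `d k` is the time until `O` is next
empty. -/
theorem ranked_of_breakpoints {X O : ℕ → Set S}
    (hstep : ∀ k, M.BreakpointStep A (x.get k) (X k) (O k) (X (k + 1)) (O (k + 1)))
    (hinf : ∀ m, ∃ n ≥ m, O n = ∅) :
    ∃ r, M.Ranked A x (fun k p => p ∈ X k) r := by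
  classical
  have hd : ∀ k, ∃ n, O (k + n) = ∅ := by
    intro k
    obtain ⟨n, hn, hO⟩ := hinf k
    exact ⟨n - k, by rwa [Nat.add_sub_cancel' hn]⟩
  let d : ℕ → ℕ := fun k => sInf {n | O (k + n) = ∅}
  have hdlt : ∀ k, (O k).Nonempty → d (k + 1) < d k := by
    intro k hk
    have hmem : O (k + d k) = ∅ := Nat.sInf_mem (hd k)
    cases hdk : d k with
    | zero =>
      rw [hdk] at hmem
      exact (hk.ne_empty hmem).elim
    | succ n =>
      rw [hdk, show k + (n + 1) = k + 1 + n by omega] at hmem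
      exact Nat.lt_succ_of_le (Nat.sInf_le hmem)
  refine ⟨fun k p => if p ∈ O k then (d k : Ordinal) else Ordinal.omega0 + d k, ?_⟩
  intro k p hp
  obtain ⟨h₁, h₂, h₃⟩ := hstep k
  by_cases hpO : p ∈ O k
  · have hlt := hdlt k ⟨p, hpO⟩
    refine (h₂ ⟨p, hpO⟩ p hpO).mono fun p' _ h => ⟨h.1, h.2.imp id fun h' => ?_⟩
    simpa [hpO, h'] using hlt
  · refine (h₁ p hp).mono fun p' _ h => ⟨h, ?_⟩
    by_cases hp' : p' ∈ O (k + 1)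
    · right
      simp only [hp', hpO, if_true, if_false]
      exact (Ordinal.natCast_lt_omega0 _).trans_le le_self_add
    · rcases (O k).eq_empty_or_nonempty with hO | hO
      · exact Or.inl ((h₃ hO p' h).resolve_right hp')
      · right
        simpa [hp', hpO] using hdlt k hO

/-- While `O` is nonempty, each new member has smaller rank than some old one. As `O` is finite, its
maximal rank drops at every step, so `O` becomes empty again and again. -/
theorem exists_breakpoints_of_ranked {G : ℕ → S → Prop} {r : ℕ → S → Ordinal.{0}}
    (hr : M.Ranked A x G r) (hQ : ∀ k p, G k p → p ∈ M.Q) :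
    ∃ O : ℕ → Set S, O 0 = ∅ ∧ (∀ k, O k ⊆ M.Q) ∧
      (∀ k, M.BreakpointStep A (x.get k) {p | G k p} (O k) {p | G (k + 1) p} (O (k + 1))) ∧
      ∀ m, ∃ n ≥ m, O n = ∅ := by
  classical
  let O : ℕ → Set S := fun k => Nat.rec ∅ (fun k (O : Set S) =>
    {p' | G (k + 1) p' ∧ p' ∉ M.F ∧ (O = ∅ ∨ ∃ p ∈ O, r (k + 1) p' < r k p)}) k
  have hO : ∀ k, O (k + 1) =
      {p' | G (k + 1) p' ∧ p' ∉ M.F ∧ (O k = ∅ ∨ ∃ p ∈ O k, r (k + 1) p' < r k p)} :=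
    fun _ => rfl
  have hOG : ∀ k, ∀ p ∈ O k, G k p := by
    intro k p hp
    cases k with
    | zero => exact hp.elim
    | succ k => exact ((hO k).subset hp).1
  have hOQ : ∀ k, O k ⊆ M.Q := fun k p hp => hQ k p (hOG k p hp)
  have hmax : ∀ k, (O k).Nonempty → ∃ p ∈ O k, ∀ p' ∈ O (k + 1), r (k + 1) p' < r k p := by
    intro k hk
    obtain ⟨p, hp, hmax⟩ := Set.exists_max_image (O k) (r k) (M.finite_Q.subset (hOQ k)) hk
    refine ⟨p, hp, fun p' hp' => ?_⟩
    obtain ⟨-, -, h⟩ := (hO k).subset hp'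
    obtain ⟨p₀, hp₀, hlt⟩ := h.resolve_left hk.ne_empty
    exact hlt.trans_le (hmax p₀ hp₀)
  have hempty : ∀ (α : Ordinal.{0}) k, (∀ p ∈ O k, r k p < α) → ∃ n ≥ k, O n = ∅ := by
    intro α
    induction α using WellFoundedLT.induction with
    | ind α ih =>
      intro k hk
      rcases (O k).eq_empty_or_nonempty with h | h
      · exact ⟨k, le_rfl, h⟩
      · obtain ⟨p, hp, hp'⟩ := hmax k h
        obtain ⟨n, hn, hn'⟩ := ih _ (hk p hp) (k + 1) hp'
        exact ⟨n, by omega, hn'⟩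
  refine ⟨O, rfl, hOQ, fun k => ⟨fun p hp => (hr k p hp).mono fun _ _ h => h.1,
    fun hne p hp => (hr k p (hOG k p hp)).mono fun p' _ h => ⟨h.1, ?_⟩, fun he p' hp' => ?_⟩,
    fun m => ?_⟩
  · refine or_iff_not_imp_left.2 fun hF => ?_
    exact (hO k).superset ⟨h.1, hF, Or.inr ⟨p, hp, h.2.resolve_left hF⟩⟩
  · refine or_iff_not_imp_left.2 fun hF => ?_
    exact (hO k).superset ⟨hp', hF, Or.inl he⟩
  · rcases (O m).eq_empty_or_nonempty with h | h
    · exact ⟨m, le_rfl, h⟩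
    · obtain ⟨p, -, hp⟩ := hmax m h
      obtain ⟨n, hn, hn'⟩ := hempty _ (m + 1) hp
      exact ⟨n, by omega, hn'⟩

/-- There is a common witness of acceptance for all accepting states. -/
theorem exists_ranked (A : EBA D Ψ) (M : ABA Ψ S) (x : Stream' D) :
    ∃ G r, M.Ranked A x G r ∧ (∀ k p, G k p → p ∈ M.Q) ∧
      ∀ q ∈ M.Q, M.AcceptsFrom A x q → G 0 q := by
  have h : ∀ q : {q // q ∈ M.Q ∧ M.AcceptsFrom A x q}, ∃ G r, M.Ranked A x G r ∧ G 0 (q : S) ∧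
      ∀ k p, G k p → p ∈ M.Q := fun q => ranked_of_acceptsFrom A M q.2.1 q.2.2
  choose G r hr hG hQ using h
  let R : ℕ → S → Set Ordinal.{0} := fun k p => {α | ∃ q, G q k p ∧ α = r q k p}
  refine ⟨fun k p => ∃ q, G q k p, fun k p => sInf (R k p), ?_, fun k p ⟨q, hq⟩ => hQ q k p hq,
    fun q hq h => ⟨⟨q, hq, h⟩, hG ⟨q, hq, h⟩⟩⟩
  rintro k p ⟨q₀, hq₀⟩
  obtain ⟨q, hq, e⟩ : sInf (R k p) ∈ R k p := csInf_mem ⟨_, q₀, hq₀, rfl⟩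
  refine BCp.Sat.mono (hr q k p hq) fun p' _ h => ⟨⟨q, h.1⟩, h.2.imp id fun h' => ?_⟩
  have hle : sInf (R (k + 1) p') ≤ r q (k + 1) p' := csInf_le' ⟨q, h.1, rfl⟩
  exact (hle.trans_lt h').trans_eq e.symm

/-- The macrostates are pairs `(X, O)` of sets of states, guessed nondeterministically along
`BreakpointStep`, and accepting when `O` is empty. -/
theorem omegaRegular_lang [Nonempty D] (A : EBA D Ψ) (M : ABA Ψ S) : OmegaRegular A (M.lang A) := by
  classical
  obtain ⟨n, dec, -, hdec⟩ := M.finite_Q.fin_param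
  -- States are coded by `Fin n` because `OmegaRegular` asks for a state type in `Type`.
  let T := Set (Fin n) × Set (Fin n)
  have fin : ∀ s : Set T, s.Finite := fun s => s.toFinite
  let disjOf : Set T → BCp T := fun s => .disj (fin s).toFinset.toList
  have mem_disjOf : ∀ s t, t ∈ (fin s).toFinset.toList ↔ t ∈ s := by simp
  let Tr : D → T → T → Prop := fun a t t' =>
    M.BreakpointStep A a (dec '' t.1) (dec '' t.2) (dec '' t'.1) (dec '' t'.2)
  have htf : ∀ t : T, ∃ f : TT Ψ (BCp T), (∀ a, f.leafOf A a = disjOf {t' | Tr a t t'}) ∧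
      ∀ l ∈ f.leaves, ∃ a, l = disjOf {t' | Tr a t t'} := by
    intro t
    obtain ⟨g, hg⟩ := TT.exists_leafOf_eq_tuple A n fun i => M.tf (dec i)
    -- Whether a step is possible depends on the letter only through the tuple `c` of leaves it
    -- selects in the transitions of all states.
    obtain ⟨f, hf⟩ := TT.exists_leafOf_eq_comp A g fun c => disjOf {t' |
      (∀ i ∈ t.1, (c i).Sat (· ∈ dec '' t'.1)) ∧
      (t.2.Nonempty → ∀ i ∈ t.2, (c i).Sat
        (fun p' => p' ∈ dec '' t'.1 ∧ (p' ∈ M.F ∨ p' ∈ dec '' t'.2))) ∧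
      (t.2 = ∅ → ∀ p' ∈ dec '' t'.1, p' ∈ M.F ∨ p' ∈ dec '' t'.2)}
    obtain ⟨f', hf', hl⟩ := TT.exists_leaves_reachable A f
    have e : ∀ a, f.leafOf A a = disjOf {t' | Tr a t t'} := by
      intro a
      rw [hf, hg]
      congr 1
      ext t'
      simp only [Tr, BreakpointStep, Set.mem_ofPred_eq, Set.forall_mem_image,
        Set.image_nonempty, Set.image_eq_empty]
    exact ⟨f', fun a => (hf' a).trans (e a), fun l h => (hl l h).imp fun a h => h.trans (e a)⟩
  choose tf htf hleaves using htf
  let N : ABA Ψ T :=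
    { Q := Set.univ
      finite_Q := Set.finite_univ
      init := disjOf {t | M.init.Sat (· ∈ dec '' t.1) ∧ t.2 = ∅}
      init_mem := Set.subset_univ _
      tf := tf
      tf_mem := fun _ _ _ _ => Set.subset_univ _
      F := {t | t.2 = ∅}
      F_subset := Set.subset_univ _ }
  have hN : N.IsNBA := by
    refine ⟨BCp.noAnd_disj _, fun t _ l hl => ?_⟩
    obtain ⟨a, rfl⟩ := hleaves t l hl
    exact BCp.noAnd_disj _
  have hedge : ∀ a t t', N.Edge A a t t' ↔ Tr a t t' := by
    intro a t t'
    change _ ∈ ((tf t).leafOf A a).dnf ↔ _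
    rw [htf, BCp.mem_dnf_disj]
    simp only [mem_disjOf]
    constructor
    · rintro ⟨s, hs, e⟩
      rwa [Set.singleton_eq_singleton_iff.1 e]
    · exact fun h => ⟨t', h, rfl⟩
  have hfinal : ∀ a t, ¬ N.Final A a t := by
    intro a t h
    change _ ∈ ((tf t).leafOf A a).dnf at h
    rw [htf, BCp.mem_dnf_disj] at h
    obtain ⟨s, -, e⟩ := h
    exact Set.singleton_ne_empty s e.symm
  have himage : ∀ X ⊆ M.Q, dec '' (dec ⁻¹' X) = X := fun X hX =>
    Set.image_preimage_eq_of_subset (hdec ▸ hX)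
  refine ⟨T, N, hN, Set.ext fun x => ?_⟩
  change _ ↔ (BCp.disj _).Sat _
  rw [BCp.sat_disj]
  simp only [mem_disjOf]
  constructor
  · intro h
    obtain ⟨G, r, hr, hQ, hacc⟩ := exists_ranked A M x
    obtain ⟨O, hO₀, hOQ, hstep, hinf⟩ := exists_breakpoints_of_ranked hr hQ
    let ρ : ℕ → T := fun k => (dec ⁻¹' {p | G k p}, dec ⁻¹' O k)
    have hρ₁ : ∀ k, dec '' (ρ k).1 = {p | G k p} := fun k => himage _ (hQ k)
    have hρ₂ : ∀ k, dec '' (ρ k).2 = O k := fun k => himage _ (hOQ k)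
    refine ⟨ρ 0, ⟨?_, ?_⟩, acceptsFrom_of_path (M := N) trivial (fun k => ?_) fun m => ?_⟩
    · rw [hρ₁]
      exact BCp.Sat.mono h fun p hp h => hacc p (M.init_mem hp) h
    · simp [ρ, hO₀]
    · rw [hedge]
      simp only [Tr, hρ₁, hρ₂]
      exact hstep k
    · refine (hinf m).imp fun n hn => ⟨hn.1, ?_⟩
      change dec ⁻¹' O n = ∅
      rw [hn.2, Set.preimage_empty]
  · rintro ⟨t, ⟨ht, ht'⟩, h⟩
    obtain ⟨ρ, rfl, ⟨hρ, hinf⟩ | ⟨n, -, hn⟩⟩ := exists_path_of_acceptsFrom hN trivial h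
    · obtain ⟨r, hr⟩ := ranked_of_breakpoints (A := A) (M := M) (x := x)
        (X := fun k => dec '' (ρ k).1) (O := fun k => dec '' (ρ k).2)
        (fun k => (hedge _ _ _).1 (hρ k)) (fun m => (hinf m).imp fun n hn => ⟨hn.1, by
          rw [show (ρ n).2 = ∅ from hn.2, Set.image_empty]⟩)
      refine ht.mono fun p _ hp => acceptsFrom_of_ranked A M hr ?_ hp
      exact hdec ▸ Set.image_subset_range _ _ hp
    · exact (hfinal _ _ hn).elim

end ABA

/-! ### Kleene's construction for paths -/

theorem TT.exists_pred {D : Type u} {Ψ : Type v} {S : Type w} (A : EBA D Ψ) (f : TT Ψ S)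
    (P : S → Prop) : ∃ α : Ψ, ∀ a, a ∈ A.den α ↔ P (f.leafOf A a) := by
  induction f with
  | leaf s =>
    by_cases h : P s
    · exact ⟨A.top, fun a => by simp [A.den_top, TT.leafOf, h]⟩
    · exact ⟨A.bot, fun a => by simp [A.den_bot, TT.leafOf, h]⟩
  | ite α f g hf hg =>
    obtain ⟨β, hβ⟩ := hf
    obtain ⟨γ, hγ⟩ := hg
    refine ⟨A.or (A.and α β) (A.and (A.not α) γ), fun a => ?_⟩
    by_cases h : a ∈ A.den α <;>
      simp [A.den_or, A.den_and, A.den_not, TT.leafOf, h, hβ, hγ]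

namespace ABA

variable {D : Type u} {Ψ : Type v} {S : Type w} {A : EBA D Ψ} {M : ABA Ψ S}

/-- `PathIn A M K p w q`: the nonempty word `w` labels a path of edges from `p` to `q` with all
intermediate states in `K`. -/
inductive PathIn (A : EBA D Ψ) (M : ABA Ψ S) (K : Set S) : S → List D → S → Prop
  | single {a p q} : M.Edge A a p q → PathIn A M K p [a] q
  | cons {a p r w q} : M.Edge A a p r → r ∈ K → PathIn A M K r w q → PathIn A M K p (a :: w) q

theorem PathIn.ne_nil {K : Set S} {p q : S} {w : List D} (h : PathIn A M K p w q) : w ≠ [] := by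
  cases h <;> exact List.cons_ne_nil _ _

theorem pathIn_cons_iff {K : Set S} {p q : S} {a : D} {w : List D} :
    PathIn A M K p (a :: w) q ↔
      (w = [] ∧ M.Edge A a p q) ∨ ∃ r ∈ K, M.Edge A a p r ∧ PathIn A M K r w q := by
  constructor
  · intro h
    cases h with
    | single h => exact Or.inl ⟨rfl, h⟩
    | cons h hr h' => exact Or.inr ⟨_, hr, h, h'⟩
  · rintro (⟨rfl, h⟩ | ⟨r, hr, h, h'⟩)
    · exact .single h
    · exact .cons h hr h'

theorem PathIn.mono {K K' : Set S} (hK : K ⊆ K') {p q : S} {w : List D}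
    (h : PathIn A M K p w q) : PathIn A M K' p w q := by
  induction h with
  | single h => exact .single h
  | cons h hr _ ih => exact .cons h (hK hr) ih

theorem PathIn.trans {K : Set S} {p q r : S} {u v : List D} (h : PathIn A M K p u r) (hr : r ∈ K)
    (h' : PathIn A M K r v q) : PathIn A M K p (u ++ v) q := by
  induction h with
  | single h => exact .cons h hr h'
  | cons h hs _ ih => exact .cons h hs (ih hr h')

theorem exists_ere_pathIn_empty (A : EBA D Ψ) (M : ABA Ψ S) (p q : S) :
    ∃ R : ERE Ψ, ∀ w, w ∈ R.lang A ↔ PathIn A M ∅ p w q := by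
  obtain ⟨α, hα⟩ := TT.exists_pred A (M.tf p) fun f => {q} ∈ f.dnf
  refine ⟨.pred α, fun w => ⟨?_, fun h => ?_⟩⟩
  · rintro ⟨a, ha, rfl⟩
    exact .single ((hα a).1 ha)
  · cases h with
    | single h => exact ⟨_, (hα _).2 h, rfl⟩
    | cons _ hr _ => exact hr.elim

/-- Cut a path at its intermediate visits to `r`: between the first and the last visit it is a
sequence of loops at `r` that stay in `K`. -/
theorem pathIn_insert_iff {K : Set S} {p q r : S} {P : S → S → Language D}
    (hP : ∀ p q w, w ∈ P p q ↔ PathIn A M K p w q) (w : List D) :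
    PathIn A M (insert r K) p w q ↔ w ∈ P p q + P p r * (KStar.kstar (P r r) * P r q) := by
  have hmono : ∀ {p q w}, w ∈ P p q → PathIn A M (insert r K) p w q := fun h =>
    ((hP _ _ _).1 h).mono (Set.subset_insert r K)
  constructor
  · intro h
    induction h with
    | single h => exact Or.inl ((hP _ _ _).2 (.single h))
    | @cons a p s w q h hs _ ih =>
      rcases hs with rfl | hs
      · refine Or.inr ?_
        rw [← List.singleton_append]
        refine Language.append_mem_mul ((hP _ _ _).2 (.single h)) ?_
        rcases ih with ih | ih
        · exact Language.mem_mul.2 ⟨[], Language.nil_mem_kstar _, w, ih, rfl⟩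
        · change w ∈ _ at ih
          rw [← mul_assoc] at ih
          have hle : P s s * KStar.kstar (P s s) ≤ KStar.kstar (P s s) := mul_kstar_le_kstar
          obtain ⟨u, hu, v, hv, rfl⟩ := Language.mem_mul.1 ih
          exact Language.append_mem_mul (hle hu) hv
      · rcases ih with ih | ih
        · exact Or.inl ((hP _ _ _).2 (.cons h hs ((hP _ _ _).1 ih)))
        · refine Or.inr ?_
          obtain ⟨u, hu, v, hv, rfl⟩ := Language.mem_mul.1 ih
          exact Language.mem_mul.2 ⟨a :: u, (hP _ _ _).2 (.cons h hs ((hP _ _ _).1 hu)), v, hv, rfl⟩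
  · rintro (h | h)
    · exact hmono h
    · obtain ⟨u, hu, v, hv, rfl⟩ := Language.mem_mul.1 h
      obtain ⟨s, ⟨l, rfl, hl⟩, t, ht, rfl⟩ := Language.mem_mul.1 hv
      refine (hmono hu).trans (Set.mem_insert r K) ?_
      clear hv h
      induction l with
      | nil => exact hmono ht
      | cons z l ih =>
        rw [List.flatten_cons, List.append_assoc]
        exact (hmono (hl z (by simp))).trans (Set.mem_insert r K)
          (ih fun y hy => hl y (by simp [hy]))

/-- The words that label paths between two states are described by regular expressions. -/
theorem exists_ere_pathIn (A : EBA D Ψ) (M : ABA Ψ S) {K : Set S} (hK : K.Finite) :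
    ∀ p q, ∃ R : ERE Ψ, ∀ w, w ∈ R.lang A ↔ PathIn A M K p w q := by
  induction K, hK using Set.Finite.induction_on with
  | empty => exact exists_ere_pathIn_empty A M
  | @insert r K _ _ ih =>
    choose R hR using ih
    intro p q
    refine ⟨.union (R p q) (.conc (R p r) (.conc (.star (R r r)) (R r q))), fun w => ?_⟩
    rw [pathIn_insert_iff (P := fun p q => (R p q).lang A) hR]
    rfl

theorem pathIn_of_edges {x : Stream' D} {ρ : ℕ → S} {k n : ℕ} (hk : ρ k ∈ M.Q)
    (h : ∀ i ≤ n, M.Edge A (x.get (k + i)) (ρ (k + i)) (ρ (k + i + 1))) :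
    PathIn A M M.Q (ρ k) ((x.drop k).take (n + 1)) (ρ (k + n + 1)) := by
  induction n generalizing k with
  | zero =>
    rw [Stream'.take_succ, Stream'.take_zero, Stream'.head_drop]
    exact .single (h 0 le_rfl)
  | succ n ih =>
    rw [Stream'.take_succ, Stream'.head_drop, Stream'.tail_drop']
    have h₀ := h 0 (by omega)
    refine .cons h₀ (h₀.mem hk) ?_
    have := ih (k := k + 1) (h₀.mem hk) fun i hi => by
      have := h (i + 1) (by omega)
      rwa [show k + (i + 1) = k + 1 + i by omega] at this
    rwa [show k + (n + 1) + 1 = k + 1 + n + 1 by omega]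

/-- The words that are accepted from `p`, described by paths. -/
def AcceptsByPaths (A : EBA D Ψ) (M : ABA Ψ S) (x : Stream' D) (p : S) : Prop :=
  M.Final A (x.get 0) p ∨ ∃ n, ∃ s ∈ M.Q, PathIn A M M.Q p (x.take (n + 1)) s ∧
    ((s ∈ M.F ∧ x.drop (n + 1) ∈ omegaPow {w | PathIn A M M.Q s w s}) ∨
      M.Final A (x.get (n + 1)) s)

theorem acceptsByPaths_of_acceptsFrom (hM : M.IsNBA) {x : Stream' D} {p : S} (hp : p ∈ M.Q)
    (h : M.AcceptsFrom A x p) : AcceptsByPaths A M x p := by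
  obtain ⟨ρ, rfl, ⟨hstep, hinf⟩ | ⟨n, hstep, hn⟩⟩ := exists_path_of_acceptsFrom hM hp h
  · have hQ : ∀ k, ρ k ∈ M.Q := by
      intro k
      induction k with
      | zero => exact hp
      | succ k ih => exact (hstep k).mem ih
    -- Pigeonhole: if each of the finitely many accepting states were eventually avoided, `F` would
    -- be too.
    have hf : ∃ f ∈ M.F, ∃ᶠ n in Filter.atTop, ρ n = f := by
      by_contra hcon
      push Not at hcon
      have h₁ := (Filter.eventually_all_finite (M.finite_Q.subset M.F_subset)).2 hcon
      obtain ⟨m, hm⟩ := Filter.eventually_atTop.1 h₁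
      obtain ⟨n, hn, hF⟩ := hinf m
      exact hm n hn _ hF rfl
    obtain ⟨f, hF, hf⟩ := hf
    rw [Filter.frequently_atTop] at hf
    have hnext : ∀ k, ∃ n, ρ (k + n + 1) = f := by
      intro k
      obtain ⟨m, hm, hm'⟩ := hf (k + 1)
      refine ⟨m - (k + 1), ?_⟩
      rwa [show k + (m - (k + 1)) + 1 = m by omega]
    obtain ⟨n, hn⟩ := hnext 0
    rw [Nat.zero_add] at hn
    refine Or.inr ⟨n, f, M.F_subset hF, ?_, Or.inl ⟨hF, ?_⟩⟩
    · have := pathIn_of_edges (n := n) (hQ 0) fun i _ => hstep (0 + i)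
      rwa [Nat.zero_add, hn] at this
    · refine RLTLp.mem_omegaPow_of_forall (P := fun y => ∃ k, y = x.drop k ∧ ρ k = f) ?_
        ⟨_, rfl, hn⟩
      rintro _ ⟨k, rfl, hk⟩
      obtain ⟨m, hm⟩ := hnext k
      refine ⟨m, ?_, k + m + 1, Stream'.drop_drop _ _ _, hm⟩
      have := pathIn_of_edges (n := m) (hQ k) fun i _ => hstep (k + i)
      rwa [hm, hk] at this
  · cases n with
    | zero => exact Or.inl hn
    | succ n =>
      have hQ : ∀ k ≤ n + 1, ρ k ∈ M.Q := by
        intro k hk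
        induction k with
        | zero => exact hp
        | succ k ih => exact (hstep k (by omega)).mem (ih (by omega))
      refine Or.inr ⟨n, _, hQ _ le_rfl, ?_, Or.inr hn⟩
      have := pathIn_of_edges (n := n) (hQ 0 (by omega)) fun i hi => hstep (0 + i) (by omega)
      rwa [Nat.zero_add] at this

/-- Rank a state by the length of the shortest remaining path to its target. At a target in `F`, the
next loop provides a new path, and the rank may rise there. -/
theorem acceptsFrom_of_acceptsByPaths {x : Stream' D} {p : S} (hp : p ∈ M.Q)
    (h : AcceptsByPaths A M x p) : M.AcceptsFrom A x p := by
  classical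
  let Good : ℕ → ℕ → S → Prop := fun n k p =>
    ∃ s ∈ M.Q, PathIn A M M.Q p ((x.drop k).take (n + 1)) s ∧
      ((s ∈ M.F ∧ x.drop (k + n + 1) ∈ omegaPow {w | PathIn A M M.Q s w s}) ∨
        M.Final A (x.get (k + n + 1)) s)
  let d : ℕ → S → ℕ := fun k p => sInf {n | Good n k p}
  refine acceptsFrom_of_ranked A M
    (G := fun k p => M.Final A (x.get k) p ∨ ∃ n, Good n k p)
    -- The `+ 1` makes the last step to a state where the run may end a decrease, from `1` to `0`.
    (r := fun k p => ((if M.Final A (x.get k) p then 0 else d k p + 1 : ℕ) : Ordinal)) ?_ hp ?_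
  · intro k p hG
    by_cases hfin : M.Final A (x.get k) p
    · exact hfin.sat _
    · obtain ⟨s, hs, hpath, hacc⟩ : Good (d k p) k p := Nat.sInf_mem (hG.resolve_left hfin)
      rw [Stream'.take_succ, Stream'.head_drop, Stream'.tail_drop', pathIn_cons_iff] at hpath
      simp only [if_neg hfin, Nat.cast_lt]
      rcases hpath with ⟨hnil, he⟩ | ⟨t, ht, he, hpath⟩
      · have hd : d k p = 0 := by
          have := congrArg List.length hnil
          simpa using this
        rw [hd, Nat.add_zero] at hacc
        refine he.sat ?_
        rcases hacc with ⟨hF, hω⟩ | hfin'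
        · refine ⟨Or.inr ?_, Or.inl hF⟩
          obtain ⟨j, hj, hj'⟩ := (RLTLp.mem_omegaPow_iff _ _).1 hω
          rw [Stream'.drop_drop] at hj'
          exact ⟨j, s, hs, hj, Or.inl ⟨hF, hj'⟩⟩
        · exact ⟨Or.inl hfin', Or.inr (by simp [hfin'])⟩
      · obtain ⟨n, hn⟩ : ∃ n, d k p = n + 1 := by
          refine Nat.exists_eq_succ_of_ne_zero fun h0 => hpath.ne_nil ?_
          rw [h0, Stream'.take_zero]
        rw [hn, show k + (n + 1) + 1 = k + 1 + n + 1 by omega] at hacc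
        rw [hn] at hpath ⊢
        have hgood : Good n (k + 1) t := ⟨s, hs, hpath, hacc⟩
        refine he.sat ⟨Or.inr ⟨n, hgood⟩, Or.inr ?_⟩
        have hle : d (k + 1) t ≤ n := Nat.sInf_le hgood
        split_ifs <;> omega
  · refine h.imp id fun ⟨n, s, hs, hpath, hacc⟩ => ⟨n, s, hs, hpath, ?_⟩
    rwa [Nat.zero_add]

end ABA

/-! ### Formulas for nondeterministic automata -/

namespace RLTLp

variable {D : Type u} {Ψ : Type v} {S : Type w}

theorem exists_models_iff_exists_mem (A : EBA D Ψ) {K : Set S} (hK : K.Finite) (f : S → RLTLp Ψ) :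
    ∃ φ : RLTLp Ψ, ∀ x, Models A φ x ↔ ∃ s ∈ K, Models A (f s) x := by
  induction K, hK using Set.Finite.induction_on with
  | empty => exact ⟨bot A, fun x => by simp [not_models_bot]⟩
  | @insert s K _ _ ih =>
    obtain ⟨φ, hφ⟩ := ih
    exact ⟨or (f s) φ, fun x => by simp [Models, hφ]⟩

theorem exists_models_iff_acceptsByPaths (A : EBA D Ψ) (M : ABA Ψ S) (p : S) :
    ∃ φ : RLTLp Ψ, ∀ x, Models A φ x ↔ M.AcceptsByPaths A x p := by
  choose R hR using ABA.exists_ere_pathIn A M M.finite_Q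
  choose β hβ using fun s => TT.exists_pred A (M.tf s) fun f => ∅ ∈ f.dnf
  -- A path to `s ∈ F`, then loops at `s` forever. Since `◇→` shares the last letter of the match,
  -- `X` moves past it before the loops start.
  obtain ⟨φ₁, h₁⟩ := exists_models_iff_exists_mem A (M.finite_Q.subset M.F_subset)
    fun s => eimpl (R p s) (next (ocl (R s s)))
  -- A path to `s` followed by a letter on which the run may end, with nothing required afterwards.
  obtain ⟨φ₂, h₂⟩ := exists_models_iff_exists_mem A M.finite_Q
    fun s => eimpl (.conc (R p s) (.pred (β s))) (top A)
  have hω : ∀ s, {y | y ∈ (R s s).lang A ∧ y ≠ []} = {w | M.PathIn A M.Q s w s} := by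
    intro s
    ext w
    simp only [Set.mem_ofPred_eq, hR]
    exact ⟨And.left, fun h => ⟨h, h.ne_nil⟩⟩
  have hconc : ∀ s (x : Stream' D) n, x.take (n + 1) ∈ (ERE.conc (R p s) (.pred (β s))).lang A ↔
      M.PathIn A M.Q p (x.take n) s ∧ M.Final A (x.get n) s := by
    intro s x n
    rw [Stream'.take_succ', ERE.lang, Language.mem_mul]
    constructor
    · rintro ⟨u, hu, _, ⟨a, ha, rfl⟩, e⟩
      obtain ⟨rfl, e'⟩ := List.append_inj' e rfl
      obtain rfl : a = x.get n := (List.cons.inj e').1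
      exact ⟨(hR _ _ _).1 hu, (hβ s _).1 ha⟩
    · rintro ⟨hu, ha⟩
      exact ⟨_, (hR _ _ _).2 hu, _, ⟨_, (hβ s _).2 ha, rfl⟩, rfl⟩
  refine ⟨or (pred (β p)) (or φ₁ φ₂), fun x => ?_⟩
  change _ ∨ (Models A φ₁ x ∨ Models A φ₂ x) ↔ _
  refine or_congr (hβ p _) ?_
  rw [h₁, h₂]
  simp only [models_eimpl, hR, hconc]
  constructor
  · rintro (⟨s, hs, n, hn, hn'⟩ | ⟨s, hs, n, ⟨hn, hn'⟩, -⟩)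
    · refine ⟨n, s, M.F_subset hs, hn, Or.inl ⟨hs, ?_⟩⟩
      rw [← hω]
      rw [Models, Stream'.drop_drop] at hn'
      exact hn'
    · cases n with
      | zero => exact (hn.ne_nil rfl).elim
      | succ n => exact ⟨n, s, hs, hn, Or.inr hn'⟩
  · rintro ⟨n, s, hs, hn, ⟨hF, hn'⟩ | hn'⟩
    · refine Or.inl ⟨s, hF, n, hn, ?_⟩
      rw [Models, Stream'.drop_drop]
      rw [← hω] at hn'
      exact hn'
    · exact Or.inr ⟨s, hs, n + 1, ⟨hn, hn'⟩, models_top A _⟩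

theorem exists_models_iff_sat (A : EBA D Ψ) {V : Stream' D → S → Prop} {f : BCp S}
    (h : ∀ p ∈ f.atoms, ∃ φ : RLTLp Ψ, ∀ x, Models A φ x ↔ V x p) :
    ∃ φ : RLTLp Ψ, ∀ x, Models A φ x ↔ f.Sat (V x) := by
  induction f with
  | atom s => exact h s rfl
  | tt => exact ⟨top A, fun x => by simp [models_top, BCp.Sat]⟩
  | ff => exact ⟨bot A, fun x => by simp [not_models_bot, BCp.Sat]⟩
  | and f g hf hg =>
    obtain ⟨φ, hφ⟩ := hf fun p hp => h p (Or.inl hp)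
    obtain ⟨ψ, hψ⟩ := hg fun p hp => h p (Or.inr hp)
    exact ⟨and φ ψ, fun x => by simp [Models, hφ, hψ, BCp.Sat]⟩
  | or f g hf hg =>
    obtain ⟨φ, hφ⟩ := hf fun p hp => h p (Or.inl hp)
    obtain ⟨ψ, hψ⟩ := hg fun p hp => h p (Or.inr hp)
    exact ⟨or φ ψ, fun x => by simp [Models, hφ, hψ, BCp.Sat]⟩

theorem exists_lang_eq_of_isNBA (A : EBA D Ψ) {M : ABA Ψ S} (hM : M.IsNBA) :
    ∃ φ : RLTLp Ψ, M.lang A = φ.lang A := by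
  obtain ⟨φ, hφ⟩ := exists_models_iff_sat A (V := M.AcceptsFrom A) (f := M.init) fun p hp => by
    obtain ⟨φ, hφ⟩ := exists_models_iff_acceptsByPaths A M p
    exact ⟨φ, fun x => (hφ x).trans ⟨ABA.acceptsFrom_of_acceptsByPaths (M.init_mem hp),
      ABA.acceptsByPaths_of_acceptsFrom hM (M.init_mem hp)⟩⟩
  exact ⟨φ, Set.ext fun x => (hφ x).symm⟩

end RLTLp

theorem theorem5 {D : Type u} {Ψ : Type v} [Nonempty D] (A : EBA D Ψ) :
    (∀ L : Set (Stream' D), OmegaRegular A L ↔ ∃ φ : RLTLp Ψ, L = φ.lang A) ∧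
    (∀ φ : RLTLp Ψ,
      (∃ tf : RLTLp Ψ → TT Ψ (RLTLp Ψ),
        RLTLp.IsDerivTF A tf φ ∧ {q | RLTLp.States tf φ q}.Finite) ∧
      ∀ (tf : RLTLp Ψ → TT Ψ (RLTLp Ψ)) (hfin : {q | RLTLp.States tf φ q}.Finite),
        RLTLp.IsDerivTF A tf φ → φ.lang A = (RLTLp.aba A tf φ hfin).lang A) := by
  refine ⟨fun L => ⟨?_, ?_⟩, fun φ => ⟨RLTLp.exists_isDerivTF_finite_states A φ,
    fun tf hfin htf => RLTLp.lang_eq_lang_aba hfin htf⟩⟩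
  · rintro ⟨S, M, hM, rfl⟩
    exact RLTLp.exists_lang_eq_of_isNBA A hM
  · rintro ⟨φ, rfl⟩
    obtain ⟨tf, htf, hfin⟩ := RLTLp.exists_isDerivTF_finite_states A φ
    rw [RLTLp.lang_eq_lang_aba hfin htf]
    exact ABA.omegaRegular_lang A _
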